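/- Let $n_1,n_2\ge 0$ be integers, $n=n_1+n_2$, let $I\subseteq\{1,\dots,n\}$ and $J=\{1,\dots,n\}\setminus I$, and put $k=|I|$, $m=|J|$. Then every $k\times m$ matrix $F(\lambda)$ of real rational functions in one variable $\lambda$ is represented by a perfect planar network in an annulus with $n_1$ boundary vertices on the outer circle, $n_2$ on the inner circle, sources $b_i$, $i\in I$, and sinks $b_j$, $j\in J$: there are such a network $N$ and nonzero real edge weights $w_e$ for which the boundary measurement matrix of $N$ equals $F$. The notions are as follows. A perfect planar network in an annulus consists of a finite directed graph (parallel edges allowed) embedded in the annulus, and a cut $\rho$: a simple oriented curve in the annulus from a base point on the inner circle to a base point on the outer circle, both distinct from the boundary vertices. The graph meets the boundary circles exactly in the boundary vertices; the labels $b_1,\dots,b_{n_1}$ run along the outer circle counterclockwise, and $b_{n_1+1},\dots,b_n$ along the inner circle clockwise, each time starting from the base point of the cut. A source has exactly one outgoing edge and no incoming edge, and a sink exactly one incoming edge and no outgoing edge. Every other vertex has degree $3$, with either exactly one incoming or exactly one outgoing edge. For a path $P=(e_1,\dots,e_r)$ from a source $b_i$ to a sink $b_j$ let $\operatorname{ind}(P)=\sum_s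 \operatorname{ind}(e_s)$ be its algebraic intersection number with $\rho$ (a crossing counts $+1$ if the tangents of $P$ and $\rho$, in this order, form a positively oriented basis, and $-1$ otherwise). Let $C_P$ be the closed curve obtained by adding to $P$ the counterclockwise arc from $b_j$ to $b_i$ if both lie on the same circle; and otherwise the counterclockwise arc from $b_j$ to the base point on its circle, the cut traversed to its other endpoint, and the counterclockwise arc from there to $b_i$. Let $c(C_P)\in\mathbb Z/2$ be the concordance number (the rotation number mod $2$): for a polygonal closed curve, the number mod $2$ of pairs of consecutive segments such that the interior of the cone spanned by their directing vectors contains the directing vector of a fixed oriented line $l$ that is not collinear to any segment; it does not depend on $l$. The weight of $P$ is $$w_P=(-1)^{c(C_P)-1}\lambda^{\operatorname{ind}(P)}\prod_{s=1}^r w_{e_s}=(-1)^{c(C_P)-1}\prod_{s=1}^r\bar w_{e_s},\qquad \bar w_e=w_e\lambda^{\operatorname{ind}(e)}.$$ The boundary measurement $M(i,j)$ is the sum of the weights of all paths from $b_i$ to $b_j$, a formal power series in the variables $\bar w_e$ that is a quotient of two polynomials in these variables; its value at real edge weights is the rational function of $\lambda$ obtained by substituting $\bar w_e=w_e\lambda^{\operatorname{ind}(e)}$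 in such a quotient whose denominator does not become zero. If $I=\{i_1<\dots<i_k\}$ and $J=\{j_1<\dots<j_m\}$, then the boundary measurement matrix is $\big(M(i_p,j_q)\big)_{1\le p\le k,\,1\le q\le m}$. -/

import Mathlib

noncomputable section

open scoped Topology Classical

namespace AnnularNetwork

/-! ### Polygonal curves in the plane -/

/-- The plane. Its norm is the maximum norm `max |x| |y|`. -/
abbrev Plane : Type := ℝ × ℝ

/-- The determinant of two plane vectors; it is positive iff `(u, v)` is a positively oriented
basis. -/
def det (u v : Plane) : ℝ := u.1 * v.2 - u.2 * v.1

/-- The set of points of the polygonal curve through a list of points. -/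
def trace : List Plane → Set Plane
  | [] => ∅
  | [a] => {a}
  | a :: b :: L => segment ℝ a b ∪ trace (b :: L)

/-- The polygonal curve through a list of points does not intersect itself
(and no two consecutive points of the list coincide). -/
def IsSimpleArc : List Plane → Prop
  | [] => True
  | [_] => True
  | a :: b :: L => a ≠ b ∧ segment ℝ a b ∩ trace (b :: L) ⊆ {b} ∧ IsSimpleArc (b :: L)

/-- The segments of a polygonal curve, as pairs (initial point, terminal point). -/
def segments (L : List Plane) : List (Plane × Plane) := L.zip L.tail

/-- The directing vectors of the oriented segments of a polygonal curve. -/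
def steps (L : List Plane) : List Plane := (segments L).map fun s => s.2 - s.1

/-- The contribution of two oriented segments in general position to the algebraic intersection
number `γ · ρ` (`s` is a segment of `γ`, and `r` is a segment of `ρ`): `1` if they cross and their
directing vectors form a positively oriented basis, `-1` if they cross the other way, and `0` if
they are disjoint. -/
def crossing (s r : Plane × Plane) : ℤ :=
  if (segment ℝ s.1 s.2 ∩ segment ℝ r.1 r.2).Nonempty then
    (SignType.sign (det (s.2 - s.1) (r.2 - r.1)) : ℤ) else 0

/-- The algebraic intersection number of two polygonal curves in general position. -/
def intersectionNumber (γ ρ : List Plane) : ℤ :=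
  ((segments γ).map fun s => ((segments ρ).map fun r => crossing s r).sum).sum

/-! ### The concordance number -/

/-- `l` belongs to the interior of the cone spanned by `u` and `v`. -/
def InOpenCone (l u v : Plane) : Prop :=
  det u v ≠ 0 ∧ ∃ a b : ℝ, 0 < a ∧ 0 < b ∧ l = a • u + b • v

/-- `c_l(C)` for a closed polygonal curve `C`, given by the cyclic list of the directing vectors of
its consecutive oriented segments, and an oriented line with directing vector `l`: the number,
modulo `2`, of pairs of consecutive segments whose open cone contains `l`. -/
def concordanceAlong (l : Plane) (C : List Plane) : ZMod 2 :=
  ((C.zip (C.rotate 1)).map fun p => if InOpenCone l p.1 p.2 then (1 : ZMod 2) else 0).sum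

/-- The concordance number `c(C)` of a closed polygonal curve `C`, given by the cyclic list of
the directing vectors of its consecutive oriented segments: the common value of `c_l(C)` for all
`l` that are not collinear to a segment of `C`. It is read off at `l = (1, t)` for
infinitesimally small `t > 0`, which is not collinear to any of the finitely many segments;
`concordanceAlong_eq_concordance` shows that every other admissible `l` gives the same value. -/
def concordance (C : List Plane) : ZMod 2 :=
  ((C.zip (C.rotate 1)).map fun p =>
    if ∀ᶠ t in 𝓝[>] (0 : ℝ), InOpenCone (1, t) p.1 p.2 then (1 : ZMod 2) else 0).sum

theorem inOpenCone_iff (l u v : Plane) : InOpenCone l u v ↔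
    (0 < det u v ∧ 0 < det l v ∧ 0 < det u l) ∨ (det u v < 0 ∧ det l v < 0 ∧ det u l < 0) := by
  obtain ⟨l1, l2⟩ := l
  obtain ⟨u1, u2⟩ := u
  obtain ⟨v1, v2⟩ := v
  constructor
  · rintro ⟨h0, a, b, ha, hb, h⟩
    simp only [Prod.smul_mk, smul_eq_mul, Prod.mk_add_mk, Prod.mk.injEq] at h
    obtain ⟨rfl, rfl⟩ := h
    have h1 : det (a * u1 + b * v1, a * u2 + b * v2) (v1, v2) = a * det (u1, u2) (v1, v2) := by
      simp only [det]; ring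
    have h2 : det (u1, u2) (a * u1 + b * v1, a * u2 + b * v2) = b * det (u1, u2) (v1, v2) := by
      simp only [det]; ring
    rw [h1, h2]
    rcases lt_or_gt_of_ne h0 with h | h
    · exact Or.inr ⟨h, mul_neg_of_pos_of_neg ha h, mul_neg_of_pos_of_neg hb h⟩
    · exact Or.inl ⟨h, mul_pos ha h, mul_pos hb h⟩
  · intro h
    have h0 : det (u1, u2) (v1, v2) ≠ 0 := by
      rcases h with h | h
      · exact h.1.ne'
      · exact h.1.ne
    refine ⟨h0, det (l1, l2) (v1, v2) / det (u1, u2) (v1, v2),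
      det (u1, u2) (l1, l2) / det (u1, u2) (v1, v2), ?_, ?_, ?_⟩
    · rcases h with h | h
      · exact div_pos h.2.1 h.1
      · exact div_pos_of_neg_of_neg h.2.1 h.1
    · rcases h with h | h
      · exact div_pos h.2.2 h.1
      · exact div_pos_of_neg_of_neg h.2.2 h.1
    · simp only [Prod.smul_mk, smul_eq_mul, Prod.mk_add_mk, Prod.mk.injEq]
      constructor <;> field_simp <;> simp only [det] <;> ring

theorem coneParity_aux {p q r s d D : ℝ} (hD : 0 < D) (hd : D * d = p * s - q * r)
    (hp : p ≠ 0) (hq : q ≠ 0) (hr : r ≠ 0) (hs : s ≠ 0)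
    (hc : ¬ (d = 0 ∧ p * r < 0)) :
    (if (0 < d ∧ 0 < s ∧ 0 < -q) ∨ (d < 0 ∧ s < 0 ∧ -q < 0) then (1 : ZMod 2) else 0) +
      (if (0 < d ∧ 0 < -r ∧ 0 < p) ∨ (d < 0 ∧ -r < 0 ∧ p < 0) then (1 : ZMod 2) else 0) =
      (if 0 < q ∧ 0 < p then (1 : ZMod 2) else 0) +
        (if 0 < s ∧ 0 < r then (1 : ZMod 2) else 0) := by
  have hD' : 0 < d → 0 < p * s - q * r := fun h => hd ▸ mul_pos hD h
  have hD'' : d < 0 → p * s - q * r < 0 := fun h => hd ▸ mul_neg_of_pos_of_neg hD h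
  have hD0 : d = 0 → p * s - q * r = 0 := fun h => by rw [← hd, h, mul_zero]
  have two : (1 : ZMod 2) + 1 = 0 := by decide
  rcases lt_or_gt_of_ne hp with hp | hp <;> rcases lt_or_gt_of_ne hq with hq | hq <;>
    rcases lt_or_gt_of_ne hr with hr | hr <;> rcases lt_or_gt_of_ne hs with hs | hs <;>
    rcases lt_trichotomy d 0 with h | h | h <;>
    first
    | (simp [hp, hq, hr, hs, h, hp.not_gt, hq.not_gt, hr.not_gt, hs.not_gt, h.not_gt]; done)
    | (simp [hp, hq, hr, hs, h, hp.not_gt, hq.not_gt, hr.not_gt, hs.not_gt, two]; done)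
    | (exfalso; exact hc ⟨h, by nlinarith⟩)
    | (exfalso
       have h1 := hD' h
       first
       | nlinarith [mul_pos hp hs, mul_pos hq hr] | nlinarith [mul_neg_of_neg_of_pos hp hs]
       | nlinarith [mul_neg_of_pos_of_neg hp hs])
    | (exfalso
       have h1 := hD'' h
       nlinarith)

/-- The two vectors do not point in opposite directions. -/
def NoCusp (u v : Plane) : Prop := ¬ ∃ c : ℝ, 0 < c ∧ v = -(c • u)

def cind (l u v : Plane) : ZMod 2 := if InOpenCone l u v then 1 else 0

theorem cind_add_of_pos {l l' u v : Plane} (hD : 0 < det l l') (hu : det l u ≠ 0)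
    (hv : det l v ≠ 0) (hu' : det l' u ≠ 0) (hv' : det l' v ≠ 0) (hc : NoCusp u v) :
    cind l u v + cind l' u v =
      (if 0 < det l u ∧ 0 < det u l' then (1 : ZMod 2) else 0) +
        (if 0 < det l v ∧ 0 < det v l' then (1 : ZMod 2) else 0) := by
  have anti : ∀ x y : Plane, det x y = - det y x := fun x y => by simp only [det]; ring
  have := coneParity_aux (p := det u l') (q := det l u) (r := det v l') (s := det l v)
    (d := det u v) hD (by simp only [det]; ring) (by rw [anti]; exact neg_ne_zero.2 hu') hu
    (by rw [anti]; exact neg_ne_zero.2 hv') hv ?_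
  · simp only [cind, inOpenCone_iff]
    rw [anti u l, anti l' v]
    exact this
  · rintro ⟨h0, h1⟩
    apply hc
    have hne : det u l' ≠ 0 := by rintro h; rw [h, zero_mul] at h1; exact lt_irrefl _ h1
    refine ⟨-(det v l' / det u l'), ?_, ?_⟩
    · rw [neg_pos]
      have : det v l' / det u l' = (det u l' * det v l') / (det u l') ^ 2 := by field_simp
      rw [this]
      exact div_neg_of_neg_of_pos h1 (by positivity)
    · ext
      · simp only [Prod.fst_neg, Prod.smul_fst, smul_eq_mul]
        field_simp
        simp only [det] at h0 ⊢
        linear_combination l'.1 * h0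
      · simp only [Prod.snd_neg, Prod.smul_snd, smul_eq_mul]
        field_simp
        simp only [det] at h0 ⊢
        linear_combination l'.2 * h0

theorem eventually_sign (a b : ℝ) : (∀ᶠ t in 𝓝[>] (0 : ℝ), 0 < a + t * b) ∨
    (∀ᶠ t in 𝓝[>] (0 : ℝ), a + t * b < 0) ∨ (a = 0 ∧ b = 0) := by
  have hc : Filter.Tendsto (fun t : ℝ => a + t * b) (𝓝[>] 0) (𝓝 a) := by
    have : Continuous fun t : ℝ => a + t * b := by fun_prop
    simpa using (this.tendsto 0).mono_left nhdsWithin_le_nhds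
  have hpos : ∀ᶠ t in 𝓝[>] (0 : ℝ), 0 < t := eventually_mem_nhdsWithin
  rcases lt_trichotomy a 0 with h | h | h
  · exact Or.inr (Or.inl (hc.eventually (gt_mem_nhds h)))
  · subst h
    rcases lt_trichotomy b 0 with h | h | h
    · refine Or.inr (Or.inl (hpos.mono fun t ht => ?_))
      rw [zero_add]; exact mul_neg_of_pos_of_neg ht h
    · exact Or.inr (Or.inr ⟨rfl, h⟩)
    · refine Or.inl (hpos.mono fun t ht => ?_)
      rw [zero_add]; exact mul_pos ht h
  · exact Or.inl (hc.eventually (lt_mem_nhds h))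

theorem eventually_det_left (u : Plane) (hu : u ≠ 0) :
    (∀ᶠ t in 𝓝[>] (0 : ℝ), 0 < det (1, t) u) ∨ (∀ᶠ t in 𝓝[>] (0 : ℝ), det (1, t) u < 0) := by
  have h1 : ∀ t : ℝ, det (1, t) u = u.2 + t * (-u.1) := fun t => by simp only [det]; ring
  simp only [h1]
  rcases eventually_sign u.2 (-u.1) with h | h | h
  · exact Or.inl h
  · exact Or.inr h
  · exact absurd (Prod.ext (neg_eq_zero.1 h.2) h.1) hu

theorem eventually_inOpenCone (u v : Plane) (hu : u ≠ 0) (hv : v ≠ 0) :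
    ∀ᶠ t in 𝓝[>] (0 : ℝ),
      (InOpenCone (1, t) u v ↔ ∀ᶠ t in 𝓝[>] (0 : ℝ), InOpenCone (1, t) u v) := by
  have anti : ∀ x y : Plane, det x y = - det y x := fun x y => by simp only [det]; ring
  have key : (∀ᶠ t in 𝓝[>] (0 : ℝ), InOpenCone (1, t) u v) ∨
      (∀ᶠ t in 𝓝[>] (0 : ℝ), ¬ InOpenCone (1, t) u v) := by
    simp only [inOpenCone_iff, anti u (1, _)]
    rcases lt_trichotomy (det u v) 0 with h | h | h <;>
      rcases eventually_det_left u hu with h1 | h1 <;>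
      rcases eventually_det_left v hv with h2 | h2 <;>
      first
      | (left; filter_upwards [h1, h2] with t h1 h2; grind)
      | (right; filter_upwards [h1, h2] with t h1 h2; grind)
  rcases key with h | h
  · exact h.mono fun t ht => ⟨fun _ => h, fun _ => ht⟩
  · refine h.mono fun t ht => ⟨fun h' => absurd h' ht, fun h' => ?_⟩
    exact absurd (h'.and h).exists (fun ⟨_, h1, h2⟩ => h2 h1)

theorem sum_zip_rotate (f : Plane → ZMod 2) (C : List Plane) :
    ((C.zip (C.rotate 1)).map fun p => f p.1 + f p.2).sum = 0 := by
  rw [List.sum_map_add]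
  have h1 : (C.zip (C.rotate 1)).map (fun p => f p.1) = C.map f := by
    conv_rhs => rw [← List.map_fst_zip (l₁ := C) (l₂ := C.rotate 1) (by simp), List.map_map]
    rfl
  have h2 : (C.zip (C.rotate 1)).map (fun p => f p.2) = (C.rotate 1).map f := by
    conv_rhs => rw [← List.map_snd_zip (l₁ := C) (l₂ := C.rotate 1) (by simp), List.map_map]
    rfl
  rw [h1, h2, ((List.rotate_perm C 1).map f).sum_eq]
  exact CharTwo.add_self_eq_zero _

theorem concordanceAlong_eq_of_pos {l l' : Plane} {C : List Plane} (hD : 0 < det l l')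
    (h : ∀ u ∈ C, det l u ≠ 0) (h' : ∀ u ∈ C, det l' u ≠ 0)
    (hc : ∀ p ∈ C.zip (C.rotate 1), NoCusp p.1 p.2) :
    concordanceAlong l C = concordanceAlong l' C := by
  have h0 : ((C.zip (C.rotate 1)).map fun p => cind l p.1 p.2 + cind l' p.1 p.2).sum = 0 := by
    rw [← sum_zip_rotate (fun w => if 0 < det l w ∧ 0 < det w l' then (1 : ZMod 2) else 0) C]
    refine congrArg List.sum (List.map_congr_left fun p hp => ?_)
    have hm := List.of_mem_zip (a := p.1) (b := p.2) hp
    have hm2 : p.2 ∈ C := List.mem_rotate.1 hm.2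
    exact cind_add_of_pos hD (h _ hm.1) (h _ hm2) (h' _ hm.1) (h' _ hm2) (hc p hp)
  rw [List.sum_map_add] at h0
  exact (CharTwo.add_eq_zero).1 h0

/-- The concordance number is the common value of all `c_l(C)`. -/
theorem concordanceAlong_eq_concordance {l : Plane} {C : List Plane}
    (h : ∀ u ∈ C, det l u ≠ 0) (hc : ∀ p ∈ C.zip (C.rotate 1), NoCusp p.1 p.2) :
    concordanceAlong l C = concordance C := by
  rcases eq_or_ne C [] with rfl | hC
  · simp [concordanceAlong, concordance]
  obtain ⟨w, hw⟩ := List.exists_mem_of_ne_nil C hC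
  have hne : ∀ u ∈ C, u ≠ 0 := fun u hu h0 => h u hu (by simp [h0, det])
  have hl : l ≠ 0 := fun h0 => h w hw (by simp [h0, det])
  have e1 : ∀ᶠ t in 𝓝[>] (0 : ℝ), det (1, t) l ≠ 0 := by
    rcases eventually_det_left l hl with h | h
    · exact h.mono fun t ht => ht.ne'
    · exact h.mono fun t ht => ht.ne
  have e2 : ∀ᶠ t in 𝓝[>] (0 : ℝ), ∀ u ∈ {u | u ∈ C}, det (1, t) u ≠ 0 := by
    refine (Filter.eventually_all_finite (List.finite_toSet C)).2 fun u hu => ?_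
    rcases eventually_det_left u (hne u hu) with h | h
    · exact h.mono fun t ht => ht.ne'
    · exact h.mono fun t ht => ht.ne
  have e3 : ∀ᶠ t in 𝓝[>] (0 : ℝ), ∀ p ∈ {p | p ∈ C.zip (C.rotate 1)},
      (InOpenCone (1, t) p.1 p.2 ↔ ∀ᶠ t in 𝓝[>] (0 : ℝ), InOpenCone (1, t) p.1 p.2) := by
    refine (Filter.eventually_all_finite (List.finite_toSet _)).2 fun p hp => ?_
    have hm := List.of_mem_zip (a := p.1) (b := p.2) hp
    exact eventually_inOpenCone _ _ (hne _ hm.1) (hne _ (List.mem_rotate.1 hm.2))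
  obtain ⟨t, h1, h2, h3⟩ := (e1.and (e2.and e3)).exists
  have h4 : concordanceAlong (1, t) C = concordance C := by
    refine congrArg List.sum (List.map_congr_left fun p hp => ?_)
    simp only [h3 p hp]
  rw [← h4]
  rcases lt_or_gt_of_ne h1 with h5 | h5
  · refine concordanceAlong_eq_of_pos ?_ h h2 hc
    have : det l (1, t) = - det (1, t) l := by simp only [det]; ring
    rw [this]; exact neg_pos.2 h5
  · exact (concordanceAlong_eq_of_pos h5 h2 h hc).symm

/-! ### The annulus -/

/-- The interior of the annulus. The annulus is `{x | 1 ≤ ‖x‖ ≤ 2}` for the maximum norm, so that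
its boundary circles are polygonal curves. -/
def openAnnulus : Set Plane := {x | 1 < ‖x‖ ∧ ‖x‖ < 2}

/-- The parametrization, of period `8`, of the circle `{x | ‖x‖ = 1}` by arc length, in the
counterclockwise direction. The corners are at the even integers. -/
def circlePoint (t : ℝ) : Plane :=
  let u := 8 * Int.fract (t / 8)
  if u < 2 then (1, u - 1) else
  if u < 4 then (3 - u, 1) else
  if u < 6 then (-1, 5 - u) else (u - 7, -1)

/-- For `a < b ≤ a + 8`: the polygonal curve that goes counterclockwise along the circle of
radius `r` from the point with parameter `a` to the point with parameter `b`. The intermediate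
points are the corners, that is, the points whose parameter is an even integer between
`a` and `b`. -/
def ccwArc (r a b : ℝ) : List Plane :=
  r • circlePoint a ::
    ((List.range (⌈b / 2⌉ - ⌊a / 2⌋ - 1).toNat).map fun i =>
      r • circlePoint (2 * ((⌊a / 2⌋ : ℝ) + 1 + i))) ++ [r • circlePoint b]

/-! ### Perfect planar networks in an annulus -/

/-- The data of a directed graph drawn in the annulus with polygonal edges, with `n₁` boundary
vertices on the outer circle and `n₂` on the inner circle, and of a polygonal cut. Boundary vertices
are represented by their labels, counted from `0`: the labels `i < n₁` lie on the outer circle,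
the other ones on the inner circle. -/
structure Diagram (n₁ n₂ : ℕ) where
  /-- the internal vertices -/
  V : Type
  /-- the edges; different edges may have the same endpoints -/
  E : Type
  /-- the initial vertex of an edge -/
  src : E → Fin (n₁ + n₂) ⊕ V
  /-- the terminal vertex of an edge -/
  tgt : E → Fin (n₁ + n₂) ⊕ V
  /-- the parameters of the boundary vertices on their circles -/
  param : Fin (n₁ + n₂) → ℝ
  /-- the positions of the internal vertices -/
  innerPos : V → Plane
  /-- the bends of an edge, listed from its initial to its terminal vertex -/
  bends : E → List Plane
  /-- the parameter of the base point of the cut on the inner circle -/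
  innerBase : ℝ
  /-- the parameter of the base point of the cut on the outer circle -/
  outerBase : ℝ
  /-- the bends of the cut, listed from the inner to the outer circle -/
  cutBends : List Plane

namespace Diagram

variable {n₁ n₂ : ℕ} (D : Diagram n₁ n₂)

/-- The position of a boundary vertex. -/
def boundaryPos (i : Fin (n₁ + n₂)) : Plane :=
  (if i.val < n₁ then (2 : ℝ) else 1) • circlePoint (D.param i)

/-- The position of a vertex. -/
def pos : Fin (n₁ + n₂) ⊕ D.V → Plane := Sum.elim D.boundaryPos D.innerPos

/-- The polygonal curve that represents an edge. -/
def curve (e : D.E) : List Plane := D.pos (D.src e) :: D.bends e ++ [D.pos (D.tgt e)]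

/-- The cut, an oriented curve from the inner to the outer circle. -/
def cut : List Plane :=
  circlePoint D.innerBase :: D.cutBends ++ [(2 : ℝ) • circlePoint D.outerBase]

/-- The number of edges that start at a vertex. -/
def outDegree (v : Fin (n₁ + n₂) ⊕ D.V) : ℕ := {e | D.src e = v}.ncard

/-- The number of edges that end at a vertex. -/
def inDegree (v : Fin (n₁ + n₂) ⊕ D.V) : ℕ := {e | D.tgt e = v}.ncard

/-- `D.IsPath u v P`: the list of edges `P` is a path from `u` to `v`. -/
def IsPath (u v : Fin (n₁ + n₂) ⊕ D.V) : List D.E → Prop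
  | [] => u = v
  | e :: P => D.src e = u ∧ IsPath (D.tgt e) v P

/-- The index `ind(e)` of an edge: its algebraic intersection number with the cut. -/
def ind (e : D.E) : ℤ := intersectionNumber (D.curve e) D.cut

/-- The directing vectors of the segments of the curve that joins the sink `b_j` to the
source `b_i` and that closes up a path from `b_i` to `b_j`. If both vertices lie on the same
circle, it goes counterclockwise along this circle. Otherwise, it goes counterclockwise
along the circle of `b_j` to the base point of the cut, then along the cut to the other base
point, and then counterclockwise along the circle of `b_i`. -/
def closingSteps (i j : Fin (n₁ + n₂)) : List Plane :=
  if i.val < n₁ ↔ j.val < n₁ then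
    steps (ccwArc (if i.val < n₁ then 2 else 1) (D.param j)
      (if D.param j < D.param i then D.param i else D.param i + 8))
  else if j.val < n₁ then
    steps (ccwArc 2 (D.param j) (D.outerBase + 8)) ++ steps D.cut.reverse ++
      steps (ccwArc 1 (D.innerBase - 8) (D.param i))
  else
    steps (ccwArc 1 (D.param j) D.innerBase) ++ steps D.cut ++
      steps (ccwArc 2 D.outerBase (D.param i))

/-- The closed curve `C_P` of a path `P` from the source `b_i` to the sink `b_j`, as the cyclic list
of the directing vectors of its oriented segments. -/
def closedCurve (i j : Fin (n₁ + n₂)) (P : List D.E) : List Plane :=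
  P.flatMap (fun e => steps (D.curve e)) ++ D.closingSteps i j

/-- The sign `(-1)^(c(C_P) - 1)` of a path `P` from the source `b_i` to the sink `b_j`. -/
def pathSign (i j : Fin (n₁ + n₂)) (P : List D.E) : ℤ :=
  (-1) ^ ((concordance (D.closedCurve i j P)).val + 1)

/-- The boundary measurement `M(i, j)` as a formal power series in the modified edge weights: the sum
over all paths `P` from `b_i` to `b_j` of the sign of `P` times the product of the variables of
the edges of `P`. Thus the coefficient of a monomial is the sum of the signs of the finitely many
paths whose product of variables is this monomial. -/
def boundarySeries (i j : Fin (n₁ + n₂)) : MvPowerSeries D.E ℤ := fun s =>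
  ∑ᶠ P ∈ {P : List D.E | D.IsPath (Sum.inl i) (Sum.inl j) P ∧
    (P.map fun e => Finsupp.single e 1).sum = s}, D.pathSign i j P

/-- The modified weight `w_e * λ ^ ind(e)` of an edge, for real edge weights `w`; the parameter `λ`
is the variable of the field of rational functions. -/
def modifiedWeight (w : D.E → ℝ) (e : D.E) : RatFunc ℝ :=
  RatFunc.C (w e) * RatFunc.X ^ D.ind e

/-- The rational function `f` of `λ` is the value at the real edge weights `w` of the boundary
measurement `M(i, j)`: the formal series `M(i, j)` is the quotient `p / q` of two polynomials in the
modified edge weights, and `f` is the value of `p / q` at the modified edge weights, where `q`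
does not vanish. -/
def BoundaryMeasurementEq (w : D.E → ℝ) (i j : Fin (n₁ + n₂)) (f : RatFunc ℝ) : Prop :=
  ∃ p q : MvPolynomial D.E ℤ,
    (q : MvPowerSeries D.E ℤ) * D.boundarySeries i j = (p : MvPowerSeries D.E ℤ) ∧
    MvPolynomial.aeval (D.modifiedWeight w) q ≠ 0 ∧
    f = MvPolynomial.aeval (D.modifiedWeight w) p / MvPolynomial.aeval (D.modifiedWeight w) q

theorem BoundaryMeasurementEq.unique {w : D.E → ℝ} {i j : Fin (n₁ + n₂)} {f g : RatFunc ℝ}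
    (hf : D.BoundaryMeasurementEq w i j f) (hg : D.BoundaryMeasurementEq w i j g) : f = g := by
  obtain ⟨p, q, h1, h2, rfl⟩ := hf
  obtain ⟨p', q', h1', h2', rfl⟩ := hg
  rw [div_eq_div_iff h2 h2', ← map_mul, ← map_mul]
  congr 1
  apply MvPolynomial.coe_injective
  simp only [MvPolynomial.coe_mul, ← h1, ← h1']
  ring

/-- Only finitely many paths contribute to a coefficient of the boundary measurement. -/
theorem finite_paths (s : D.E →₀ ℕ) :
    {P : List D.E | (P.map fun e => Finsupp.single e 1).sum = s}.Finite := by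
  have h : ∀ P : List D.E, (P.map fun e => Finsupp.single e 1).sum =
      Multiset.toFinsupp (P : Multiset D.E) := by
    intro P
    induction P with
    | nil => simp
    | cons e P ih => rw [List.map_cons, List.sum_cons, ih, ← Multiset.cons_coe,
        ← Multiset.singleton_add, map_add, Multiset.toFinsupp_singleton]
  refine (Multiset.toFinset (Multiset.toFinsupp.symm s).lists).finite_toSet.subset fun P hP => ?_
  have h3 : Multiset.toFinsupp (P : Multiset D.E) = s := by rw [← h]; exact hP
  simp only [Finset.mem_coe, Multiset.mem_toFinset, Multiset.mem_lists_iff, ← h3]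
  simp

end Diagram

/-- A perfect planar network (without its edge weights) in the annulus, whose boundary vertices with
labels in `I` are sources and whose other boundary vertices are sinks. Parallel edges are allowed,
loops are not. The drawing is an embedded polygonal one; since no two segments overlap and edges run
inside the open annulus, the curves `C_P` have no cusps, and edges and cut are transversal to the
boundary circles. -/
structure Network (n₁ n₂ : ℕ) (I : Finset (Fin (n₁ + n₂))) extends Diagram n₁ n₂ where
  finite_V : Finite V
  finite_E : Finite E
  src_ne_tgt : ∀ e, src e ≠ tgt e
  source : ∀ i ∈ I, toDiagram.outDegree (Sum.inl i) = 1 ∧ toDiagram.inDegree (Sum.inl i) = 0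
  sink : ∀ i ∉ I, toDiagram.outDegree (Sum.inl i) = 0 ∧ toDiagram.inDegree (Sum.inl i) = 1
  /-- every internal vertex is white (one incoming and two outgoing edges) or black (two incoming
  edges and one outgoing edge) -/
  white_or_black : ∀ v : V,
    (toDiagram.inDegree (Sum.inr v) = 1 ∧ toDiagram.outDegree (Sum.inr v) = 2) ∨
    (toDiagram.inDegree (Sum.inr v) = 2 ∧ toDiagram.outDegree (Sum.inr v) = 1)
  /-- on the outer circle, the labels increase counterclockwise from the base point of the cut -/
  param_outer : ∀ i, i.val < n₁ → outerBase < param i ∧ param i < outerBase + 8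
  param_outer_lt : ∀ i j, i < j → j.val < n₁ → param i < param j
  /-- on the inner circle, the labels increase clockwise from the base point of the cut -/
  param_inner : ∀ i, n₁ ≤ i.val → innerBase - 8 < param i ∧ param i < innerBase
  param_inner_lt : ∀ i j, i < j → n₁ ≤ i.val → param j < param i
  innerPos_mem : ∀ v, innerPos v ∈ openAnnulus
  innerPos_injective : Function.Injective innerPos
  /-- every edge is a simple arc -/
  edge_simple : ∀ e, IsSimpleArc (toDiagram.curve e)
  /-- every edge runs inside the annulus and meets its boundary at boundary vertices only -/
  edge_mem : ∀ e, ∀ x ∈ trace (toDiagram.curve e),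
    x ∈ openAnnulus ∨ ∃ i, x = toDiagram.boundaryPos i
  /-- an edge passes through no vertices other than its endpoints -/
  edge_vertex : ∀ e v, toDiagram.pos v ∈ trace (toDiagram.curve e) → v = src e ∨ v = tgt e
  /-- two different edges meet at vertices only -/
  edge_disjoint : ∀ e f, e ≠ f →
    ∀ x ∈ trace (toDiagram.curve e) ∩ trace (toDiagram.curve f), ∃ v, x = toDiagram.pos v
  /-- the cut is a simple arc -/
  cut_simple : IsSimpleArc toDiagram.cut
  /-- the cut runs inside the annulus and meets its boundary at the base points only -/
  cut_mem : ∀ x ∈ trace toDiagram.cut, x ∈ openAnnulus ∨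
    x = circlePoint innerBase ∨ x = (2 : ℝ) • circlePoint outerBase
  /-- the edges and the cut are in general position: no vertex or bend of one of them lies on the
  other, so that they meet in finitely many transversal crossings of segments -/
  general_position : ∀ e,
    (∀ x ∈ toDiagram.curve e, x ∉ trace toDiagram.cut) ∧
    (∀ x ∈ toDiagram.cut, x ∉ trace (toDiagram.curve e))

/-- The `k × m` matrix `F` of rational functions is represented by the network `N`: it is
the boundary measurement matrix of `N` for some nonzero real edge weights. The rows (columns) of
this matrix correspond to the sources (sinks) in the increasing order of their labels. -/
def Network.Represents {n₁ n₂ k m : ℕ} {I : Finset (Fin (n₁ + n₂))} (N : Network n₁ n₂ I)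
    (hI : I.card = k) (hJ : Iᶜ.card = m) (F : Matrix (Fin k) (Fin m) (RatFunc ℝ)) : Prop :=
  ∃ w : N.E → ℝ, (∀ e, w e ≠ 0) ∧
    ∀ p q, N.BoundaryMeasurementEq w (I.orderEmbOfFin hI p) (Iᶜ.orderEmbOfFin hJ q) (F p q)

end AnnularNetwork

end

/-! The network is a ladder. Concentric closed columns, which are circles of the maximum norm, each
oriented one way or the other, are joined by short rungs on the right side of the annulus. The cut
is a straight segment on the left. Every end of a rung is a vertex: the start of a rung is white,
its terminus is black, and boundary vertices are ends on the two boundary circles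
(`Ladder.network`).

Signs are harmless. The concordance number is read off at the direction `(1, t)` with `t > 0`
infinitesimal, and two consecutive steps that both go up or both go down do not contribute to it.
The drawing makes all edges at a vertex go up, or all of them down. So the sign of a path is a
product of signs of its edges times a sign that depends on its endpoints only
(`VertexMonotone.pathSign_eq`). The edge signs are absorbed into the weights and the endpoint sign
into the prescribed matrix.

What remains is linear algebra. The generating functions of paths to a fixed sink solve a linear
system, and Cramer's rule writes them as quotients of polynomials. Hence a boundary measurement can
be found by solving the system over the field of rational functions, provided that the homogeneous
system has only the zero solution (`boundaryMeasurementEq_of_system`). A solution is called a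
potential. At each height between two rungs it gives a state, a vector with one entry per column. A
rung relates the states below and above it (`Circuit.step`), and because of the crossings with the
cut the state at the bottom is `λ` times the state at the top (`Circuit.state_wrap`).

Rungs between neighbouring columns act as transvections. A bump, which is a rung parallel to an edge
of one column, multiplies by the sum `w + w'` of two weights. Together they realize every invertible
real matrix (`Realizable.of_det_ne_zero`). Conjugating by such matrices lets a source read any
nonzero linear form of the state and lets a sink add its potential along any nonzero vector
(`exists_isBlock`). A bump with `w + w' = 0` makes the potential ahead of it vanish and leaves the
potential behind it free, although no weight is zero.

Finally, write the matrix, with the endpoint signs, as `P i j / Q`. Each label `j` gets registers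
`0, …, d + 1`. One turn round the annulus shifts them, so that register `p ≤ d` contains `λ ^ p`
times register `0`. The sink `j` feeds the last register, and a companion matrix with the
coefficients of `Q` closes the loop. Vanishing bumps at both ends of the chain turn this into `λ Q x
= δ j` for the content `x` of register `0` at the top. The source `i` reads the coefficients of `P i
j` and therefore obtains `P i j / Q` (`program_spec`). -/

noncomputable section

open scoped Topology Classical

namespace AnnularNetwork

/-! ### Generating functions of paths and Cramer's rule. -/

namespace Diagram

variable {n₁ n₂ : ℕ} (D : Diagram n₁ n₂)

/-- The generating function of the paths from `u` to `v`, where a path is counted with the product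
of the coefficients `τ` of its edges. -/
def pathSeries (τ : D.E → ℤ) (u v : Fin (n₁ + n₂) ⊕ D.V) : MvPowerSeries D.E ℤ := fun s =>
  ∑ᶠ P ∈ {P : List D.E | D.IsPath u v P ∧ (P.map fun e => Finsupp.single e 1).sum = s},
    (P.map τ).prod

theorem coeff_pathSeries (τ : D.E → ℤ) (u v : Fin (n₁ + n₂) ⊕ D.V) (s : D.E →₀ ℕ) :
    MvPowerSeries.coeff s (D.pathSeries τ u v) =
    ∑ᶠ P ∈ {P : List D.E | D.IsPath u v P ∧ (P.map fun e => Finsupp.single e 1).sum = s},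
      (P.map τ).prod := rfl

/-- Decomposition by the first edge: a path is empty, or it is an edge followed by a path from the
end of that edge. All sums are finite by `finite_paths`. -/
theorem pathSeries_eq [Fintype D.E] (τ : D.E → ℤ) (u v : Fin (n₁ + n₂) ⊕ D.V) :
    D.pathSeries τ u v = (if u = v then 1 else 0) +
      ∑ e, if D.src e = u then MvPowerSeries.C (τ e) * (MvPowerSeries.X e *
        D.pathSeries τ (D.tgt e) v) else 0 := by
  ext s
  have hset : {P : List D.E | D.IsPath u v P ∧ (P.map fun e => Finsupp.single e 1).sum = s} =
      {P | P = [] ∧ u = v ∧ s = 0} ∪ ⋃ e : D.E, List.cons e '' {P | D.src e = u ∧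
        D.IsPath (D.tgt e) v P ∧
        Finsupp.single e 1 + (P.map fun e => Finsupp.single e 1).sum = s} := by
    ext P
    cases P with
    | nil => simp [IsPath, eq_comm]
    | cons e P => simp [IsPath, and_assoc]
  have hfin : ∀ (e : D.E), {P : List D.E | D.src e = u ∧ D.IsPath (D.tgt e) v P ∧
        Finsupp.single e 1 + (P.map fun e => Finsupp.single e 1).sum = s}.Finite := by
    intro e
    refine (D.finite_paths (s - Finsupp.single e 1)).subset ?_
    rintro P ⟨-, -, rfl⟩
    simp
  rw [coeff_pathSeries, hset, finsum_mem_union, finsum_mem_iUnion, map_add, map_sum,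
    finsum_eq_sum_of_fintype (fun e : D.E => ∑ᶠ P ∈ List.cons e '' _, (P.map τ).prod)]
  · congr 1
    · by_cases h : u = v ∧ s = 0
      · obtain ⟨rfl, rfl⟩ := h
        simp
      · have : {P : List D.E | P = [] ∧ u = v ∧ s = 0} = ∅ := by
          ext P; simp only [Set.mem_ofPred_eq, h, and_false, Set.mem_empty_iff_false]
        rw [this, finsum_mem_empty]
        split_ifs with h1
        · rw [MvPowerSeries.coeff_one, if_neg (fun h2 => h ⟨h1, h2⟩)]
        · simp
    · refine Finset.sum_congr rfl fun e _ => ?_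
      rw [finsum_mem_image (List.cons_injective.injOn)]
      by_cases hu : D.src e = u
      · rw [if_pos hu, MvPowerSeries.coeff_C_mul, MvPowerSeries.X,
          MvPowerSeries.coeff_monomial_mul]
        simp only [List.map_cons, List.prod_cons]
        rw [← mul_finsum_mem' _ _ (hfin e)]
        congr 1
        split_ifs with h
        · rw [coeff_pathSeries, one_mul]
          have : {P : List D.E | D.src e = u ∧ D.IsPath (D.tgt e) v P ∧
              Finsupp.single e 1 + (P.map fun e => Finsupp.single e 1).sum = s} =
              {P : List D.E | D.IsPath (D.tgt e) v P ∧
                (P.map fun e => Finsupp.single e 1).sum = s - Finsupp.single e 1} := by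
            ext P
            simp only [Set.mem_ofPred_eq, hu, true_and]
            refine and_congr_right fun _ => ?_
            rw [eq_tsub_iff_add_eq_of_le h, add_comm]
          rw [this]
        · have : {P : List D.E | D.src e = u ∧ D.IsPath (D.tgt e) v P ∧
              Finsupp.single e 1 + (P.map fun e => Finsupp.single e 1).sum = s} = ∅ := by
            ext P
            simp only [Set.mem_ofPred_eq, Set.mem_empty_iff_false, iff_false]
            rintro ⟨-, -, rfl⟩
            exact h le_self_add
          rw [this, finsum_mem_empty]
      · have : {P : List D.E | D.src e = u ∧ D.IsPath (D.tgt e) v P ∧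
              Finsupp.single e 1 + (P.map fun e => Finsupp.single e 1).sum = s} = ∅ := by
            ext P
            simp [hu]
        rw [this, finsum_mem_empty, if_neg hu, map_zero]
  · intro e f hef
    rw [Function.onFun, Set.disjoint_left]
    rintro _ ⟨P, -, rfl⟩ ⟨Q, -, h⟩
    exact hef (List.cons.inj h).1.symm
  · exact fun e => (hfin e).image _
  · rw [Set.disjoint_left]
    rintro P ⟨rfl, -⟩ h
    simp at h
  · exact (Set.finite_singleton []).subset fun P h => h.1
  · exact Set.finite_iUnion fun e => (hfin e).image _

/-- The matrix of the linear system whose solutions are the generating functions of the paths,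
for edge weights `x`. -/
def systemMatrix {R : Type*} [CommRing R] [Fintype D.E] (x : D.E → R) :
    Matrix (Fin (n₁ + n₂) ⊕ D.V) (Fin (n₁ + n₂) ⊕ D.V) R :=
  1 - Matrix.of fun u v => ∑ e, if D.src e = u ∧ D.tgt e = v then x e else 0

theorem systemMatrix_mulVec {R : Type*} [CommRing R] [Fintype D.E] [Fintype D.V] (x : D.E → R)
    (φ : Fin (n₁ + n₂) ⊕ D.V → R) (u : Fin (n₁ + n₂) ⊕ D.V) :
    (D.systemMatrix x).mulVec φ u =
      φ u - ∑ e, if D.src e = u then x e * φ (D.tgt e) else 0 := by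
  rw [systemMatrix, Matrix.sub_mulVec, Matrix.one_mulVec, Pi.sub_apply, Matrix.mulVec, dotProduct]
  congr 1
  simp only [Matrix.of_apply, Finset.sum_mul, ite_mul, zero_mul]
  rw [Finset.sum_comm]
  refine Finset.sum_congr rfl fun e _ => ?_
  by_cases h : D.src e = u <;> simp [h]

/-- The same polynomial matrix is specialized twice: to power series, where the paths solve the
system, and to rational functions, where the weights are substituted. -/
theorem systemMatrix_map {R S : Type*} [CommRing R] [CommRing S] [Fintype D.E] [Fintype D.V] (f : R →+* S)
    (x : D.E → R) : f.mapMatrix (D.systemMatrix x) = D.systemMatrix fun e => f (x e) := by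
  ext u v
  rw [RingHom.mapMatrix_apply, Matrix.map_apply, systemMatrix, systemMatrix, Matrix.sub_apply,
    Matrix.sub_apply, map_sub, Matrix.of_apply, Matrix.of_apply, map_sum, Matrix.one_apply,
    Matrix.one_apply]
  congr 1
  · split_ifs <;> simp
  · refine Finset.sum_congr rfl fun e _ => ?_
    split_ifs <;> simp

/-- A boundary measurement can be computed by solving a linear system over the field of rational
functions, as soon as the sign of a path is the product of signs of its edges, up to a sign that
depends on the endpoints only. -/
theorem boundaryMeasurementEq_of_system [Fintype D.E] [Fintype D.V] (τ : D.E → ℤ)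
    (hτ : ∀ e, τ e * τ e = 1) (σ : ℤ) (hσ : σ * σ = 1) (i j : Fin (n₁ + n₂))
    (hsign : ∀ P, D.IsPath (Sum.inl i) (Sum.inl j) P → D.pathSign i j P = σ * (P.map τ).prod)
    (w : D.E → ℝ)
    (huniq : ∀ φ : Fin (n₁ + n₂) ⊕ D.V → RatFunc ℝ,
      (∀ u, φ u = ∑ e, if D.src e = u then D.modifiedWeight w e * φ (D.tgt e) else 0) → φ = 0)
    (f : RatFunc ℝ)
    (hf : ∀ φ : Fin (n₁ + n₂) ⊕ D.V → RatFunc ℝ,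
      (∀ u, φ u = (if u = Sum.inl j then 1 else 0) +
        ∑ e, if D.src e = u then D.modifiedWeight w e * φ (D.tgt e) else 0) →
      φ (Sum.inl i) = σ * f) :
    D.BoundaryMeasurementEq (fun e => τ e * w e) i j f := by
  -- The formal variables stand for weights that contain the signs `τ e`. Substituting `τ e * w e`
  -- cancels these signs, since `τ e * τ e = 1`, and leaves the system for `w`.
  set B : Matrix (Fin (n₁ + n₂) ⊕ D.V) (Fin (n₁ + n₂) ⊕ D.V) (MvPolynomial D.E ℤ) :=
    D.systemMatrix fun e => MvPolynomial.C (τ e) * MvPolynomial.X e with hB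
  have haeval : ∀ e, MvPolynomial.aeval (D.modifiedWeight fun e => τ e * w e)
      (MvPolynomial.C (τ e) * MvPolynomial.X e : MvPolynomial D.E ℤ) = D.modifiedWeight w e := by
    intro e
    have h1 : ((τ e : ℤ) : RatFunc ℝ) * (τ e : ℤ) = 1 := by exact_mod_cast hτ e
    rw [map_mul, MvPolynomial.aeval_X, MvPolynomial.aeval_C, modifiedWeight, modifiedWeight,
      map_mul, map_intCast]
    simp only [eq_intCast]
    rw [← mul_assoc, ← mul_assoc, h1, one_mul]
  set g : MvPolynomial D.E ℤ →+* RatFunc ℝ :=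
    (MvPolynomial.aeval (D.modifiedWeight fun e => τ e * w e) :
      MvPolynomial D.E ℤ →ₐ[ℤ] RatFunc ℝ).toRingHom with hg
  have hBg : g.mapMatrix B = D.systemMatrix (D.modifiedWeight w) := by
    rw [hB, systemMatrix_map]
    congr 1
    funext e
    exact haeval e
  have hdet : (D.systemMatrix (D.modifiedWeight w)).det ≠ 0 := by
    intro h0
    obtain ⟨φ, hφ, h⟩ := Matrix.exists_mulVec_eq_zero_iff.2 h0
    refine hφ (huniq φ fun u => ?_)
    have := congrFun h u
    rw [systemMatrix_mulVec, Pi.zero_apply] at this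
    exact sub_eq_zero.1 this
  have hseries : (MvPolynomial.coeToMvPowerSeries.ringHom (σ := D.E) (R := ℤ)).mapMatrix B =
      D.systemMatrix fun e => MvPowerSeries.C (τ e) * MvPowerSeries.X e := by
    rw [hB, systemMatrix_map]
    congr 1
    funext e
    rw [MvPolynomial.coeToMvPowerSeries.ringHom_apply, MvPolynomial.coe_mul, MvPolynomial.coe_C,
      MvPolynomial.coe_X]
  have hsol : (D.systemMatrix fun e => MvPowerSeries.C (τ e) * MvPowerSeries.X e).mulVec
      (fun u => D.pathSeries τ u (Sum.inl j)) = Pi.single (Sum.inl j) 1 := by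
    funext u
    rw [systemMatrix_mulVec, pathSeries_eq]
    simp only [mul_assoc]
    rw [add_sub_cancel_right, Pi.single_apply]
  have hcramer : ((B.det : MvPolynomial D.E ℤ) : MvPowerSeries D.E ℤ) *
      D.pathSeries τ (Sum.inl i) (Sum.inl j) =
      -- Multiplication of the system by the adjugate matrix; no invertibility of the determinant is
      -- needed here.
      ((B.adjugate (Sum.inl i) (Sum.inl j) : MvPolynomial D.E ℤ) : MvPowerSeries D.E ℤ) := by
    have h1 := congrArg (Matrix.mulVec
      (D.systemMatrix fun e => MvPowerSeries.C (τ e) * MvPowerSeries.X e).adjugate) hsol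
    rw [Matrix.mulVec_mulVec, Matrix.adjugate_mul, Matrix.smul_mulVec, Matrix.one_mulVec] at h1
    have h2 := congrFun h1 (Sum.inl i)
    rw [Pi.smul_apply, smul_eq_mul, Matrix.mulVec_single_one, ← hseries, ← RingHom.map_det,
      ← RingHom.map_adjugate] at h2
    exact h2
  refine ⟨MvPolynomial.C σ * B.adjugate (Sum.inl i) (Sum.inl j), B.det, ?_, ?_, ?_⟩
  · have hbs : D.boundarySeries i j = MvPowerSeries.C σ *
        D.pathSeries τ (Sum.inl i) (Sum.inl j) := by
      ext s
      rw [MvPowerSeries.coeff_C_mul, coeff_pathSeries, mul_finsum_mem]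
      refine finsum_mem_congr rfl fun P hP => ?_
      exact hsign P hP.1
    rw [hbs, mul_left_comm, hcramer, MvPolynomial.coe_mul, MvPolynomial.coe_C]
  · change g B.det ≠ 0
    rwa [RingHom.map_det, hBg]
  · change f = g (_ * _) / g B.det
    have h1 : g (MvPolynomial.C σ) = (σ : RatFunc ℝ) := by
      rw [hg]; simp
    rw [map_mul, RingHom.map_det, hBg, h1]
    have h3 : g (B.adjugate (Sum.inl i) (Sum.inl j)) =
        (D.systemMatrix (D.modifiedWeight w)).adjugate (Sum.inl i) (Sum.inl j) := by
      rw [← hBg, ← RingHom.map_adjugate]; rfl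
    rw [h3]
    set Bg := D.systemMatrix (D.modifiedWeight w)
    -- The column of the inverse matrix that belongs to the sink solves the inhomogeneous system, so
    -- that `hf` gives its entry at the source.
    have h4 := hf (fun u => Bg.adjugate u (Sum.inl j) / Bg.det) ?_
    · have h5 : ((σ : ℤ) : RatFunc ℝ) * (σ : ℤ) = 1 := by exact_mod_cast hσ
      rw [mul_div_assoc, h4, ← mul_assoc, h5, one_mul]
    · intro u
      have h5 : Bg.mulVec (fun u => Bg.adjugate u (Sum.inl j) / Bg.det) =
          Pi.single (Sum.inl j) 1 := by
        have h6 : (fun u => Bg.adjugate u (Sum.inl j) / Bg.det) =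
            (Bg.det)⁻¹ • Bg.adjugate.col (Sum.inl j) := by
          funext u; simp [div_eq_inv_mul]
        rw [h6, Matrix.mulVec_smul, ← Matrix.mulVec_single_one, Matrix.mulVec_mulVec,
          Matrix.mul_adjugate, Matrix.smul_mulVec, Matrix.one_mulVec, smul_smul,
          inv_mul_cancel₀ hdet, one_smul]
      have h7 := congrFun h5 u
      rw [systemMatrix_mulVec, Pi.single_apply, sub_eq_iff_eq_add] at h7
      exact h7

end Diagram

end AnnularNetwork

namespace AnnularNetwork

/-! ### Signs of paths -/

/-- The contribution of two consecutive directing vectors to the concordance number. -/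
def turn (u v : Plane) : ZMod 2 :=
  if ∀ᶠ t in 𝓝[>] (0 : ℝ), InOpenCone (1, t) u v then 1 else 0

theorem turn_eq_zero {u v : Plane} (h : ∀ᶠ t in 𝓝[>] (0 : ℝ), ¬ InOpenCone (1, t) u v) :
    turn u v = 0 :=
  if_neg fun h' => (h'.and h).exists.elim fun _ h => h.2 h.1

/-- The cone stays in the closed lower half-plane, while `(1, t)` lies above it. -/
theorem turn_eq_zero_of_snd_nonpos {u v : Plane} (hu : u.2 ≤ 0) (hv : v.2 ≤ 0) : turn u v = 0 := by
  refine turn_eq_zero ?_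
  filter_upwards [eventually_mem_nhdsWithin] with t ht
  rintro ⟨-, a, b, ha, hb, h⟩
  have h2 := congrArg Prod.snd h
  simp only [Prod.snd_add, Prod.smul_snd, smul_eq_mul] at h2
  have : (0 : ℝ) < t := ht
  nlinarith [mul_nonneg ha.le (neg_nonneg.2 hu), mul_nonneg hb.le (neg_nonneg.2 hv)]

theorem turn_eq_zero_of_fst_nonpos {u v : Plane} (hu : u.1 ≤ 0) (hv : v.1 ≤ 0) : turn u v = 0 := by
  refine turn_eq_zero (Filter.Eventually.of_forall fun t => ?_)
  rintro ⟨-, a, b, ha, hb, h⟩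
  have h2 := congrArg Prod.fst h
  simp only [Prod.fst_add, Prod.smul_fst, smul_eq_mul] at h2
  nlinarith [mul_nonneg ha.le (neg_nonneg.2 hu), mul_nonneg hb.le (neg_nonneg.2 hv)]

theorem eventually_det_left_pos {u : Plane} (hu : 0 < u.2) :
    ∀ᶠ t in 𝓝[>] (0 : ℝ), 0 < det (1, t) u := by
  rcases eventually_det_left u (fun h => by simp [h] at hu) with h | h
  · exact h
  · exfalso
    have hc : Filter.Tendsto (fun t : ℝ => det (1, t) u) (𝓝[>] 0) (𝓝 u.2) := by
      have : Continuous fun t : ℝ => det (1, t) u := by simp only [det]; fun_prop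
      have h1 := (this.tendsto 0).mono_left (nhdsWithin_le_nhds (s := Set.Ioi 0))
      simpa [det] using h1
    exact ((hc.eventually (lt_mem_nhds hu)).and h).exists.elim fun _ h => h.1.not_gt h.2

/-- Directing vectors in the same open half-plane, above or below the horizontal axis, do not
contribute to the concordance number. -/
theorem turn_eq_zero_of_mul_pos {u v : Plane} (h : 0 < u.2 * v.2) : turn u v = 0 := by
  rcases pos_and_pos_or_neg_and_neg_of_mul_pos h with ⟨hu, hv⟩ | ⟨hu, hv⟩
  · refine turn_eq_zero ?_
    filter_upwards [eventually_det_left_pos hu, eventually_det_left_pos hv] with t h1 h2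
    have h3 : det u (1, t) = - det (1, t) u := by simp only [det]; ring
    rw [inOpenCone_iff, h3]
    rintro (⟨-, -, h⟩ | ⟨-, h, -⟩) <;> linarith
  · exact turn_eq_zero_of_snd_nonpos hu.le hv.le

/-- The one kind of corner of the closing curves that contributes. -/
theorem turn_right_up {a b : ℝ} (ha : 0 < a) (hb : 0 < b) : turn (a, 0) (0, b) = 1 := by
  refine if_pos ?_
  filter_upwards [eventually_mem_nhdsWithin] with t ht
  have ht : (0 : ℝ) < t := ht
  rw [inOpenCone_iff]
  left
  simp only [det]
  refine ⟨?_, ?_, ?_⟩ <;> ring_nf <;> positivity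

/-- The sum of the contributions of the pairs of consecutive vectors of a list to the concordance
number. -/
def chainTurn : List Plane → ZMod 2
  | [] => 0
  | [_] => 0
  | a :: b :: L => turn a b + chainTurn (b :: L)

theorem chainTurn_append {A B : List Plane}
    (h : ∀ a ∈ A.getLast?, ∀ b ∈ B.head?, turn a b = 0) :
    chainTurn (A ++ B) = chainTurn A + chainTurn B := by
  induction A with
  | nil => simp [chainTurn]
  | cons a A ih =>
    cases A with
    | nil =>
      cases B with
      | nil => simp [chainTurn]
      | cons b B => simp [chainTurn, h a (by simp) b (by simp)]
    | cons a' A =>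
      have h1 := ih (fun x hx b hb => h x (by simpa using hx) b hb)
      simp only [List.cons_append] at h1 ⊢
      rw [chainTurn, h1, chainTurn, add_assoc]

theorem sum_zip_append_singleton (L : List Plane) (x y : Plane) :
    (((x :: L).zip (L ++ [y])).map fun p => turn p.1 p.2).sum =
      chainTurn (x :: L ++ [y]) := by
  induction L generalizing x with
  | nil => simp [chainTurn]
  | cons a L ih =>
    have := ih a
    simp only [List.cons_append, List.zip_cons_cons, List.map_cons, List.sum_cons] at this ⊢
    rw [chainTurn, ← this]

/-- The cyclic sum has one more pair than the linear one, namely the last and the first vector. -/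
theorem concordance_eq_chainTurn {C : List Plane}
    (h : ∀ a ∈ C.getLast?, ∀ b ∈ C.head?, turn a b = 0) : concordance C = chainTurn C := by
  cases C with
  | nil => rfl
  | cons a L =>
    have h1 : concordance (a :: L) = chainTurn (a :: L ++ [a]) := by
      rw [← sum_zip_append_singleton]
      simp only [concordance, List.rotate_cons_succ, List.rotate_zero]
      rfl
    rw [h1, chainTurn_append]
    · simp [chainTurn]
    · intro x hx b hb
      refine h x hx b ?_
      simpa using hb

/-- The sign `(-1) ^ z`. -/
def paritySign (z : ZMod 2) : ℤ := (-1) ^ z.val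

theorem paritySign_add (y z : ZMod 2) : paritySign (y + z) = paritySign y * paritySign z := by
  revert y z; decide

theorem paritySign_mul_self (z : ZMod 2) : paritySign z * paritySign z = 1 := by
  revert z; decide

theorem paritySign_sum (L : List (ZMod 2)) :
    paritySign L.sum = (L.map paritySign).prod := by
  induction L with
  | nil => rfl
  | cons a L ih => rw [List.sum_cons, paritySign_add, ih, List.map_cons, List.prod_cons]

namespace Diagram

variable {n₁ n₂ : ℕ} (D : Diagram n₁ n₂)

/-- The sign that an edge contributes to the signs of the paths through it. -/
def edgeSign (e : D.E) : ℤ := paritySign (chainTurn (steps (D.curve e)))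

/-- Close to every vertex, all edges at this vertex point upwards, or all of them point
downwards. -/
def VertexMonotone (s : Fin (n₁ + n₂) ⊕ D.V → ℝ) : Prop :=
  ∀ e, (∀ a ∈ (steps (D.curve e)).head?, 0 < a.2 * s (D.src e)) ∧
    (∀ a ∈ (steps (D.curve e)).getLast?, 0 < a.2 * s (D.tgt e))

variable {D}

theorem steps_curve_ne_nil (e : D.E) : steps (D.curve e) ≠ [] := by
  simp only [steps, segments, curve]
  cases D.bends e <;> simp

theorem mul_pos_of_mul_pos {a b c : ℝ} (h1 : 0 < a * c) (h2 : 0 < b * c) : 0 < a * b := by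
  have : 0 < (a * b) * (c * c) := by nlinarith [mul_pos h1 h2]
  exact pos_of_mul_pos_left this (mul_self_nonneg c)

/-- Where two edges of the path meet, the vertical components of both adjacent steps have the sign
of `s` at the common vertex. So the junction contributes nothing, and the turns inside the edges
simply add up. -/
theorem VertexMonotone.chainTurn_path {s : Fin (n₁ + n₂) ⊕ D.V → ℝ} (hs : D.VertexMonotone s)
    {u v : Fin (n₁ + n₂) ⊕ D.V} {P : List D.E} (hP : D.IsPath u v P) :
    chainTurn (P.flatMap fun e => steps (D.curve e)) =
      (P.map fun e => chainTurn (steps (D.curve e))).sum ∧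
    (∀ a ∈ (P.flatMap fun e => steps (D.curve e)).head?, 0 < a.2 * s u) ∧
    (∀ a ∈ (P.flatMap fun e => steps (D.curve e)).getLast?, 0 < a.2 * s v) := by
  induction P generalizing u with
  | nil => simp [chainTurn]
  | cons e P ih =>
    obtain ⟨rfl, hP'⟩ := hP
    obtain ⟨h1, h2, h3⟩ := ih hP'
    have hne := D.steps_curve_ne_nil e
    rw [List.flatMap_cons]
    refine ⟨?_, ?_, ?_⟩
    · rw [chainTurn_append, h1, List.map_cons, List.sum_cons]
      intro a ha b hb
      exact turn_eq_zero_of_mul_pos (mul_pos_of_mul_pos ((hs e).2 a ha) (h2 b hb))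
    · intro a ha
      rw [List.head?_append_of_ne_nil _ hne] at ha
      exact (hs e).1 a ha
    · intro a ha
      by_cases hP0 : P = []
      · subst hP0
        simp only [List.flatMap_nil, List.append_nil] at ha
        rw [show v = D.tgt e from hP'.symm]
        exact (hs e).2 a ha
      · rw [List.getLast?_append_of_ne_nil] at ha
        · exact h3 a ha
        · obtain ⟨f, P, rfl⟩ := List.exists_cons_of_ne_nil hP0
          rw [List.flatMap_cons]
          exact List.append_ne_nil_of_left_ne_nil (D.steps_curve_ne_nil f) _

/-- The junctions with the closing curve are trivial too: it starts and ends upwards, as do the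
edges at boundary vertices by `hs1`. The path is nonempty since `i ≠ j`. The minus sign comes from
the exponent `c - 1`. -/
theorem VertexMonotone.pathSign_eq {s : Fin (n₁ + n₂) ⊕ D.V → ℝ} (hs : D.VertexMonotone s)
    (hs1 : ∀ i, s (Sum.inl i) = 1) {i j : Fin (n₁ + n₂)}
    (hhead : ∀ a ∈ (D.closingSteps i j).head?, 0 < a.2)
    (hlast : ∀ a ∈ (D.closingSteps i j).getLast?, 0 < a.2)
    (hne : D.closingSteps i j ≠ []) (hij : i ≠ j)
    {P : List D.E} (hP : D.IsPath (Sum.inl i) (Sum.inl j) P) :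
    D.pathSign i j P =
      - paritySign (chainTurn (D.closingSteps i j)) * (P.map D.edgeSign).prod := by
  obtain ⟨h1, h2, h3⟩ := hs.chainTurn_path hP
  have hP0 : P.flatMap (fun e => steps (D.curve e)) ≠ [] := by
    cases P with
    | nil => exact absurd (Sum.inl.inj hP) hij
    | cons e P =>
      rw [List.flatMap_cons]
      exact List.append_ne_nil_of_left_ne_nil (D.steps_curve_ne_nil e) _
  simp only [hs1, mul_one] at h2 h3
  have h4 : concordance (D.closedCurve i j P) =
      (P.map fun e => chainTurn (steps (D.curve e))).sum + chainTurn (D.closingSteps i j) := by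
    rw [closedCurve, concordance_eq_chainTurn, chainTurn_append, h1]
    · intro a ha b hb
      exact turn_eq_zero_of_mul_pos (mul_pos (h3 a ha) (hhead b hb))
    · intro a ha b hb
      rw [List.getLast?_append_of_ne_nil _ hne] at ha
      rw [List.head?_append_of_ne_nil _ hP0] at hb
      exact turn_eq_zero_of_mul_pos (mul_pos (hlast a ha) (h2 b hb))
  rw [pathSign, h4, pow_succ]
  change paritySign _ * -1 = _
  rw [paritySign_add, paritySign_sum, List.map_map]
  change (P.map D.edgeSign).prod * _ * -1 = _
  ring

end Diagram

/-! ### The closing arcs -/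

theorem circlePoint_add_eight (t : ℝ) : circlePoint (t + 8) = circlePoint t := by
  simp only [circlePoint]
  rw [show (t + 8) / 8 = t / 8 + 1 by ring, Int.fract_add_one]

theorem fract_div_eight {t : ℝ} (h0 : 0 ≤ t) (h1 : t < 8) : 8 * Int.fract (t / 8) = t := by
  rw [Int.fract_eq_self.2 ⟨by positivity, by linarith⟩]
  ring

theorem circlePoint_right {t : ℝ} (h0 : 0 ≤ t) (h1 : t < 2) : circlePoint t = (1, t - 1) := by
  simp only [circlePoint, fract_div_eight h0 (by linarith : t < 8), if_pos h1]

theorem circlePoint_two : circlePoint 2 = (1, 1) := by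
  simp only [circlePoint, fract_div_eight (show (0 : ℝ) ≤ 2 by norm_num) (by norm_num)]
  norm_num

theorem circlePoint_four : circlePoint 4 = (-1, 1) := by
  simp only [circlePoint, fract_div_eight (show (0 : ℝ) ≤ 4 by norm_num) (by norm_num)]
  norm_num

theorem circlePoint_five : circlePoint 5 = (-1, 0) := by
  simp only [circlePoint, fract_div_eight (show (0 : ℝ) ≤ 5 by norm_num) (by norm_num)]
  norm_num

theorem circlePoint_six : circlePoint 6 = (-1, -1) := by
  simp only [circlePoint, fract_div_eight (show (0 : ℝ) ≤ 6 by norm_num) (by norm_num)]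
  norm_num

theorem circlePoint_zero : circlePoint 0 = (1, -1) := by
  rw [circlePoint_right le_rfl (by norm_num)]; norm_num

theorem circlePoint_eight : circlePoint 8 = (1, -1) := by
  rw [← circlePoint_zero, ← circlePoint_add_eight 0]; norm_num

theorem circlePoint_neg_two : circlePoint (-2) = (-1, -1) := by
  rw [← circlePoint_six, ← circlePoint_add_eight (-2)]; norm_num

theorem circlePoint_neg_three : circlePoint (-3) = (-1, 0) := by
  rw [← circlePoint_five, ← circlePoint_add_eight (-3)]; norm_num

section Arcs

variable {r a b : ℝ}

theorem floor_half (h0 : 0 < a) (h1 : a < 2) : ⌊a / 2⌋ = 0 := by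
  rw [Int.floor_eq_iff]; constructor <;> push_cast <;> linarith

theorem ceil_half (h0 : 0 < a) (h1 : a < 2) : ⌈a / 2⌉ = 1 := by
  rw [Int.ceil_eq_iff]; constructor <;> push_cast <;> linarith

theorem ccwArc_right (ha : 0 < a) (ha' : a < 2) (hb : 0 < b) (hb' : b < 2) :
    ccwArc r a b = [r • (1, a - 1), r • (1, b - 1)] := by
  rw [ccwArc, floor_half ha ha', ceil_half hb hb', circlePoint_right ha.le ha',
    circlePoint_right hb.le hb']
  simp

theorem ccwArc_around (ha : 0 < a) (ha' : a < 2) (hb : 0 < b) (hb' : b < 2) :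
    ccwArc r a (b + 8) = [r • (1, a - 1), r • (1, 1), r • (-1, 1), r • (-1, -1), r • (1, -1),
      r • (1, b - 1)] := by
  rw [ccwArc, floor_half ha ha', circlePoint_add_eight, circlePoint_right ha.le ha',
    circlePoint_right hb.le hb', show (b + 8) / 2 = b / 2 + (4 : ℤ) by push_cast; ring,
    Int.ceil_add_intCast, ceil_half hb hb']
  have h6 : (2 : ℝ) * (1 + 2) = 6 := by norm_num
  have h8 : (2 : ℝ) * (1 + 3) = 8 := by norm_num
  have h4 : (2 : ℝ) * (1 + 1) = 4 := by norm_num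
  simp [List.range_succ, circlePoint_two, h6, h8, h4, circlePoint_four, circlePoint_six,
    circlePoint_eight]

theorem ccwArc_to_left (ha : 0 < a) (ha' : a < 2) :
    ccwArc r a 5 = [r • (1, a - 1), r • (1, 1), r • (-1, 1), r • (-1, 0)] := by
  have h5 : ⌈(5 : ℝ) / 2⌉ = 3 := by rw [Int.ceil_eq_iff]; norm_num
  rw [ccwArc, floor_half ha ha', circlePoint_right ha.le ha', circlePoint_five, h5]
  have h4 : (2 : ℝ) * (1 + 1) = 4 := by norm_num
  simp [List.range_succ, circlePoint_two, h4, circlePoint_four]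

theorem ccwArc_from_left (hb : 0 < b) (hb' : b < 2) :
    ccwArc r (-3) b = [r • (-1, 0), r • (-1, -1), r • (1, -1), r • (1, b - 1)] := by
  have h5 : ⌊(-3 : ℝ) / 2⌋ = -2 := by rw [Int.floor_eq_iff]; norm_num
  rw [ccwArc, ceil_half hb hb', circlePoint_right hb.le hb', circlePoint_neg_three, h5]
  have h4 : (2 : ℝ) * (-2 + 1) = -2 := by norm_num
  have h0 : (2 : ℝ) * (-2 + 1 + 1) = 0 := by norm_num
  simp [List.range_succ, circlePoint_neg_two, h4, h0, circlePoint_zero]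

end Arcs

namespace Diagram

variable {n₁ n₂ : ℕ} {D : Diagram n₁ n₂}

/-- The closing curve of a path, for boundary vertices on the right sides of the boundary circles
and the straight cut from the left. -/
theorem closingSteps_spec (hcut : D.cutBends = []) (hin : D.innerBase = 5) (hout : D.outerBase = -3)
    (hparam : ∀ i, 0 < D.param i ∧ D.param i < 2) (i j : Fin (n₁ + n₂)) :
    chainTurn (D.closingSteps i j) =
      (if (i.val < n₁ ↔ j.val < n₁) ∧ D.param j < D.param i then 0 else 1) ∧
    (∀ a ∈ (D.closingSteps i j).head?, 0 < a.2) ∧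
    (∀ a ∈ (D.closingSteps i j).getLast?, 0 < a.2) ∧ D.closingSteps i j ≠ [] := by
  obtain ⟨hi, hi'⟩ := hparam i
  obtain ⟨hj, hj'⟩ := hparam j
  have hup : (0 : ℝ) < 1 - (D.param j - 1) := by linarith
  have hup' : (0 : ℝ) < D.param i - 1 + 1 := by linarith
  have hcut' : D.cut = [(-1, 0), (-2, 0)] := by
    rw [cut, hcut, hin, hout, circlePoint_five, circlePoint_neg_three]; simp
  have e1 : (-3 : ℝ) + 8 = 5 := by norm_num
  have e2 : (5 : ℝ) - 8 = -3 := by norm_num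
  by_cases h : i.val < n₁ ↔ j.val < n₁
  · obtain ⟨r, hr, hr'⟩ : ∃ r : ℝ, 0 < r ∧ r = if i.val < n₁ then 2 else 1 := by
      refine ⟨_, ?_, rfl⟩; split_ifs <;> norm_num
    rw [closingSteps, if_pos h, ← hr']
    by_cases h' : D.param j < D.param i
    · rw [if_pos h', ccwArc_right hj hj' hi hi', if_pos ⟨h, h'⟩]
      have h1 : 0 < r * (D.param i - 1) - r * (D.param j - 1) := by nlinarith
      simpa [steps, segments, chainTurn] using h1
    · rw [if_neg h', ccwArc_around hj hj' hi hi', if_neg (fun h => h' h.2)]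
      have h1 : 0 < r - r * (D.param j - 1) := by nlinarith
      have h2 : 0 < r * (D.param i - 1) + r := by nlinarith
      -- Only the lower right corner counts, where the curve turns from rightward to upward. In the
      -- remaining cases it is again passed exactly once.
      have h3 : turn (r + r, 0) (0, r * (D.param i - 1) + r) = 1 :=
        turn_right_up (by positivity) h2
      have t1 : turn (0, r - r * (D.param j - 1)) (-r - r, 0) = 0 :=
        turn_eq_zero_of_fst_nonpos le_rfl (by simp only; linarith)
      have t2 : turn (-r - r, 0) (0, -r - r) = 0 :=
        turn_eq_zero_of_snd_nonpos le_rfl (by simp only; linarith)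
      have t3 : turn (0, -r - r) (r + r, 0) = 0 :=
        turn_eq_zero_of_snd_nonpos (by simp only; linarith) le_rfl
      simp only [steps, segments, Prod.smul_mk, smul_eq_mul, mul_one, mul_neg, List.tail_cons,
        List.zip_cons_cons, List.zip_nil_right, List.map_cons, List.map_nil, Prod.mk_sub_mk,
        sub_self, sub_neg_eq_add, chainTurn, h3, t1, t2, t3]
      simpa using ⟨sub_pos.1 h1, h2⟩
  · rw [closingSteps, if_neg h, hin, hout, hcut', if_neg (show ¬ ((i.val < n₁ ↔ j.val < n₁) ∧ D.param j < D.param i) from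
      fun h' => h h'.1)]
    by_cases h' : j.val < n₁
    · rw [if_pos h', e1, e2, ccwArc_to_left hj hj', ccwArc_from_left hi hi']
      have h3 : turn (1 + 1, 0) (0, D.param i - 1 + 1) = 1 :=
        turn_right_up (by norm_num) hup'
      have t1 : turn (0, 2 - 2 * (D.param j - 1)) (-2 - 2, 0) = 0 :=
        turn_eq_zero_of_fst_nonpos le_rfl (by norm_num)
      have t2 : turn (-2 - 2, 0) (0, 0 - 2) = 0 :=
        turn_eq_zero_of_snd_nonpos le_rfl (by norm_num)
      have t3 : turn (0, 0 - 2) (-1 + 2, 0) = 0 :=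
        turn_eq_zero_of_snd_nonpos (by norm_num) le_rfl
      have t4 : turn (-1 + 2, 0) (0, -1 - 0) = 0 :=
        turn_eq_zero_of_snd_nonpos le_rfl (by norm_num)
      have t5 : turn (0, -1 - 0) (1 + 1, 0) = 0 :=
        turn_eq_zero_of_snd_nonpos (by norm_num) le_rfl
      simp only [steps, segments, Prod.smul_mk, smul_eq_mul, mul_one, mul_neg, List.tail_cons,
        List.zip_cons_cons, List.zip_nil_right, List.map_cons, List.map_nil, Prod.mk_sub_mk,
        sub_self, sub_neg_eq_add, List.reverse_cons, List.reverse_nil, List.nil_append,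
        List.cons_append, chainTurn, one_mul, mul_zero, h3, t1, t2, t3, t4, t5]
      simpa using ⟨sub_pos.1 hup, hi⟩
    · rw [if_neg h', ccwArc_to_left hj hj', ccwArc_from_left hi hi']
      have h1 : (0 : ℝ) < 2 * (D.param i - 1) + 2 := by linarith
      have h3 : turn (2 + 2, 0) (0, 2 * (D.param i - 1) + 2) = 1 :=
        turn_right_up (by norm_num) h1
      have t1 : turn (0, 1 - (D.param j - 1)) (-1 - 1, 0) = 0 :=
        turn_eq_zero_of_fst_nonpos le_rfl (by norm_num)
      have t2 : turn (-1 - 1, 0) (0, 0 - 1) = 0 :=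
        turn_eq_zero_of_snd_nonpos le_rfl (by norm_num)
      have t3 : turn (0, 0 - 1) (-2 + 1, 0) = 0 :=
        turn_eq_zero_of_snd_nonpos (by norm_num) le_rfl
      have t4 : turn (-2 + 1, 0) (0, -2 - 0) = 0 :=
        turn_eq_zero_of_snd_nonpos le_rfl (by norm_num)
      have t5 : turn (0, -2 - 0) (2 + 2, 0) = 0 :=
        turn_eq_zero_of_snd_nonpos (by norm_num) le_rfl
      simp only [steps, segments, Prod.smul_mk, smul_eq_mul, mul_one, mul_neg, List.tail_cons,
        List.zip_cons_cons, List.zip_nil_right, List.map_cons, List.map_nil, Prod.mk_sub_mk,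
        sub_self, sub_neg_eq_add, List.nil_append,
        List.cons_append, chainTurn, one_mul, mul_zero, h3, t1, t2, t3, t4, t5]
      simpa using ⟨sub_pos.1 hup, h1⟩

end Diagram

end AnnularNetwork

namespace AnnularNetwork

/-! ### Ladders -/

/-- Every finite set with a colouring and a key has a successor function that, in every colour
class, runs through the elements by increasing keys, and from the last element back to the
first one. -/
theorem exists_cyclic_successor {V : Type*} [Finite V] (col : V → ℕ) (key : V → ℤ) :
    ∃ next : V → V, ∀ v, col (next v) = col v ∧
      ((key v < key (next v) ∧ ∀ w, col w = col v → key w ≤ key v ∨ key (next v) ≤ key w) ∨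
        ((∀ w, col w = col v → key w ≤ key v) ∧ ∀ w, col w = col v → key (next v) ≤ key w)) := by
  have h : ∀ v, ∃ u, col u = col v ∧
      ((key v < key u ∧ ∀ w, col w = col v → key w ≤ key v ∨ key u ≤ key w) ∨
        ((∀ w, col w = col v → key w ≤ key v) ∧ ∀ w, col w = col v → key u ≤ key w)) := by
    intro v
    by_cases hv : ∃ w, col w = col v ∧ key v < key w
    · obtain ⟨u, ⟨hu1, hu2⟩, hu⟩ := Set.exists_min_image {w | col w = col v ∧ key v < key w} key
        (Set.toFinite _) hv
      refine ⟨u, hu1, Or.inl ⟨hu2, fun w hw => ?_⟩⟩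
      by_cases hw' : key v < key w
      · exact Or.inr (hu w ⟨hw, hw'⟩)
      · exact Or.inl (not_lt.1 hw')
    -- At the largest key the successor is the smallest one: the column closes up.
    · obtain ⟨u, hu1, hu⟩ := Set.exists_min_image {w | col w = col v} key
        (Set.toFinite _) ⟨v, rfl⟩
      refine ⟨u, hu1, Or.inr ⟨fun w hw => ?_, fun w hw => hu w hw⟩⟩
      exact not_lt.1 fun h => hv ⟨w, hw, h⟩
  choose next hnext using h
  exact ⟨next, hnext⟩

/-- A ladder: the closed columns `1, …, M` of an annulus, oriented by `sgn` (`1` is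
counterclockwise), and between them the rungs `0, …, T - 1`, in the order of increasing height on
the right side of the annulus. A rung has the two ends `(t, false)` (start) and `(t, true)`
(terminus). The columns `0` and `M + 1` are the right sides of the boundary circles. -/
structure Ladder (n₁ n₂ : ℕ) where
  M : ℕ
  T : ℕ
  sgn : ℕ → ℤ
  col : Fin T × Bool → ℕ
  /-- the end of a rung at a boundary vertex -/
  boundaryEnd : Fin (n₁ + n₂) → Fin T × Bool
  sgn_eq : ∀ c, sgn c = 1 ∨ sgn c = -1
  sgn_zero : sgn 0 = 1
  sgn_last : sgn (M + 1) = 1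
  col_le : ∀ p, col p ≤ M + 1
  col_adj : ∀ t, col (t, false) ≤ col (t, true) + 1 ∧ col (t, true) ≤ col (t, false) + 1
  internal_or : ∀ t, (0 < col (t, false) ∧ col (t, false) < M + 1) ∨
    (0 < col (t, true) ∧ col (t, true) < M + 1)
  col_boundaryEnd : ∀ i, col (boundaryEnd i) = if i.val < n₁ then M + 1 else 0
  boundaryEnd_injective : Function.Injective boundaryEnd
  exists_boundaryEnd : ∀ p, col p = 0 ∨ col p = M + 1 → ∃ i, boundaryEnd i = p
  outer_lt : ∀ i j, i < j → j.val < n₁ → (boundaryEnd i).1 < (boundaryEnd j).1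
  inner_lt : ∀ i j, i < j → n₁ ≤ i.val → (boundaryEnd j).1 < (boundaryEnd i).1
  -- With two vertices on every internal column, no edge of a column is a loop.
  exists_ne : ∀ p, 0 < col p → col p < M + 1 → ∃ q, q ≠ p ∧ col q = col p

namespace Ladder

variable {n₁ n₂ : ℕ} (L : Ladder n₁ n₂)

/-- The internal vertices of a ladder. -/
abbrev V : Type := {p : Fin L.T × Bool // 0 < L.col p ∧ L.col p < L.M + 1}

/-- The vertices of a ladder are the ends of its rungs. -/
def endEquiv : Fin (n₁ + n₂) ⊕ L.V ≃ Fin L.T × Bool :=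
  Equiv.ofBijective (Sum.elim L.boundaryEnd Subtype.val) <| by
    have hb : ∀ i, ¬ (0 < L.col (L.boundaryEnd i) ∧ L.col (L.boundaryEnd i) < L.M + 1) := by
      intro i
      rw [L.col_boundaryEnd]
      split_ifs <;> omega
    constructor
    · rintro (i | v) (j | w) h
      · exact congrArg _ (L.boundaryEnd_injective h)
      · simp only [Sum.elim_inl, Sum.elim_inr] at h
        exact absurd (h ▸ w.2) (hb i)
      · simp only [Sum.elim_inl, Sum.elim_inr] at h
        exact absurd (h ▸ v.2) (hb j)
      · exact congrArg _ (Subtype.ext h)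
    · intro p
      by_cases hp : 0 < L.col p ∧ L.col p < L.M + 1
      · exact ⟨Sum.inr ⟨p, hp⟩, rfl⟩
      · obtain ⟨i, hi⟩ := L.exists_boundaryEnd p (by have := L.col_le p; omega)
        exact ⟨Sum.inl i, hi⟩

@[simp] theorem endEquiv_inl (i : Fin (n₁ + n₂)) : L.endEquiv (Sum.inl i) = L.boundaryEnd i := rfl

@[simp] theorem endEquiv_inr (v : L.V) : L.endEquiv (Sum.inr v) = v.1 := rfl

/-- The vertex at an end of a rung. -/
def vtx (p : Fin L.T × Bool) : Fin (n₁ + n₂) ⊕ L.V := L.endEquiv.symm p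

@[simp] theorem vtx_boundaryEnd (i : Fin (n₁ + n₂)) : L.vtx (L.boundaryEnd i) = Sum.inl i :=
  L.endEquiv.symm_apply_apply (Sum.inl i)

@[simp] theorem vtx_val (v : L.V) : L.vtx v.1 = Sum.inr v :=
  L.endEquiv.symm_apply_apply (Sum.inr v)

theorem vtx_injective : Function.Injective L.vtx := L.endEquiv.symm.injective

@[simp] theorem endEquiv_vtx (p : Fin L.T × Bool) : L.endEquiv (L.vtx p) = p :=
  L.endEquiv.apply_symm_apply p

theorem vtx_eq_inl {p : Fin L.T × Bool} {i : Fin (n₁ + n₂)} :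
    L.vtx p = Sum.inl i ↔ p = L.boundaryEnd i := by
  rw [← L.vtx_boundaryEnd, L.vtx_injective.eq_iff]

theorem vtx_eq_inr {p : Fin L.T × Bool} {v : L.V} : L.vtx p = Sum.inr v ↔ p = v.1 := by
  rw [← L.vtx_val, L.vtx_injective.eq_iff]

/-- The height of an end of a rung, in units of the grid. -/
def time (p : Fin L.T × Bool) : ℤ :=
  8 * p.1.val + 8 + if p.2 then L.sgn (L.col (p.1, false)) + L.sgn (L.col (p.1, true)) else 0

/-- The rungs are `8` units apart and stay within `2` units of their base heights. They therefore
lie in disjoint horizontal slabs, on which most of the disjointness arguments rest. -/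
theorem abs_time_sub (p : Fin L.T × Bool) : |L.time p - (8 * p.1.val + 8)| ≤ 2 := by
  rw [time, abs_le]
  rcases L.sgn_eq (L.col (p.1, false)) with h1 | h1 <;>
    rcases L.sgn_eq (L.col (p.1, true)) with h2 | h2 <;> rw [h1, h2] <;> split_ifs <;> omega

theorem time_lt_time {p q : Fin L.T × Bool} (h : p.1 < q.1) : L.time p < L.time q := by
  have h1 := abs_le.1 (L.abs_time_sub p)
  have h2 := abs_le.1 (L.abs_time_sub q)
  have h3 : p.1.val < q.1.val := h
  omega

theorem fst_eq_of_abs_le {p : Fin L.T × Bool} {t : Fin L.T}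
    (h : |L.time p - (8 * t.val + 8)| ≤ 2) : p.1 = t := by
  have h1 := abs_le.1 (L.abs_time_sub p)
  have h2 := abs_le.1 h
  apply Fin.ext
  omega

/-- Ends of different rungs lie in different slabs. The two ends of one rung, when on the same
column, differ in height by twice the sign of this column. -/
theorem eq_of_time_eq {p q : Fin L.T × Bool} (hc : L.col p = L.col q) (h : L.time p = L.time q) :
    p = q := by
  have h1 : p.1 = q.1 := L.fst_eq_of_abs_le (h ▸ L.abs_time_sub q)
  obtain ⟨t, b⟩ := p
  obtain ⟨t', b'⟩ := q
  obtain rfl : t = t' := h1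
  cases b <;> cases b'
  · rfl
  · simp only [time] at h
    rw [hc] at h
    rcases L.sgn_eq (L.col (t, true)) with h1 | h1 <;> rw [h1] at h <;> simp at h
  · simp only [time] at h
    rw [hc] at h
    rcases L.sgn_eq (L.col (t, false)) with h1 | h1 <;> rw [h1] at h <;> simp at h
  · rfl

/-- The time of an end in the direction of its column. -/
def key (v : L.V) : ℤ := L.sgn (L.col v.1) * L.time v.1

theorem eq_of_key_eq {v w : L.V} (hc : L.col v.1 = L.col w.1) (h : L.key v = L.key w) : v = w := by
  refine Subtype.ext (L.eq_of_time_eq hc ?_)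
  rw [key, key, hc] at h
  rcases L.sgn_eq (L.col w.1) with h1 | h1 <;> rw [h1] at h <;> linarith

/-- The next vertex on a column. -/
def next : L.V → L.V := (exists_cyclic_successor (fun v : L.V => L.col v.1) L.key).choose

theorem next_spec (v : L.V) : L.col (L.next v).1 = L.col v.1 ∧
    ((L.key v < L.key (L.next v) ∧
      ∀ w : L.V, L.col w.1 = L.col v.1 → L.key w ≤ L.key v ∨ L.key (L.next v) ≤ L.key w) ∨
    ((∀ w : L.V, L.col w.1 = L.col v.1 → L.key w ≤ L.key v) ∧
      ∀ w : L.V, L.col w.1 = L.col v.1 → L.key (L.next v) ≤ L.key w)) :=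
  (exists_cyclic_successor (fun v : L.V => L.col v.1) L.key).choose_spec v

theorem col_next (v : L.V) : L.col (L.next v).1 = L.col v.1 := (L.next_spec v).1

theorem next_of_lt {v : L.V} (h : L.key v < L.key (L.next v)) (w : L.V)
    (hw : L.col w.1 = L.col v.1) : L.key w ≤ L.key v ∨ L.key (L.next v) ≤ L.key w := by
  rcases (L.next_spec v).2 with h1 | h1
  · exact h1.2 w hw
  · exact absurd (h1.1 _ (L.col_next v)) (not_le.2 h)

theorem next_of_not_lt {v : L.V} (h : ¬ L.key v < L.key (L.next v)) (w : L.V)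
    (hw : L.col w.1 = L.col v.1) : L.key w ≤ L.key v ∧ L.key (L.next v) ≤ L.key w := by
  rcases (L.next_spec v).2 with h1 | h1
  · exact absurd h1.1 h
  · exact ⟨h1.1 w hw, h1.2 w hw⟩

/-- A fixed point would be the only vertex of its column, against `exists_ne`. -/
theorem next_ne (v : L.V) : L.next v ≠ v := by
  intro h
  obtain ⟨q, hq, hc⟩ := L.exists_ne v.1 v.2.1 v.2.2
  have h1 := L.next_of_not_lt (v := v) (by rw [h]; exact lt_irrefl _) ⟨q, hc ▸ v.2⟩ hc
  rw [h] at h1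
  exact hq (congrArg Subtype.val (L.eq_of_key_eq (v := ⟨q, hc ▸ v.2⟩) (w := v) hc
    (le_antisymm h1.1 h1.2)))

theorem key_next_lt {v : L.V} (h : ¬ L.key v < L.key (L.next v)) : L.key (L.next v) < L.key v :=
  lt_of_le_of_ne (not_lt.1 h) fun h1 => L.next_ne v (L.eq_of_key_eq (L.col_next v) h1)

/-- Makes `next` a permutation, so that exactly one edge of the column ends at each internal vertex.
-/
theorem next_injective : Function.Injective L.next := by
  have key : ∀ v w : L.V, L.next v = L.next w → ¬ L.key v < L.key w := by
    intro v w h hlt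
    have hc : L.col w.1 = L.col v.1 := by rw [← L.col_next w, ← h, L.col_next]
    by_cases hv : L.key v < L.key (L.next v)
    · rcases L.next_of_lt hv w hc with h1 | h1
      · omega
      · by_cases hw : L.key w < L.key (L.next w)
        · rw [h] at h1; omega
        · have := (L.next_of_not_lt hw v hc.symm).2
          rw [← h] at this
          omega
    · have := (L.next_of_not_lt hv w hc).1
      omega
  intro v w h
  have hc : L.col v.1 = L.col w.1 := by rw [← L.col_next v, h, L.col_next]
  exact L.eq_of_key_eq hc (le_antisymm (not_lt.1 (key w v h.symm)) (not_lt.1 (key v w h)))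

/-- The next vertex on a column, as a permutation. -/
def nextEquiv : Equiv.Perm L.V :=
  Equiv.ofBijective L.next (Finite.injective_iff_bijective.1 L.next_injective)

/-! ### Coordinates -/

/-- The horizontal coordinate of a point of the grid. -/
def X (p : ℝ) : ℝ := 1 + p / (2 * (L.M + 1))

/-- The vertical coordinate of a point of the grid. -/
def Y (q : ℝ) : ℝ := q / (4 * (L.T + 1)) - 1

theorem X_strictMono : StrictMono L.X := fun p q h => by
  have : (0 : ℝ) < 2 * (L.M + 1) := by positivity
  simp only [X]
  gcongr

theorem Y_strictMono : StrictMono L.Y := fun p q h => by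
  have : (0 : ℝ) < 4 * (L.T + 1) := by positivity
  simp only [Y]
  gcongr

theorem X_zero : L.X 0 = 1 := by simp [X]

theorem X_last : L.X (2 * (L.M + 1)) = 2 := by
  have : (0 : ℝ) < 2 * (L.M + 1) := by positivity
  rw [X, div_self this.ne']; norm_num

theorem Y_zero : L.Y 0 = -1 := by simp [Y]

theorem Y_last : L.Y (8 * (L.T + 1)) = 1 := by
  have : (0 : ℝ) < (L.T + 1) := by positivity
  rw [Y]; field_simp; norm_num

theorem Y_mem {q : ℝ} (h0 : 0 < q) (h1 : q < 8 * (L.T + 1)) : -1 < L.Y q ∧ L.Y q < 1 :=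
  ⟨L.Y_zero ▸ L.Y_strictMono h0, L.Y_last ▸ L.Y_strictMono h1⟩

/-- A point of the grid. -/
def gridPoint (p q : ℝ) : Plane := (L.X p, L.Y q)

theorem gridPoint_inj {p q p' q' : ℝ} : L.gridPoint p q = L.gridPoint p' q' ↔ p = p' ∧ q = q' := by
  rw [gridPoint, gridPoint, Prod.mk.injEq, L.X_strictMono.injective.eq_iff,
    L.Y_strictMono.injective.eq_iff]

theorem mem_segment_plane {a b z : Plane} (h : z ∈ segment ℝ a b) :
    ∃ θ : ℝ, 0 ≤ θ ∧ θ ≤ 1 ∧ z = (a.1 + θ * (b.1 - a.1), a.2 + θ * (b.2 - a.2)) := by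
  rw [segment_eq_image'] at h
  obtain ⟨θ, ⟨h0, h1⟩, rfl⟩ := h
  exact ⟨θ, h0, h1, by ext <;> simp⟩

theorem mem_segment_gridPoint {p q p' q' : ℝ} {z : Plane}
    (h : z ∈ segment ℝ (L.gridPoint p q) (L.gridPoint p' q')) :
    ∃ θ : ℝ, 0 ≤ θ ∧ θ ≤ 1 ∧ z = L.gridPoint (p + θ * (p' - p)) (q + θ * (q' - q)) := by
  obtain ⟨θ, h0, h1, rfl⟩ := mem_segment_plane h
  refine ⟨θ, h0, h1, ?_⟩
  simp only [gridPoint, X, Y]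
  ext <;> simp only <;> ring

theorem one_le_X {p : ℝ} (h : 0 ≤ p) : 1 ≤ L.X p := L.X_zero ▸ L.X_strictMono.monotone h

theorem norm_gridPoint {p q : ℝ} (hp : 0 ≤ p) (h0 : 0 < q) (h1 : q < 8 * (L.T + 1)) :
    ‖L.gridPoint p q‖ = L.X p := by
  have h2 := L.one_le_X hp
  have h3 := L.Y_mem h0 h1
  rw [gridPoint, Prod.norm_def, Real.norm_eq_abs, Real.norm_eq_abs, abs_of_pos (by linarith),
    max_eq_left]
  rw [abs_le]; constructor <;> linarith

/-- The position of an end of a rung. -/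
def endPos (p : Fin L.T × Bool) : Plane := L.gridPoint (2 * L.col p) (L.time p)

theorem time_mem (p : Fin L.T × Bool) : (0 : ℝ) < L.time p ∧ (L.time p : ℝ) < 8 * (L.T + 1) := by
  have h1 := abs_le.1 (L.abs_time_sub p)
  have h2 := p.1.2
  constructor
  · have : (0 : ℤ) < L.time p := by omega
    exact_mod_cast this
  · have : L.time p < 8 * ((L.T : ℤ) + 1) := by omega
    exact_mod_cast this

/-- The horizontal coordinate of the bend of a rung, in units of the grid. -/
def midX (t : Fin L.T) : ℕ :=
  if L.col (t, false) = L.col (t, true) then 2 * L.col (t, false) + 1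
  else L.col (t, false) + L.col (t, true)

theorem midX_start (t : Fin L.T) : (L.midX t : ℝ) - 2 * L.col (t, false) = 1 ∨
    (L.midX t : ℝ) - 2 * L.col (t, false) = -1 := by
  have h1 := L.col_adj t
  have h2 : (L.midX t : ℤ) - 2 * L.col (t, false) = 1 ∨
    (L.midX t : ℤ) - 2 * L.col (t, false) = -1 := by
    rw [midX]; split_ifs <;> omega
  exact_mod_cast h2

theorem midX_end (t : Fin L.T) : (L.midX t : ℝ) - 2 * L.col (t, true) = 1 ∨
    (L.midX t : ℝ) - 2 * L.col (t, true) = -1 := by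
  have h1 := L.col_adj t
  have h2 : (L.midX t : ℤ) - 2 * L.col (t, true) = 1 ∨
    (L.midX t : ℤ) - 2 * L.col (t, true) = -1 := by
    rw [midX]; split_ifs <;> omega
  exact_mod_cast h2

theorem midX_mem (t : Fin L.T) : 1 ≤ L.midX t ∧ L.midX t ≤ 2 * L.M + 1 := by
  have h1 := L.col_adj t
  have h2 := L.internal_or t
  rw [midX]; split_ifs <;> omega

/-- The bend of a rung. -/
def midPos (t : Fin L.T) : Plane :=
  L.gridPoint (L.midX t) (8 * t.val + 8 + L.sgn (L.col (t, false)))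

/-- The bends of the closing edge of a column that has the distance `r` from the origin and the
orientation `s`. -/
def wrapBends (r s : ℝ) : List Plane := [(r, s * r), (-r, s * r), (-r, -(s * r)), (r, -(s * r))]

/-- The radius of the column of a vertex. -/
def radius (v : L.V) : ℝ := L.X (2 * L.col v.1)

theorem radius_mem (v : L.V) : 1 < L.radius v ∧ L.radius v < 2 := by
  have h1 : 0 < (L.col v.1 : ℝ) := by exact_mod_cast v.2.1
  have h2 : (L.col v.1 : ℝ) < L.M + 1 := by exact_mod_cast v.2.2
  constructor
  · rw [← L.X_zero]; exact L.X_strictMono (by linarith)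
  · rw [← L.X_last]; exact L.X_strictMono (by linarith)

/-- The initial vertex of a rung, or of the edge of a column that starts at a vertex. -/
def src : Fin L.T ⊕ L.V → Fin (n₁ + n₂) ⊕ L.V := Sum.elim (fun t => L.vtx (t, false)) Sum.inr

/-- The terminal vertex of a rung, or of the edge of a column that starts at a vertex. -/
def tgt : Fin L.T ⊕ L.V → Fin (n₁ + n₂) ⊕ L.V :=
  Sum.elim (fun t => L.vtx (t, true)) fun v => Sum.inr (L.next v)

/-- The planar drawing of a ladder. -/
def diagram : Diagram n₁ n₂ where
  V := L.V
  E := Fin L.T ⊕ L.V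
  src := L.src
  tgt := L.tgt
  param i := 1 + L.Y (L.time (L.boundaryEnd i)) / (if i.val < n₁ then 2 else 1)
  innerPos v := L.endPos v.1
  bends := Sum.elim (fun t => [L.midPos t]) fun v =>
    if L.key v < L.key (L.next v) then [] else wrapBends (L.radius v) (L.sgn (L.col v.1))
  innerBase := 5
  outerBase := -3
  cutBends := []

theorem param_mem (i : Fin (n₁ + n₂)) : 0 < L.diagram.param i ∧ L.diagram.param i < 2 := by
  have h1 := L.Y_mem (L.time_mem (L.boundaryEnd i)).1 (L.time_mem (L.boundaryEnd i)).2
  simp only [diagram]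
  split_ifs <;> constructor <;> linarith

/-- On the outer circle the scaling by `2` undoes the division by `2` in `param`, so boundary
vertices have the grid heights of their rung ends. -/
theorem boundaryPos_eq (i : Fin (n₁ + n₂)) :
    L.diagram.boundaryPos i = L.endPos (L.boundaryEnd i) := by
  rw [Diagram.boundaryPos, circlePoint_right (L.param_mem i).1.le (L.param_mem i).2, endPos,
    L.col_boundaryEnd, gridPoint]
  simp only [diagram]
  split_ifs with h
  · push_cast
    rw [L.X_last]
    ext
    · simp
    · simp only [Prod.smul_mk, smul_eq_mul]; ring
  · simp [L.X_zero]

theorem pos_eq (u : Fin (n₁ + n₂) ⊕ L.V) : L.diagram.pos u = L.endPos (L.endEquiv u) := by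
  rcases u with i | v
  · exact L.boundaryPos_eq i
  · rfl

theorem curve_rung (t : Fin L.T) :
    L.diagram.curve (Sum.inl t) = [L.endPos (t, false), L.midPos t, L.endPos (t, true)] := by
  have h1 := L.pos_eq (L.vtx (t, false))
  have h2 := L.pos_eq (L.vtx (t, true))
  rw [endEquiv_vtx] at h1 h2
  rw [← h1, ← h2]
  rfl

theorem curve_strand {v : L.V} (h : L.key v < L.key (L.next v)) :
    L.diagram.curve (Sum.inr v) = [L.endPos v.1, L.endPos (L.next v).1] := by
  simp only [Diagram.curve, diagram, Sum.elim_inr, if_pos h]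
  rfl

theorem curve_wrap {v : L.V} (h : ¬ L.key v < L.key (L.next v)) :
    L.diagram.curve (Sum.inr v) =
      L.endPos v.1 :: (wrapBends (L.radius v) (L.sgn (L.col v.1)) ++ [L.endPos (L.next v).1]) := by
  simp only [Diagram.curve, diagram, Sum.elim_inr, if_neg h]
  rfl

end Ladder

end AnnularNetwork

namespace AnnularNetwork

namespace Ladder

variable {n₁ n₂ : ℕ} (L : Ladder n₁ n₂)

/-! ### The traces of the edges of a ladder -/

theorem cast_sgn (c : ℕ) : (L.sgn c : ℝ) = 1 ∨ (L.sgn c : ℝ) = -1 := by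
  rcases L.sgn_eq c with h | h <;> simp [h]

theorem time_start (t : Fin L.T) : L.time (t, false) = 8 * t.val + 8 := by simp [time]

theorem time_end (t : Fin L.T) : L.time (t, true) =
    8 * t.val + 8 + L.sgn (L.col (t, false)) + L.sgn (L.col (t, true)) := by
  simp [time, add_assoc]

/-- Columns have even abscissas and the bend of a rung is one unit away from its columns. By parity
a half of a rung meets a column only at its end. -/
theorem even_of_abs_le {a c : ℕ} {x : ℝ} (h : (2 * a : ℝ) + x = 2 * c) (h0 : |x| ≤ 1) : x = 0 := by
  have h1 : x = ((2 * c - 2 * a : ℤ) : ℝ) := by push_cast; linarith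
  rw [h1] at h0 ⊢
  have h2 : |(2 * c - 2 * a : ℤ)| ≤ 1 := by exact_mod_cast h0
  have h3 : (2 * c - 2 * a : ℤ) = 0 := by
    rw [abs_le] at h2; omega
  exact_mod_cast h3

/-- All that later arguments need about the position of a rung: its slab, its horizontal range, and
that it meets columns only in its two ends. -/
theorem trace_rung {t : Fin L.T} {z : Plane} (h : z ∈ trace (L.diagram.curve (Sum.inl t))) :
    ∃ p q : ℝ, z = L.gridPoint p q ∧ |q - (8 * t.val + 8)| ≤ 2 ∧ 0 ≤ p ∧ p ≤ 2 * (L.M + 1) ∧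
      ∀ c : ℕ, p = 2 * c → z = L.endPos (t, false) ∨ z = L.endPos (t, true) := by
  have hm := L.midX_mem t
  have hm1 : (1 : ℝ) ≤ L.midX t := by exact_mod_cast hm.1
  have hm2 : (L.midX t : ℝ) ≤ 2 * L.M + 1 := by exact_mod_cast hm.2
  have hs1 := L.cast_sgn (L.col (t, false))
  have hs2 := L.cast_sgn (L.col (t, true))
  have hc1 : (L.col (t, false) : ℝ) ≤ L.M + 1 := by exact_mod_cast L.col_le (t, false)
  have hc2 : (L.col (t, true) : ℝ) ≤ L.M + 1 := by exact_mod_cast L.col_le (t, true)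
  have hc1' : (0 : ℝ) ≤ L.col (t, false) := by positivity
  have hc2' : (0 : ℝ) ≤ L.col (t, true) := by positivity
  have key : z ∈ segment ℝ (L.endPos (t, false)) (L.midPos t) ∨
      z ∈ segment ℝ (L.midPos t) (L.endPos (t, true)) := by
    rw [curve_rung] at h
    simp only [trace, Set.mem_union, Set.mem_singleton_iff] at h
    rcases h with h | h | rfl
    · exact Or.inl h
    · exact Or.inr h
    · exact Or.inr (right_mem_segment _ _ _)
  rcases key with h | h
  · obtain ⟨θ, h0, h1, rfl⟩ := L.mem_segment_gridPoint h
    refine ⟨_, _, rfl, ?_, ?_, ?_, fun c hc => Or.inl ?_⟩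
    · rw [L.time_start]
      push_cast
      rw [abs_le]
      rcases hs1 with hs | hs <;> rw [hs] <;> constructor <;> linarith
    · nlinarith
    · nlinarith
    · have h2 := L.midX_start t
      have hx : θ * (L.midX t - 2 * L.col (t, false)) = 0 := by
        refine even_of_abs_le hc ?_
        rw [abs_le]
        rcases h2 with h2 | h2 <;> rw [h2] <;> constructor <;> linarith
      have hθ : θ = 0 := by
        rcases h2 with h2 | h2 <;> rw [h2] at hx <;> linarith
      simp [hθ, endPos]
  · obtain ⟨θ, h0, h1, rfl⟩ := L.mem_segment_gridPoint h
    refine ⟨_, _, rfl, ?_, ?_, ?_, fun c hc => Or.inr ?_⟩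
    · rw [L.time_end]
      push_cast
      rw [abs_le]
      rcases hs1 with hs | hs <;> rcases hs2 with hs' | hs' <;> rw [hs, hs'] <;>
        constructor <;> linarith
    · nlinarith
    · nlinarith
    · have h2 := L.midX_end t
      have hx : (1 - θ) * (L.midX t - 2 * L.col (t, true)) = 0 := by
        refine even_of_abs_le (a := L.col (t, true)) (c := c) ?_ ?_
        · rw [← hc]; ring
        rw [abs_le]
        rcases h2 with h2 | h2 <;> rw [h2] <;> constructor <;> linarith
      have hθ : θ = 1 := by
        rcases h2 with h2 | h2 <;> rw [h2] at hx <;> linarith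
      subst hθ
      simp only [endPos]
      congr 1 <;> ring

/-- A part of the right side of a column. -/
theorem trace_strand {v : L.V} (hv : L.key v < L.key (L.next v)) {z : Plane}
    (h : z ∈ trace (L.diagram.curve (Sum.inr v))) :
    ∃ q : ℝ, z = L.gridPoint (2 * L.col v.1) q ∧ 0 < q ∧ q < 8 * (L.T + 1) ∧
      (L.key v : ℝ) ≤ L.sgn (L.col v.1) * q ∧ L.sgn (L.col v.1) * q ≤ L.key (L.next v) := by
  have key : z ∈ segment ℝ (L.endPos v.1) (L.endPos (L.next v).1) := by
    rw [L.curve_strand hv] at h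
    simp only [trace, Set.mem_union, Set.mem_singleton_iff] at h
    rcases h with h | rfl
    · exact h
    · exact right_mem_segment _ _ _
  obtain ⟨θ, h0, h1, rfl⟩ := L.mem_segment_gridPoint key
  have hk : (L.key v : ℝ) < L.key (L.next v) := by exact_mod_cast hv
  have e1 : (L.key v : ℝ) = L.sgn (L.col v.1) * L.time v.1 := by rw [Ladder.key]; push_cast; rfl
  have e2 : (L.key (L.next v) : ℝ) = L.sgn (L.col v.1) * L.time (L.next v).1 := by
    rw [Ladder.key, L.col_next]; push_cast; rfl
  have m1 := L.time_mem v.1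
  have m2 := L.time_mem (L.next v).1
  refine ⟨_, by rw [L.col_next, sub_self, mul_zero, add_zero], ?_, ?_, ?_, ?_⟩
  · rcases h1.eq_or_lt with rfl | h1
    · linarith
    · nlinarith [mul_pos (sub_pos.2 h1) m1.1, mul_nonneg h0 m2.1.le]
  · rcases h1.eq_or_lt with rfl | h1
    · linarith
    · nlinarith [mul_pos (sub_pos.2 h1) (sub_pos.2 m1.2), mul_nonneg h0 (sub_nonneg.2 m2.2.le)]
  · have : L.sgn (L.col v.1) * ((L.time v.1 : ℝ) + θ * (L.time (L.next v).1 - L.time v.1)) =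
      L.key v + θ * (L.key (L.next v) - L.key v) := by rw [e1, e2]; ring
    rw [this]
    nlinarith
  · have : L.sgn (L.col v.1) * ((L.time v.1 : ℝ) + θ * (L.time (L.next v).1 - L.time v.1)) =
      L.key v + θ * (L.key (L.next v) - L.key v) := by rw [e1, e2]; ring
    rw [this]
    nlinarith

/-- The five sides of the curve that closes a column. -/
def IsWrapPoint (r s y y' : ℝ) (z : Plane) : Prop :=
  (z.1 = r ∧ s * y ≤ s * z.2 ∧ s * z.2 ≤ r) ∨ (s * z.2 = r ∧ -r ≤ z.1 ∧ z.1 ≤ r) ∨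
  (z.1 = -r ∧ -r ≤ s * z.2 ∧ s * z.2 ≤ r) ∨ (s * z.2 = -r ∧ -r ≤ z.1 ∧ z.1 ≤ r) ∨
  (z.1 = r ∧ -r ≤ s * z.2 ∧ s * z.2 ≤ s * y')

section Wrap

variable {r s y y' : ℝ} (hs : s = 1 ∨ s = -1) (hr : 1 < r) (hy : |y| < 1) (hy' : |y'| < 1)
include hs hr

theorem wrap_side_one (hy : |y| < 1) {z : Plane} (h : z ∈ segment ℝ ((r, y) : Plane) (r, s * r)) :
    z.1 = r ∧ s * y ≤ s * z.2 ∧ s * z.2 ≤ r := by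
  obtain ⟨θ, h0, h1, rfl⟩ := mem_segment_plane h
  rw [abs_lt] at hy
  rcases hs with rfl | rfl <;> simp only <;> refine ⟨by ring, ?_, ?_⟩ <;> nlinarith

theorem wrap_side_two {z : Plane} (h : z ∈ segment ℝ ((r, s * r) : Plane) (-r, s * r)) :
    s * z.2 = r ∧ -r ≤ z.1 ∧ z.1 ≤ r := by
  obtain ⟨θ, h0, h1, rfl⟩ := mem_segment_plane h
  rcases hs with rfl | rfl <;> simp only <;> refine ⟨by ring, ?_, ?_⟩ <;> nlinarith

theorem wrap_side_three {z : Plane} (h : z ∈ segment ℝ ((-r, s * r) : Plane) (-r, -(s * r))) :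
    z.1 = -r ∧ -r ≤ s * z.2 ∧ s * z.2 ≤ r := by
  obtain ⟨θ, h0, h1, rfl⟩ := mem_segment_plane h
  rcases hs with rfl | rfl <;> simp only <;> refine ⟨by ring, ?_, ?_⟩ <;> nlinarith

theorem wrap_side_four {z : Plane} (h : z ∈ segment ℝ ((-r, -(s * r)) : Plane) (r, -(s * r))) :
    s * z.2 = -r ∧ -r ≤ z.1 ∧ z.1 ≤ r := by
  obtain ⟨θ, h0, h1, rfl⟩ := mem_segment_plane h
  rcases hs with rfl | rfl <;> simp only <;> refine ⟨by ring, ?_, ?_⟩ <;> nlinarith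

theorem wrap_side_five (hy' : |y'| < 1) {z : Plane}
    (h : z ∈ segment ℝ ((r, -(s * r)) : Plane) (r, y')) :
    z.1 = r ∧ -r ≤ s * z.2 ∧ s * z.2 ≤ s * y' := by
  obtain ⟨θ, h0, h1, rfl⟩ := mem_segment_plane h
  rw [abs_lt] at hy'
  rcases hs with rfl | rfl <;> simp only <;> refine ⟨by ring, ?_, ?_⟩ <;> nlinarith

include hy hy'

theorem isWrapPoint_of_mem_trace {z : Plane}
    (h : z ∈ trace ((r, y) :: (wrapBends r s ++ [(r, y')]))) : IsWrapPoint r s y y' z := by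
  simp only [wrapBends, List.cons_append, List.nil_append, trace, Set.mem_union,
    Set.mem_singleton_iff] at h
  rcases h with h | h | h | h | h | rfl
  · exact Or.inl (wrap_side_one hs hr hy h)
  · exact Or.inr (Or.inl (wrap_side_two hs hr h))
  · exact Or.inr (Or.inr (Or.inl (wrap_side_three hs hr h)))
  · exact Or.inr (Or.inr (Or.inr (Or.inl (wrap_side_four hs hr h))))
  · exact Or.inr (Or.inr (Or.inr (Or.inr (wrap_side_five hs hr hy' h))))
  · exact Or.inr (Or.inr (Or.inr (Or.inr
      (wrap_side_five hs hr hy' (right_mem_segment _ _ _)))))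

/-- The first and the last side lie on the same vertical line. By `hlt` the curve leaves ahead of
the place where it returns, which keeps them apart. -/
theorem isSimpleArc_wrap (hlt : s * y' < s * y) :
    IsSimpleArc ((r, y) :: (wrapBends r s ++ [(r, y')])) := by
  have hs0 : s * s = 1 := by rcases hs with rfl | rfl <;> norm_num
  have hs1 : ∀ {a b : ℝ}, s * a = b → a = s * b := fun h => by rw [← h, ← mul_assoc, hs0, one_mul]
  have ha : |s * y| < 1 := by rcases hs with rfl | rfl <;> simpa using hy
  have ha' : |s * y'| < 1 := by rcases hs with rfl | rfl <;> simpa using hy'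
  rw [abs_lt] at ha ha'
  have hss : s * (s * r) = r := by rw [← mul_assoc, hs0, one_mul]
  simp only [wrapBends, List.cons_append, List.nil_append, IsSimpleArc, trace]
  refine ⟨?_, ?_, ?_, ?_, ?_, ?_, ?_, ?_, ?_, ?_, trivial⟩
  · intro h
    have := congrArg (fun z : Plane => s * z.2) h
    simp only [hss] at this
    linarith
  · rintro z ⟨h1, h2⟩
    obtain ⟨f1, f2, f3⟩ := wrap_side_one hs hr hy h1
    have goal : s * z.2 = r → z = (r, s * r) := fun h => Prod.ext f1 (hs1 h)
    simp only [Set.mem_union, Set.mem_singleton_iff] at h2 ⊢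
    rcases h2 with h | h | h | h | rfl
    · exact goal (wrap_side_two hs hr h).1
    · have := wrap_side_three hs hr h; exfalso; linarith
    · have := wrap_side_four hs hr h; exfalso; linarith
    · have := wrap_side_five hs hr hy' h; exfalso; linarith
    · exfalso; simp only at f2; linarith
  · intro h
    have := congrArg Prod.fst h
    simp only at this
    linarith
  · rintro z ⟨h1, h2⟩
    obtain ⟨f1, f2, f3⟩ := wrap_side_two hs hr h1
    have goal : z.1 = -r → z = (-r, s * r) := fun h => Prod.ext h (hs1 f1)
    simp only [Set.mem_union, Set.mem_singleton_iff] at h2 ⊢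
    rcases h2 with h | h | h | rfl
    · exact goal (wrap_side_three hs hr h).1
    · have := wrap_side_four hs hr h; exfalso; linarith
    · have := wrap_side_five hs hr hy' h; exfalso; linarith
    · exfalso; simp only at f1; linarith
  · intro h
    have := congrArg (fun z : Plane => s * z.2) h
    simp only [hss, mul_neg] at this
    linarith
  · rintro z ⟨h1, h2⟩
    obtain ⟨f1, f2, f3⟩ := wrap_side_three hs hr h1
    have goal : s * z.2 = -r → z = (-r, -(s * r)) := fun h =>
      Prod.ext f1 ((hs1 h).trans (mul_neg _ _))
    simp only [Set.mem_union, Set.mem_singleton_iff] at h2 ⊢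
    rcases h2 with h | h | rfl
    · exact goal (wrap_side_four hs hr h).1
    · have := wrap_side_five hs hr hy' h; exfalso; linarith
    · exfalso; simp only at f1; linarith
  · intro h
    have := congrArg Prod.fst h
    simp only at this
    linarith
  · rintro z ⟨h1, h2⟩
    obtain ⟨f1, f2, f3⟩ := wrap_side_four hs hr h1
    have goal : z.1 = r → z = (r, -(s * r)) := fun h =>
      Prod.ext h ((hs1 f1).trans (mul_neg _ _))
    simp only [Set.mem_union, Set.mem_singleton_iff] at h2 ⊢
    rcases h2 with h | rfl
    · exact goal (wrap_side_five hs hr hy' h).1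
    · exact goal rfl
  · intro h
    have := congrArg (fun z : Plane => s * z.2) h
    simp only [hss, mul_neg] at this
    linarith
  · exact Set.inter_subset_right

end Wrap

theorem abs_Y_time (p : Fin L.T × Bool) : |L.Y (L.time p)| < 1 :=
  abs_lt.2 (L.Y_mem (L.time_mem p).1 (L.time_mem p).2)

theorem sgn_mul_Y_le {s : ℝ} (hs : s = 1 ∨ s = -1) {q q' : ℝ} :
    s * L.Y q ≤ s * L.Y q' ↔ s * q ≤ s * q' := by
  rcases hs with rfl | rfl
  · simp [L.Y_strictMono.le_iff_le]
  · simp [L.Y_strictMono.le_iff_le]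

theorem wrap_eq {v : L.V} (hv : ¬ L.key v < L.key (L.next v)) :
    L.diagram.curve (Sum.inr v) = (L.radius v, L.Y (L.time v.1)) ::
      (wrapBends (L.radius v) (L.sgn (L.col v.1)) ++
        [(L.radius v, L.Y (L.time (L.next v).1))]) := by
  rw [L.curve_wrap hv]
  simp only [endPos, gridPoint, L.col_next]
  rfl

theorem cast_key (v : L.V) : (L.key v : ℝ) = L.sgn (L.col v.1) * L.time v.1 := by
  rw [key]; push_cast; rfl

theorem cast_key_next (v : L.V) :
    (L.key (L.next v) : ℝ) = L.sgn (L.col v.1) * L.time (L.next v).1 := by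
  rw [key, L.col_next]; push_cast; rfl

theorem isWrapPoint_of_mem {v : L.V} (hv : ¬ L.key v < L.key (L.next v)) {z : Plane}
    (h : z ∈ trace (L.diagram.curve (Sum.inr v))) :
    IsWrapPoint (L.radius v) (L.sgn (L.col v.1)) (L.Y (L.time v.1))
      (L.Y (L.time (L.next v).1)) z := by
  rw [L.wrap_eq hv] at h
  exact isWrapPoint_of_mem_trace (L.cast_sgn _) (L.radius_mem v).1 (L.abs_Y_time _)
    (L.abs_Y_time _) h

theorem sgn_mul_Y_lt {v : L.V} (hv : ¬ L.key v < L.key (L.next v)) :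
    (L.sgn (L.col v.1) : ℝ) * L.Y (L.time (L.next v).1) <
      L.sgn (L.col v.1) * L.Y (L.time v.1) := by
  rw [← not_le, L.sgn_mul_Y_le (L.cast_sgn _), not_le, ← L.cast_key, ← L.cast_key_next]
  exact_mod_cast L.key_next_lt hv

/-- A column is a circle of the maximum norm. On its right side the closing edge covers only what
lies behind the last vertex or ahead of the first one, in the direction of the column. -/
theorem trace_wrap {v : L.V} (hv : ¬ L.key v < L.key (L.next v)) {z : Plane}
    (h : z ∈ trace (L.diagram.curve (Sum.inr v))) :
    ‖z‖ = L.radius v ∧ ∀ q, z = L.gridPoint (2 * L.col v.1) q → 0 < q → q < 8 * (L.T + 1) →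
      (L.key v : ℝ) ≤ L.sgn (L.col v.1) * q ∨ L.sgn (L.col v.1) * q ≤ L.key (L.next v) := by
  have hw := L.isWrapPoint_of_mem hv h
  have hs := L.cast_sgn (L.col v.1)
  have hr := L.radius_mem v
  have h1 := abs_lt.1 (L.abs_Y_time v.1)
  have h2 := abs_lt.1 (L.abs_Y_time (L.next v).1)
  constructor
  · have habs : |z.2| = |(L.sgn (L.col v.1) : ℝ) * z.2| := by
      rcases hs with hs | hs <;> rw [hs] <;> simp
    have habs1 : |L.Y (L.time v.1)| = |(L.sgn (L.col v.1) : ℝ) * L.Y (L.time v.1)| := by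
      rcases hs with hs | hs <;> rw [hs] <;> simp
    have habs2 : |L.Y (L.time (L.next v).1)| =
        |(L.sgn (L.col v.1) : ℝ) * L.Y (L.time (L.next v).1)| := by
      rcases hs with hs | hs <;> rw [hs] <;> simp
    have h1' := abs_lt.1 (habs1 ▸ L.abs_Y_time v.1)
    have h2' := abs_lt.1 (habs2 ▸ L.abs_Y_time (L.next v).1)
    rw [Prod.norm_def, Real.norm_eq_abs, Real.norm_eq_abs, habs]
    rcases hw with ⟨e, l, u⟩ | ⟨e, l, u⟩ | ⟨e, l, u⟩ | ⟨e, l, u⟩ | ⟨e, l, u⟩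
    · rw [e, abs_of_pos (by linarith), max_eq_left]
      rw [abs_le]; constructor <;> linarith
    · rw [e, abs_of_pos (by linarith : 0 < L.radius v), max_eq_right]
      rw [abs_le]; constructor <;> linarith
    · rw [e, abs_neg, abs_of_pos (by linarith : 0 < L.radius v), max_eq_left]
      rw [abs_le]; constructor <;> linarith
    · rw [e, abs_neg, abs_of_pos (by linarith : 0 < L.radius v), max_eq_right]
      rw [abs_le]; constructor <;> linarith
    · rw [e, abs_of_pos (by linarith), max_eq_left]
      rw [abs_le]; constructor <;> linarith
  · rintro q rfl hq0 hq1
    have hq := L.Y_mem hq0 hq1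
    rw [L.cast_key, L.cast_key_next]
    simp only [IsWrapPoint, gridPoint] at hw
    rw [L.sgn_mul_Y_le hs, L.sgn_mul_Y_le hs] at hw
    rcases hw with ⟨e, l, u⟩ | ⟨e, l, u⟩ | ⟨e, l, u⟩ | ⟨e, l, u⟩ | ⟨e, l, u⟩
    · exact Or.inl l
    · exfalso; rcases hs with hs | hs <;> rw [hs] at e <;> linarith
    · exfalso; change L.radius v = _ at e; linarith
    · exfalso; rcases hs with hs | hs <;> rw [hs] at e <;> linarith
    · exact Or.inr u

/-- The norm separates edges of different columns from each other, and all of them from the boundary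
circles. -/
theorem norm_of_mem_strand {v : L.V} {z : Plane}
    (h : z ∈ trace (L.diagram.curve (Sum.inr v))) : ‖z‖ = L.radius v := by
  by_cases hv : L.key v < L.key (L.next v)
  · obtain ⟨q, rfl, h0, h1, -⟩ := L.trace_strand hv h
    rw [L.norm_gridPoint (by positivity) h0 h1]
    rfl
  · exact (L.trace_wrap hv h).1

theorem radius_eq_iff {v w : L.V} : L.radius v = L.radius w ↔ L.col v.1 = L.col w.1 := by
  rw [radius, radius, L.X_strictMono.injective.eq_iff]
  constructor
  · intro h
    have : (L.col v.1 : ℝ) = L.col w.1 := by linarith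
    exact_mod_cast this
  · intro h; rw [h]

theorem norm_endPos (p : Fin L.T × Bool) : ‖L.endPos p‖ = L.X (2 * L.col p) :=
  L.norm_gridPoint (by positivity) (L.time_mem p).1 (L.time_mem p).2

theorem endPos_injective : Function.Injective L.endPos := by
  intro p q h
  have h1 := L.gridPoint_inj.1 h
  refine L.eq_of_time_eq ?_ (by exact_mod_cast h1.2)
  have : (L.col p : ℝ) = L.col q := by linarith [h1.1]
  exact_mod_cast this

theorem slab_mem {t : Fin L.T} {q : ℝ} (h : |q - (8 * t.val + 8)| ≤ 2) :
    0 < q ∧ q < 8 * (L.T + 1) := by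
  have h1 : (t.val : ℝ) + 1 ≤ L.T := by exact_mod_cast t.2
  have h2 : (0 : ℝ) ≤ t.val := by positivity
  rw [abs_le] at h
  constructor <;> linarith

theorem mem_openAnnulus_of_strand {v : L.V} {z : Plane}
    (h : z ∈ trace (L.diagram.curve (Sum.inr v))) : z ∈ openAnnulus := by
  rw [openAnnulus, Set.mem_ofPred_eq, L.norm_of_mem_strand h]
  exact L.radius_mem v

theorem edge_mem (e : L.diagram.E) (z : Plane) (h : z ∈ trace (L.diagram.curve e)) :
    z ∈ openAnnulus ∨ ∃ i, z = L.diagram.boundaryPos i := by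
  rcases e with t | v
  · obtain ⟨p, q, rfl, hq, hp0, hp1, hc⟩ := L.trace_rung h
    -- A rung reaches a boundary circle only in an end on column `0` or `M + 1`, and every such end
    -- is a boundary vertex.
    have hb : ∀ c : ℕ, c = 0 ∨ c = L.M + 1 → p = 2 * c →
        ∃ i, L.gridPoint p q = L.diagram.boundaryPos i := by
      intro c hc0 hpc
      have : ∃ b, L.gridPoint p q = L.endPos (t, b) := by
        rcases hc c hpc with h | h
        · exact ⟨_, h⟩
        · exact ⟨_, h⟩
      obtain ⟨b, hb⟩ := this
      have hcol : L.col (t, b) = c := by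
        have h1 := (L.gridPoint_inj.1 hb).1
        have : (L.col (t, b) : ℝ) = c := by linarith
        exact_mod_cast this
      obtain ⟨i, hi⟩ := L.exists_boundaryEnd (t, b) (hcol ▸ hc0)
      exact ⟨i, by rw [hb, L.boundaryPos_eq, hi]⟩
    have hn := L.norm_gridPoint hp0 (L.slab_mem hq).1 (L.slab_mem hq).2
    rcases hp0.eq_or_lt with h0 | h0
    · exact Or.inr (hb 0 (Or.inl rfl) (by simp [← h0]))
    rcases hp1.eq_or_lt with h1 | h1
    · exact Or.inr (hb (L.M + 1) (Or.inr rfl) (by rw [h1]; push_cast; ring))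
    · left
      rw [openAnnulus, Set.mem_ofPred_eq, hn]
      exact ⟨L.X_zero ▸ L.X_strictMono h0, L.X_last ▸ L.X_strictMono h1⟩
  · exact Or.inl (L.mem_openAnnulus_of_strand h)

/-- A rung meets no vertex of another rung because the slabs are disjoint. An edge of a column meets
no third vertex because it joins vertices with cyclically consecutive keys. -/
theorem edge_vertex (e : L.diagram.E) (u : Fin (n₁ + n₂) ⊕ L.V)
    (h : L.diagram.pos u ∈ trace (L.diagram.curve e)) :
    u = L.diagram.src e ∨ u = L.diagram.tgt e := by
  rw [L.pos_eq] at h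
  obtain ⟨p, rfl⟩ : ∃ p, L.vtx p = u := ⟨L.endEquiv u, L.endEquiv.symm_apply_apply u⟩
  rw [endEquiv_vtx] at h
  rcases e with t | v
  · obtain ⟨a, q, hz, hq, -⟩ := L.trace_rung h
    have hq' := (L.gridPoint_inj.1 hz).2
    have ht : p.1 = t := by
      apply L.fst_eq_of_abs_le
      rw [← hq'] at hq
      exact_mod_cast hq
    obtain ⟨t', b⟩ := p
    obtain rfl : t' = t := ht
    cases b
    · exact Or.inl rfl
    · exact Or.inr rfl
  · have hc : L.col p = L.col v.1 := by
      have h1 := L.norm_of_mem_strand h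
      rw [L.norm_endPos, radius, L.X_strictMono.injective.eq_iff] at h1
      have : (L.col p : ℝ) = L.col v.1 := by linarith
      exact_mod_cast this
    set w : L.V := ⟨p, hc ▸ v.2⟩ with hw
    have hk : (L.key w : ℝ) = L.sgn (L.col v.1) * L.time p := by
      rw [← hc]; exact L.cast_key w
    have key : w = v ∨ w = L.next v := by
      by_cases hv : L.key v < L.key (L.next v)
      · obtain ⟨q, hz, -, -, h1, h2⟩ := L.trace_strand hv h
        rw [← (L.gridPoint_inj.1 hz).2, ← hk] at h1 h2
        have h1 : L.key v ≤ L.key w := by exact_mod_cast h1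
        have h2 : L.key w ≤ L.key (L.next v) := by exact_mod_cast h2
        rcases L.next_of_lt hv w hc with h3 | h3
        · exact Or.inl (L.eq_of_key_eq hc (le_antisymm h3 h1))
        · exact Or.inr (L.eq_of_key_eq (hc.trans (L.col_next v).symm) (le_antisymm h2 h3))
      · have h1 := (L.trace_wrap hv h).2 (L.time p) (by rw [endPos, hc]) (L.time_mem p).1
          (L.time_mem p).2
        rw [← hk] at h1
        have h1 : L.key v ≤ L.key w ∨ L.key w ≤ L.key (L.next v) := by exact_mod_cast h1
        have h2 := L.next_of_not_lt hv w hc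
        rcases h1 with h1 | h1
        · exact Or.inl (L.eq_of_key_eq hc (le_antisymm h2.1 h1))
        · exact Or.inr (L.eq_of_key_eq (hc.trans (L.col_next v).symm) (le_antisymm h1 h2.2))
    have hp : L.vtx p = Sum.inr w := L.vtx_eq_inr.2 rfl
    rcases key with h1 | h1
    · left; rw [hp, h1]; rfl
    · right; rw [hp, h1]; rfl

theorem exists_pos_eq (p : Fin L.T × Bool) : ∃ u, L.endPos p = L.diagram.pos u :=
  ⟨L.vtx p, by rw [L.pos_eq, endEquiv_vtx]⟩

theorem rung_strand {t : Fin L.T} {v : L.V} {z : Plane}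
    (h1 : z ∈ trace (L.diagram.curve (Sum.inl t)))
    (h2 : z ∈ trace (L.diagram.curve (Sum.inr v))) : ∃ u, z = L.diagram.pos u := by
  have h3 := L.norm_of_mem_strand h2
  obtain ⟨p, q, rfl, hq, hp0, hp1, hc⟩ := L.trace_rung h1
  rw [L.norm_gridPoint hp0 (L.slab_mem hq).1 (L.slab_mem hq).2, radius,
    L.X_strictMono.injective.eq_iff] at h3
  rcases hc _ h3 with h | h <;> rw [h] <;> exact L.exists_pos_eq _

theorem gridPoint_eq_endPos {v : L.V} {c : ℕ} {q : ℝ} (hc : L.col v.1 = c)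
    (h : (L.key v : ℝ) = L.sgn c * q) : L.gridPoint (2 * c) q = L.endPos v.1 := by
  rw [L.cast_key, hc] at h
  have : (L.time v.1 : ℝ) = q := by
    rcases L.cast_sgn c with hs | hs <;> rw [hs] at h <;> linarith
  rw [endPos, hc, this]

/-- If `v` has the smaller key, it is not last on its column, so its edge stays on the right side
and ends no later than `w`. The edge of `w` starts at `w` and, if it wraps around, comes back no
later than `v`. The two can meet only at `w` or at `v`. -/
theorem strand_strand {v w : L.V} (hvw : L.key v < L.key w ∨ L.key w < L.key v) {z : Plane}
    (h1 : z ∈ trace (L.diagram.curve (Sum.inr v)))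
    (h2 : z ∈ trace (L.diagram.curve (Sum.inr w))) : ∃ u, z = L.diagram.pos u := by
  wlog hlt : L.key v < L.key w generalizing v w
  · exact this hvw.symm h2 h1 (hvw.resolve_left hlt)
  have hc : L.col v.1 = L.col w.1 :=
    L.radius_eq_iff.1 ((L.norm_of_mem_strand h1).symm.trans (L.norm_of_mem_strand h2))
  have hlt' : (L.key v : ℝ) < L.key w := by exact_mod_cast hlt
  by_cases hv : L.key v < L.key (L.next v)
  · obtain ⟨q, rfl, hq0, hq1, h3, h4⟩ := L.trace_strand hv h1
    have h5 : L.key (L.next v) ≤ L.key w :=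
      (L.next_of_lt hv w hc.symm).resolve_left (not_le.2 hlt)
    have h5' : (L.key (L.next v) : ℝ) ≤ L.key w := by exact_mod_cast h5
    by_cases hw : L.key w < L.key (L.next w)
    · obtain ⟨q', hz, -, -, h6, -⟩ := L.trace_strand hw h2
      rw [← (L.gridPoint_inj.1 hz).2, ← hc] at h6
      rw [L.gridPoint_eq_endPos hc.symm (by linarith)]
      exact L.exists_pos_eq _
    · rcases (L.trace_wrap hw h2).2 q (by rw [hc]) hq0 hq1 with h6 | h6
      · rw [← hc] at h6
        rw [L.gridPoint_eq_endPos hc.symm (by linarith)]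
        exact L.exists_pos_eq _
      · have h7 := (L.next_of_not_lt hw v hc).2
        have h7' : (L.key (L.next w) : ℝ) ≤ L.key v := by exact_mod_cast h7
        rw [← hc] at h6
        rw [L.gridPoint_eq_endPos (v := v) rfl (by linarith)]
        exact L.exists_pos_eq _
  · have := (L.next_of_not_lt hv w hc.symm).1
    omega

theorem edge_disjoint (e f : L.diagram.E) (hef : e ≠ f) (z : Plane)
    (h : z ∈ trace (L.diagram.curve e) ∩ trace (L.diagram.curve f)) :
    ∃ u, z = L.diagram.pos u := by
  obtain ⟨h1, h2⟩ := h
  rcases e with t | v <;> rcases f with t' | w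
  · exfalso
    obtain ⟨p, q, rfl, hq, -⟩ := L.trace_rung h1
    obtain ⟨p', q', hz, hq', -⟩ := L.trace_rung h2
    rw [← (L.gridPoint_inj.1 hz).2] at hq'
    rw [abs_le] at hq hq'
    apply hef
    have h3 : (8 : ℝ) * t.val ≤ 8 * t'.val + 4 := by linarith
    have h4 : (8 : ℝ) * t'.val ≤ 8 * t.val + 4 := by linarith
    have h3 : 8 * t.val ≤ 8 * t'.val + 4 := by exact_mod_cast h3
    have h4 : 8 * t'.val ≤ 8 * t.val + 4 := by exact_mod_cast h4
    exact congrArg _ (Fin.ext (by omega))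
  · exact L.rung_strand h1 h2
  · exact L.rung_strand h2 h1
  · have hc : L.col v.1 = L.col w.1 :=
      L.radius_eq_iff.1 ((L.norm_of_mem_strand h1).symm.trans (L.norm_of_mem_strand h2))
    refine L.strand_strand ?_ h1 h2
    exact lt_or_gt_of_ne fun h => hef (congrArg _ (L.eq_of_key_eq hc h))

theorem edge_simple (e : L.diagram.E) : IsSimpleArc (L.diagram.curve e) := by
  rcases e with t | v
  · have h1 := L.midX_start t
    have h2 := L.midX_end t
    have hs := L.cast_sgn (L.col (t, false))
    have hs' := L.cast_sgn (L.col (t, true))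
    rw [curve_rung]
    simp only [IsSimpleArc, trace]
    refine ⟨?_, ?_, ?_, Set.inter_subset_right, trivial⟩
    · intro h
      have := (L.gridPoint_inj.1 h).1
      rcases h1 with h1 | h1 <;> linarith
    · rintro z ⟨m1, m2⟩
      have m2 : z ∈ segment ℝ (L.midPos t) (L.endPos (t, true)) := by
        rcases m2 with m2 | m2
        · exact m2
        · rw [Set.mem_singleton_iff] at m2
          rw [m2]; exact right_mem_segment _ _ _
      obtain ⟨θ, a0, a1, rfl⟩ := L.mem_segment_gridPoint m1
      obtain ⟨η, b0, b1, hz⟩ := L.mem_segment_gridPoint m2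
      obtain ⟨hx, hy⟩ := L.gridPoint_inj.1 hz
      -- The two halves of a bump are separated by the height of the bend, those of any other rung
      -- by its abscissa.
      have hθ : θ = 1 := by
        by_cases hc : L.col (t, false) = L.col (t, true)
        · rw [L.time_start, L.time_end, ← hc] at hy
          push_cast at hy
          rcases hs with hs | hs <;> rw [hs] at hy <;> linarith
        · have hm : (L.midX t : ℝ) = L.col (t, false) + L.col (t, true) := by
            rw [midX, if_neg hc]; push_cast; rfl
          rw [hm] at hx h1
          rcases h1 with h1 | h1
          · have : (L.col (t, true) : ℝ) = 1 + L.col (t, false) := by linarith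
            rw [this] at hx; linarith
          · have : (L.col (t, true) : ℝ) = L.col (t, false) - 1 := by linarith
            rw [this] at hx; linarith
      rw [Set.mem_singleton_iff, hθ, midPos, gridPoint_inj, L.time_start]
      push_cast
      constructor <;> ring
    · intro h
      have := (L.gridPoint_inj.1 h).1
      rcases h2 with h2 | h2 <;> linarith
  · by_cases hv : L.key v < L.key (L.next v)
    · rw [L.curve_strand hv]
      refine ⟨fun h => ?_, Set.inter_subset_right, trivial⟩
      exact L.next_ne v (Subtype.ext (L.endPos_injective h)).symm
    · rw [L.wrap_eq hv]
      exact isSimpleArc_wrap (L.cast_sgn _) (L.radius_mem v).1 (L.abs_Y_time _) (L.abs_Y_time _)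
        (L.sgn_mul_Y_lt hv)

end Ladder

end AnnularNetwork

namespace AnnularNetwork

namespace Ladder

variable {n₁ n₂ : ℕ} (L : Ladder n₁ n₂)

/-! ### The network of a ladder -/

theorem src_eq_inr_strand {w v : L.V} : L.src (Sum.inr w) = Sum.inr v ↔ w = v :=
  Sum.inr_injective.eq_iff

theorem tgt_eq_inr_strand {w v : L.V} :
    L.tgt (Sum.inr w) = Sum.inr v ↔ w = L.nextEquiv.symm v := by
  rw [Equiv.eq_symm_apply]
  exact Sum.inr_injective.eq_iff

theorem outDegree_inl (i : Fin (n₁ + n₂)) :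
    L.diagram.outDegree (Sum.inl i) = if (L.boundaryEnd i).2 = false then 1 else 0 := by
  change Set.ncard {e : Fin L.T ⊕ L.V | L.src e = Sum.inl i} = _
  obtain ⟨⟨t, b⟩, hb⟩ : ∃ p, p = L.boundaryEnd i := ⟨_, rfl⟩
  have h1 : ∀ t', L.src (Sum.inl t') = Sum.inl i ↔ (t', false) = (t, b) := fun t' => by
    rw [hb]; exact L.vtx_eq_inl
  have h2 : ∀ v, L.src (Sum.inr v) ≠ Sum.inl i := fun v => Sum.inr_ne_inl
  rw [← hb]
  cases b
  · rw [if_pos rfl, Set.ncard_eq_one]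
    exact ⟨Sum.inl t, Set.ext fun e => by rcases e with t' | v <;> simp [h1, h2]⟩
  · rw [if_neg (by simp), Set.ncard_eq_zero]
    exact Set.eq_empty_of_forall_notMem fun e => by rcases e with t' | v <;> simp [h1, h2]

theorem outDegree_inr (v : L.V) :
    L.diagram.outDegree (Sum.inr v) = if v.1.2 = false then 2 else 1 := by
  change Set.ncard {e : Fin L.T ⊕ L.V | L.src e = Sum.inr v} = _
  obtain ⟨⟨t, b⟩, hb⟩ : ∃ p, p = v.1 := ⟨_, rfl⟩
  have h1 : ∀ t', L.src (Sum.inl t') = Sum.inr v ↔ (t', false) = (t, b) := fun t' => by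
    rw [hb]; exact L.vtx_eq_inr
  rw [← hb]
  cases b
  · rw [if_pos rfl, Set.ncard_eq_two]
    refine ⟨Sum.inl t, Sum.inr v, Sum.inl_ne_inr, Set.ext fun e => ?_⟩
    rcases e with t' | w
    · simp [h1]
    · exact L.src_eq_inr_strand.trans (by simp)
  · rw [if_neg (by simp), Set.ncard_eq_one]
    refine ⟨Sum.inr v, Set.ext fun e => ?_⟩
    rcases e with t' | w
    · simp [h1]
    · exact L.src_eq_inr_strand.trans (by simp)

theorem inDegree_inl (i : Fin (n₁ + n₂)) :
    L.diagram.inDegree (Sum.inl i) = if (L.boundaryEnd i).2 = false then 0 else 1 := by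
  change Set.ncard {e : Fin L.T ⊕ L.V | L.tgt e = Sum.inl i} = _
  obtain ⟨⟨t, b⟩, hb⟩ : ∃ p, p = L.boundaryEnd i := ⟨_, rfl⟩
  have h1 : ∀ t', L.tgt (Sum.inl t') = Sum.inl i ↔ (t', true) = (t, b) := fun t' => by
    rw [hb]; exact L.vtx_eq_inl
  have h2 : ∀ v, L.tgt (Sum.inr v) ≠ Sum.inl i := fun v => Sum.inr_ne_inl
  rw [← hb]
  cases b
  · rw [if_pos rfl, Set.ncard_eq_zero]
    exact Set.eq_empty_of_forall_notMem fun e => by rcases e with t' | v <;> simp [h1, h2]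
  · rw [if_neg (by simp), Set.ncard_eq_one]
    exact ⟨Sum.inl t, Set.ext fun e => by rcases e with t' | v <;> simp [h1, h2]⟩

theorem inDegree_inr (v : L.V) :
    L.diagram.inDegree (Sum.inr v) = if v.1.2 = false then 1 else 2 := by
  change Set.ncard {e : Fin L.T ⊕ L.V | L.tgt e = Sum.inr v} = _
  obtain ⟨⟨t, b⟩, hb⟩ : ∃ p, p = v.1 := ⟨_, rfl⟩
  have h1 : ∀ t', L.tgt (Sum.inl t') = Sum.inr v ↔ (t', true) = (t, b) := fun t' => by
    rw [hb]; exact L.vtx_eq_inr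
  rw [← hb]
  cases b
  · rw [if_pos rfl, Set.ncard_eq_one]
    refine ⟨Sum.inr (L.nextEquiv.symm v), Set.ext fun e => ?_⟩
    rcases e with t' | w
    · simp [h1]
    · exact L.tgt_eq_inr_strand.trans (by simp)
  · rw [if_neg (by simp), Set.ncard_eq_two]
    refine ⟨Sum.inl t, Sum.inr (L.nextEquiv.symm v), Sum.inl_ne_inr, Set.ext fun e => ?_⟩
    rcases e with t' | w
    · simp [h1]
    · exact L.tgt_eq_inr_strand.trans (by simp)

theorem src_ne_tgt (e : L.diagram.E) : L.diagram.src e ≠ L.diagram.tgt e := by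
  rcases e with t | v
  · intro h
    have := L.vtx_injective h
    simp at this
  · intro h
    exact L.next_ne v (Sum.inr_injective h).symm

theorem cut_eq : L.diagram.cut = [(-1, 0), (-2, 0)] := by
  change circlePoint 5 :: ([] ++ [(2 : ℝ) • circlePoint (-3)]) = _
  rw [circlePoint_five, circlePoint_neg_three]; simp

theorem mem_cut_segment {z : Plane} (h : z ∈ segment ℝ ((-1, 0) : Plane) (-2, 0)) :
    ∃ θ : ℝ, 0 ≤ θ ∧ θ ≤ 1 ∧ z = (-(1 + θ), 0) := by
  obtain ⟨θ, h0, h1, rfl⟩ := mem_segment_plane h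
  refine ⟨θ, h0, h1, ?_⟩
  ext
  · simp only; ring
  · simp

theorem mem_cut {z : Plane} (h : z ∈ trace L.diagram.cut) :
    ∃ θ : ℝ, 0 ≤ θ ∧ θ ≤ 1 ∧ z = (-(1 + θ), 0) := by
  rw [cut_eq] at h
  simp only [trace, Set.mem_union, Set.mem_singleton_iff] at h
  rcases h with h | rfl
  · exact mem_cut_segment h
  · exact mem_cut_segment (right_mem_segment _ _ _)

theorem cut_mem (z : Plane) (h : z ∈ trace L.diagram.cut) : z ∈ openAnnulus ∨
    z = circlePoint L.diagram.innerBase ∨ z = (2 : ℝ) • circlePoint L.diagram.outerBase := by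
  obtain ⟨θ, h0, h1, rfl⟩ := L.mem_cut h
  rcases h0.eq_or_lt with rfl | h0
  · right; left
    change _ = circlePoint 5
    rw [circlePoint_five]; simp
  rcases h1.eq_or_lt with rfl | h1
  · right; right
    change _ = (2 : ℝ) • circlePoint (-3)
    rw [circlePoint_neg_three]
    ext <;> norm_num
  · left
    have : ‖((-(1 + θ), 0) : Plane)‖ = 1 + θ := by
      rw [Prod.norm_def, Real.norm_eq_abs, abs_neg, abs_of_pos (by linarith), norm_zero,
        max_eq_left (by linarith)]
    rw [openAnnulus, Set.mem_ofPred_eq, this]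
    constructor <;> linarith

theorem endPos_fst_pos (p : Fin L.T × Bool) : 0 < (L.endPos p).1 :=
  lt_of_lt_of_le one_pos (L.one_le_X (by positivity))

theorem midPos_fst_pos (t : Fin L.T) : 0 < (L.midPos t).1 :=
  lt_of_lt_of_le one_pos (L.one_le_X (by positivity))

/-- The cut lies on the negative horizontal axis, which no vertex or bend touches. -/
theorem mem_curve {e : L.diagram.E} {z : Plane} (h : z ∈ L.diagram.curve e) :
    0 < z.1 ∨ z.2 ≠ 0 := by
  rcases e with t | v
  · rw [curve_rung] at h
    simp only [List.mem_cons, List.not_mem_nil, or_false] at h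
    rcases h with rfl | rfl | rfl
    · exact Or.inl (L.endPos_fst_pos _)
    · exact Or.inl (L.midPos_fst_pos _)
    · exact Or.inl (L.endPos_fst_pos _)
  · by_cases hv : L.key v < L.key (L.next v)
    · rw [L.curve_strand hv] at h
      simp only [List.mem_cons, List.not_mem_nil, or_false] at h
      rcases h with rfl | rfl <;> exact Or.inl (L.endPos_fst_pos _)
    · rw [L.curve_wrap hv] at h
      have hr : L.radius v ≠ 0 := by linarith [(L.radius_mem v).1]
      have hs : (L.sgn (L.col v.1) : ℝ) ≠ 0 := by
        rcases L.cast_sgn (L.col v.1) with h | h <;> rw [h] <;> norm_num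
      simp only [wrapBends, List.cons_append, List.nil_append, List.mem_cons, List.not_mem_nil,
        or_false] at h
      rcases h with rfl | rfl | rfl | rfl | rfl | rfl
      · exact Or.inl (L.endPos_fst_pos _)
      · right; exact mul_ne_zero hs hr
      · right; exact mul_ne_zero hs hr
      · right; exact neg_ne_zero.2 (mul_ne_zero hs hr)
      · right; exact neg_ne_zero.2 (mul_ne_zero hs hr)
      · exact Or.inl (L.endPos_fst_pos _)

theorem general_position (e : L.diagram.E) :
    (∀ z ∈ L.diagram.curve e, z ∉ trace L.diagram.cut) ∧
    (∀ z ∈ L.diagram.cut, z ∉ trace (L.diagram.curve e)) := by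
  constructor
  · intro z hz hz'
    obtain ⟨θ, h0, h1, rfl⟩ := L.mem_cut hz'
    rcases L.mem_curve hz with h | h
    · simp only at h; linarith
    · exact h rfl
  · intro z hz hz'
    -- The base points of the cut lie on the boundary circles, where edges have only boundary
    -- vertices, all of them on the right side.
    have hn : z.1 < 0 ∧ (‖z‖ = 1 ∨ ‖z‖ = 2) := by
      rw [cut_eq] at hz
      simp only [List.mem_cons, List.not_mem_nil, or_false] at hz
      rcases hz with rfl | rfl <;> simp [Prod.norm_def]
    rcases L.edge_mem e z hz' with h | ⟨i, rfl⟩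
    · rw [openAnnulus, Set.mem_ofPred_eq] at h
      rcases hn.2 with h' | h' <;> rw [h'] at h <;> linarith [h.1, h.2]
    · rw [L.boundaryPos_eq] at hn
      exact hn.1.not_gt (L.endPos_fst_pos _)

theorem param_lt_outer {i j : Fin (n₁ + n₂)} (hi : i.val < n₁) (hj : j.val < n₁) :
    L.diagram.param i < L.diagram.param j ↔
      L.time (L.boundaryEnd i) < L.time (L.boundaryEnd j) := by
  simp only [diagram, if_pos hi, if_pos hj]
  rw [add_lt_add_iff_left, div_lt_div_iff_of_pos_right two_pos, L.Y_strictMono.lt_iff_lt]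
  exact Int.cast_lt

theorem param_lt_inner {i j : Fin (n₁ + n₂)} (hi : ¬ i.val < n₁) (hj : ¬ j.val < n₁) :
    L.diagram.param i < L.diagram.param j ↔
      L.time (L.boundaryEnd i) < L.time (L.boundaryEnd j) := by
  simp only [diagram, if_neg hi, if_neg hj]
  rw [add_lt_add_iff_left, div_lt_div_iff_of_pos_right one_pos, L.Y_strictMono.lt_iff_lt]
  exact Int.cast_lt

theorem param_outer_lt (i j : Fin (n₁ + n₂)) (hij : i < j) (hj : j.val < n₁) :
    L.diagram.param i < L.diagram.param j := by
  have hij' : i.val < j.val := hij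
  rw [L.param_lt_outer (by omega) hj]
  exact L.time_lt_time (L.outer_lt i j hij hj)

theorem param_inner_lt (i j : Fin (n₁ + n₂)) (hij : i < j) (hi : n₁ ≤ i.val) :
    L.diagram.param j < L.diagram.param i := by
  have hij' : i.val < j.val := hij
  rw [L.param_lt_inner (by omega) (by omega)]
  exact L.time_lt_time (L.inner_lt i j hij hi)

/-- A ladder as a perfect planar network in the annulus. -/
def network (I : Finset (Fin (n₁ + n₂))) (hI : ∀ i, i ∈ I ↔ (L.boundaryEnd i).2 = false) :
    Network n₁ n₂ I where
  toDiagram := L.diagram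
  finite_V := inferInstanceAs (Finite L.V)
  finite_E := inferInstanceAs (Finite (Fin L.T ⊕ L.V))
  src_ne_tgt := L.src_ne_tgt
  source i hi := by
    rw [L.outDegree_inl, L.inDegree_inl, if_pos ((hI i).1 hi), if_pos ((hI i).1 hi)]
    exact ⟨rfl, rfl⟩
  sink i hi := by
    rw [L.outDegree_inl, L.inDegree_inl, if_neg (fun h => hi ((hI i).2 h)),
      if_neg (fun h => hi ((hI i).2 h))]
    exact ⟨rfl, rfl⟩
  -- At the start of a rung the column branches (white); at its terminus the rung joins the column
  -- (black).
  white_or_black v := by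
    have h1 := L.inDegree_inr v
    have h2 := L.outDegree_inr v
    by_cases h : v.1.2 = false
    · rw [if_pos h] at h1 h2
      exact Or.inl ⟨h1, h2⟩
    · rw [if_neg h] at h1 h2
      exact Or.inr ⟨h1, h2⟩
  param_outer i _ := by
    have h := L.param_mem i
    change -3 < _ ∧ _ < (-3 : ℝ) + 8
    constructor <;> linarith
  param_outer_lt := L.param_outer_lt
  param_inner i _ := by
    have h := L.param_mem i
    change (5 : ℝ) - 8 < _ ∧ _ < (5 : ℝ)
    constructor <;> linarith
  param_inner_lt := L.param_inner_lt
  innerPos_mem v := by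
    have h : ‖L.endPos v.1‖ = L.radius v := L.norm_endPos v.1
    change 1 < ‖L.endPos v.1‖ ∧ ‖L.endPos v.1‖ < 2
    rw [h]
    exact L.radius_mem v
  innerPos_injective _ _ h := Subtype.ext (L.endPos_injective h)
  edge_simple := L.edge_simple
  edge_mem := L.edge_mem
  edge_vertex := L.edge_vertex
  edge_disjoint := L.edge_disjoint
  cut_simple := by
    rw [cut_eq]
    refine ⟨?_, Set.inter_subset_right, trivial⟩
    simp
  cut_mem := L.cut_mem
  general_position := L.general_position

/-! ### Indices and signs -/

/-- In each case the segment lies in an open half-plane that is disjoint from the cut. -/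
theorem crossing_eq_zero {a b : Plane}
    (h : (0 < a.1 ∧ 0 < b.1) ∨ (0 < a.2 ∧ 0 < b.2) ∨ (a.2 < 0 ∧ b.2 < 0)) :
    crossing (a, b) ((-1, 0), (-2, 0)) = 0 := by
  rw [crossing, if_neg]
  rintro ⟨z, h1, h2⟩
  obtain ⟨θ, h0, -, rfl⟩ := mem_cut_segment h2
  obtain ⟨η, e0, e1, hz⟩ := mem_segment_plane h1
  have hx := congrArg Prod.fst hz
  have hy := congrArg Prod.snd hz
  simp only at hx hy
  rcases e1.eq_or_lt with rfl | e1
  · rcases h with h | h | h <;> linarith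
  · rcases h with h | h | h
    · nlinarith [mul_pos (sub_pos.2 e1) h.1, mul_nonneg e0 h.2.le]
    · nlinarith [mul_pos (sub_pos.2 e1) h.1, mul_nonneg e0 h.2.le]
    · nlinarith [mul_pos (sub_pos.2 e1) (neg_pos.2 h.1), mul_nonneg e0 (neg_pos.2 h.2).le]

theorem intersectionNumber_cut (γ : List Plane) :
    intersectionNumber γ L.diagram.cut =
      ((segments γ).map fun s => crossing s ((-1, 0), (-2, 0))).sum := by
  simp [intersectionNumber, cut_eq, segments]

theorem ind_rung (t : Fin L.T) : L.diagram.ind (Sum.inl t) = 0 := by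
  change intersectionNumber (L.diagram.curve _) L.diagram.cut = _
  rw [intersectionNumber_cut, curve_rung]
  simp [segments, crossing_eq_zero (Or.inl ⟨L.endPos_fst_pos _, L.midPos_fst_pos _⟩),
    crossing_eq_zero (Or.inl ⟨L.midPos_fst_pos _, L.endPos_fst_pos _⟩)]

theorem ind_strand {v : L.V} (hv : L.key v < L.key (L.next v)) :
    L.diagram.ind (Sum.inr v) = 0 := by
  change intersectionNumber (L.diagram.curve _) L.diagram.cut = _
  rw [intersectionNumber_cut, L.curve_strand hv]
  simp [segments, crossing_eq_zero (Or.inl ⟨L.endPos_fst_pos _, L.endPos_fst_pos _⟩)]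

/-- Only the left side of the closing edge meets the cut. A counterclockwise column runs downwards
there while the cut points to the left, a negatively oriented pair; the other orientation reverses
the sign. -/
theorem ind_wrap {v : L.V} (hv : ¬ L.key v < L.key (L.next v)) :
    L.diagram.ind (Sum.inr v) = -L.sgn (L.col v.1) := by
  have hr : 0 < L.radius v := by linarith [(L.radius_mem v).1]
  change intersectionNumber (L.diagram.curve _) L.diagram.cut = _
  rw [intersectionNumber_cut, L.wrap_eq hv]
  set r := L.radius v
  set y := L.Y (L.time v.1)
  set y' := L.Y (L.time (L.next v).1)
  have hs : (0 : ℝ) < L.sgn (L.col v.1) * r ∨ (L.sgn (L.col v.1) : ℝ) * r < 0 := by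
    rcases L.cast_sgn (L.col v.1) with h | h <;> rw [h]
    · left; linarith
    · right; linarith
  set s : ℝ := ((L.sgn (L.col v.1) : ℤ) : ℝ)
  have c1 : crossing ((r, y), (r, s * r)) ((-1, 0), (-2, 0)) = 0 :=
    crossing_eq_zero (Or.inl ⟨hr, hr⟩)
  have c2 : crossing ((r, s * r), (-r, s * r)) ((-1, 0), (-2, 0)) = 0 :=
    crossing_eq_zero (Or.inr (hs.imp (fun h => ⟨h, h⟩) (fun h => ⟨h, h⟩)))
  have c4 : crossing ((-r, -(s * r)), (r, -(s * r))) ((-1, 0), (-2, 0)) = 0 :=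
    crossing_eq_zero (Or.inr (hs.symm.imp (fun h => ⟨neg_pos.2 h, neg_pos.2 h⟩)
      (fun h => ⟨neg_lt_zero.2 h, neg_lt_zero.2 h⟩)))
  have c5 : crossing ((r, -(s * r)), (r, y')) ((-1, 0), (-2, 0)) = 0 :=
    crossing_eq_zero (Or.inl ⟨hr, hr⟩)
  have c3 : crossing ((-r, s * r), (-r, -(s * r))) ((-1, 0), (-2, 0)) = -L.sgn (L.col v.1) := by
    rw [crossing, if_pos]
    · have hd : det (((-r, -(s * r)) : Plane) - (-r, s * r)) (((-2, 0) : Plane) - (-1, 0)) =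
          -(2 * (s * r)) := by
        simp only [det, Prod.fst_sub, Prod.snd_sub]; ring
      simp only [hd]
      rcases L.sgn_eq (L.col v.1) with h | h
      · have : -(2 * (s * r)) < 0 := by
          have : s = 1 := by simp [s, h]
          rw [this]; linarith
        rw [sign_neg this, h]; rfl
      · have : 0 < -(2 * (s * r)) := by
          have : s = -1 := by simp [s, h]
          rw [this]; linarith
        rw [sign_pos this, h]; rfl
    · have hr1 := L.radius_mem v
      refine ⟨(-r, 0), ?_, ?_⟩
      · rw [segment_eq_image']
        refine ⟨1 / 2, by norm_num, ?_⟩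
        ext
        · simp
        · simp; ring
      · rw [segment_eq_image']
        refine ⟨r - 1, ⟨by linarith, by linarith⟩, ?_⟩
        ext
        · simp; ring
        · simp
  simp [wrapBends, segments, c1, c2, c3, c4, c5]

/-- The vertical direction of the edges at a vertex. -/
def direction (u : Fin (n₁ + n₂) ⊕ L.V) : ℝ := L.sgn (L.col (L.endEquiv u))

theorem direction_inl (i : Fin (n₁ + n₂)) : L.direction (Sum.inl i) = 1 := by
  rw [direction, endEquiv_inl, L.col_boundaryEnd]
  split_ifs
  · simp [L.sgn_last]
  · simp [L.sgn_zero]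

theorem Y_sub_Y (q q' : ℝ) : L.Y q - L.Y q' = (q - q') / (4 * (L.T + 1)) := by
  rw [Y, Y]; ring

/-- This explains the heights in the drawing. A rung leaves its start by one unit in the vertical
direction of the first column and reaches its terminus by one unit in that of the second, so it
agrees with the column edges at both vertices. Boundary columns have sign `1`, hence point upwards.
-/
theorem vertexMonotone : L.diagram.VertexMonotone L.direction := by
  have hT : (0 : ℝ) < 4 * (L.T + 1) := by positivity
  rintro (t | v)
  · have h1 : L.direction (L.diagram.src (Sum.inl t)) = L.sgn (L.col (t, false)) := by
      change L.direction (L.vtx (t, false)) = _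
      rw [direction, endEquiv_vtx]
    have h2 : L.direction (L.diagram.tgt (Sum.inl t)) = L.sgn (L.col (t, true)) := by
      change L.direction (L.vtx (t, true)) = _
      rw [direction, endEquiv_vtx]
    rw [curve_rung, h1, h2]
    constructor
    · rintro a ha
      simp only [steps, segments, List.tail_cons, List.zip_cons_cons, List.map_cons,
        List.head?_cons, Option.mem_def, Option.some.injEq] at ha
      subst ha
      simp only [Prod.snd_sub, midPos, endPos, gridPoint, Y_sub_Y, L.time_start]
      push_cast
      rw [add_sub_cancel_left]
      rcases L.cast_sgn (L.col (t, false)) with h | h <;> rw [h]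
      · positivity
      · rw [neg_div, neg_mul_neg]; positivity
    · rintro a ha
      simp only [steps, segments, List.tail_cons, List.zip_cons_cons, List.map_cons,
        List.zip_nil_right, List.map_nil, List.getLast?_cons_cons, List.getLast?_singleton,
        Option.mem_def, Option.some.injEq] at ha
      subst ha
      simp only [Prod.snd_sub, midPos, endPos, gridPoint, Y_sub_Y, L.time_end]
      push_cast
      rw [add_sub_cancel_left]
      rcases L.cast_sgn (L.col (t, true)) with h | h <;> rw [h]
      · positivity
      · rw [neg_div, neg_mul_neg]; positivity
  · have h1 : L.direction (L.diagram.src (Sum.inr v)) = L.sgn (L.col v.1) := rfl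
    have h2 : L.direction (L.diagram.tgt (Sum.inr v)) = L.sgn (L.col v.1) := by
      change (L.sgn (L.col (L.next v).1) : ℝ) = _
      rw [L.col_next]
    rw [h1, h2]
    by_cases hv : L.key v < L.key (L.next v)
    · have h3 : (0 : ℝ) < (L.Y (L.time (L.next v).1) - L.Y (L.time v.1)) *
          L.sgn (L.col v.1) := by
        rw [Y_sub_Y, div_mul_eq_mul_div]
        refine div_pos ?_ hT
        have h4 : (L.key v : ℝ) < L.key (L.next v) := by exact_mod_cast hv
        rw [L.cast_key, L.cast_key_next] at h4
        linarith
      rw [L.curve_strand hv]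
      constructor <;> rintro a ha <;>
        simp only [steps, segments, List.tail_cons, List.zip_cons_cons, List.map_cons,
          List.zip_nil_right, List.map_nil, List.head?_cons, List.getLast?_singleton,
          Option.mem_def, Option.some.injEq] at ha <;> subst ha <;> exact h3
    · have hr := (L.radius_mem v).1
      have a1 := abs_lt.1 (L.abs_Y_time v.1)
      have a2 := abs_lt.1 (L.abs_Y_time (L.next v).1)
      rw [L.wrap_eq hv]
      constructor <;> rintro a ha <;>
        simp only [steps, segments, wrapBends, List.cons_append, List.nil_append, List.tail_cons,
          List.zip_cons_cons, List.map_cons, List.zip_nil_right, List.map_nil, List.head?_cons,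
          List.getLast?_cons_cons, List.getLast?_singleton,
          Option.mem_def, Option.some.injEq] at ha <;> subst ha <;>
        rcases L.cast_sgn (L.col v.1) with h | h <;> rw [h] <;> simp only [Prod.snd_sub] <;>
        linarith

/-- The sign of the paths from `b_i` to `b_j` in a ladder, up to the signs of their edges. -/
def closingSign (n₁ : ℕ) {n : ℕ} (i j : Fin n) : ℤ :=
  -paritySign (if (i.val < n₁ ∧ j.val < n₁ ∧ j < i) ∨ (n₁ ≤ i.val ∧ n₁ ≤ j.val ∧ i < j) then 0
    else 1)

theorem closingSign_mul_self (n₁ : ℕ) {n : ℕ} (i j : Fin n) :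
    closingSign n₁ i j * closingSign n₁ i j = 1 := by
  rw [closingSign, neg_mul_neg, paritySign_mul_self]

/-- Labels run clockwise on the inner circle, so there the order of the parameters is reversed. In
particular the sign of the closing curve does not depend on the ladder. -/
theorem param_lt_iff {i j : Fin (n₁ + n₂)} :
    ((i.val < n₁ ↔ j.val < n₁) ∧ L.diagram.param j < L.diagram.param i) ↔
    (i.val < n₁ ∧ j.val < n₁ ∧ j < i) ∨ (n₁ ≤ i.val ∧ n₁ ≤ j.val ∧ i < j) := by
  by_cases hi : i.val < n₁ <;> by_cases hj : j.val < n₁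
  · simp only [hi, hj, true_and, not_le.2 hi, false_and, or_false]
    refine ⟨fun h => ?_, fun h => L.param_outer_lt j i h hi⟩
    by_contra h'
    rcases (not_lt.1 h').eq_or_lt with rfl | h'
    · exact lt_irrefl _ h
    · exact lt_asymm h (L.param_outer_lt i j h' hj)
  · simp [hi, hj]
  · simp [hi, hj]
  · simp only [hi, hj, true_and, not_lt.1 hi, not_lt.1 hj, false_and, false_or]
    refine ⟨fun h => ?_, fun h => L.param_inner_lt i j h (not_lt.1 hi)⟩
    by_contra h'
    rcases (not_lt.1 h').eq_or_lt with rfl | h'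
    · exact lt_irrefl _ h
    · exact lt_asymm h (L.param_inner_lt j i h' (not_lt.1 hj))

theorem pathSign_eq {i j : Fin (n₁ + n₂)} (hij : i ≠ j) {P : List L.diagram.E}
    (hP : L.diagram.IsPath (Sum.inl i) (Sum.inl j) P) :
    L.diagram.pathSign i j P = closingSign n₁ i j * (P.map L.diagram.edgeSign).prod := by
  obtain ⟨h1, h2, h3, h4⟩ := Diagram.closingSteps_spec (D := L.diagram) rfl rfl rfl L.param_mem i j
  rw [L.vertexMonotone.pathSign_eq L.direction_inl h2 h3 h4 hij hP, h1, closingSign]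
  simp only [L.param_lt_iff]

end Ladder

end AnnularNetwork

namespace AnnularNetwork

/-! ### Circuits -/

/-- The gates of a circuit with `m + 1` columns: rungs between different columns, rungs that run
parallel to an edge of a column, and rungs that start at a source or end at a sink. -/
inductive Gate (n m : ℕ)
  | rung (a b : Fin (m + 1)) (w : ℝ)
  | bump (a : Fin (m + 1)) (w w' : ℝ)
  | source (i : Fin n)
  | sink (i : Fin n) (w : ℝ)

namespace Gate

variable {n m : ℕ}

/-- The column next to a boundary vertex. -/
def boundaryCol (n₁ m : ℕ) {n : ℕ} (i : Fin n) : Fin (m + 1) :=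
  if i.val < n₁ then Fin.last m else 0

/-- The column at which a gate starts. -/
def startCol (n₁ : ℕ) : Gate n m → ℕ
  | rung a _ _ => a + 1
  | bump a _ _ => a + 1
  | source i => if i.val < n₁ then m + 2 else 0
  | sink i _ => boundaryCol n₁ m i + 1

/-- The column at which a gate ends. -/
def endCol (n₁ : ℕ) : Gate n m → ℕ
  | rung _ b _ => b + 1
  | bump a _ _ => a + 1
  | source i => boundaryCol n₁ m i + 1
  | sink i _ => if i.val < n₁ then m + 2 else 0

/-- The boundary vertex of a gate. -/
def label : Gate n m → Option (Fin n)
  | source i => some i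
  | sink i _ => some i
  | _ => none

/-- The gate leads to a sink. -/
def isSink : Gate n m → Bool
  | sink _ _ => true
  | _ => false

/-- The weight of the rung. -/
def weight : Gate n m → ℝ
  | rung _ _ w => w
  | bump _ _ w' => w'
  | source _ => 1
  | sink _ w => w

/-- The weight of the edge of the column that continues the path at the start of the gate. -/
def sideWeight : Gate n m → ℝ
  | bump _ w _ => w
  | _ => 1

/-- The gate joins neighbouring columns, and its weights do not vanish. -/
def Valid : Gate n m → Prop
  | rung a b w => (a.val + 1 = b.val ∨ b.val + 1 = a.val) ∧ w ≠ 0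
  | bump _ w w' => w ≠ 0 ∧ w' ≠ 0
  | source _ => True
  | sink _ w => w ≠ 0

theorem Valid.weight_ne {g : Gate n m} (h : g.Valid) : g.weight ≠ 0 := by
  cases g
  · exact h.2
  · exact h.2
  · exact one_ne_zero
  · exact h

theorem Valid.sideWeight_ne {g : Gate n m} (h : g.Valid) : g.sideWeight ≠ 0 := by
  cases g
  · exact one_ne_zero
  · exact h.1
  · exact one_ne_zero
  · exact one_ne_zero

theorem boundaryCol_val (n₁ m : ℕ) (i : Fin n) :
    (boundaryCol n₁ m i).val = if i.val < n₁ then m else 0 := by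
  rw [boundaryCol]; split_ifs <;> rfl

theorem col_bounds (n₁ : ℕ) {g : Gate n m} (h : g.Valid) :
    g.startCol n₁ ≤ m + 2 ∧ g.endCol n₁ ≤ m + 2 ∧ g.startCol n₁ ≤ g.endCol n₁ + 1 ∧
    g.endCol n₁ ≤ g.startCol n₁ + 1 ∧ ((0 < g.startCol n₁ ∧ g.startCol n₁ < m + 2) ∨
      (0 < g.endCol n₁ ∧ g.endCol n₁ < m + 2)) := by
  cases g with
  | rung a b w =>
    have := h.1
    simp only [startCol, endCol]
    omega
  | bump a w w' =>
    simp only [startCol, endCol]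
    omega
  | source i =>
    simp only [startCol, endCol, boundaryCol_val]
    split_ifs <;> omega
  | sink i w =>
    simp only [startCol, endCol, boundaryCol_val]
    split_ifs <;> omega

end Gate

/-- The order of the labels on the right sides of the boundary circles, by increasing height. -/
def LabelBelow (n₁ : ℕ) {n : ℕ} (i j : Fin n) : Prop :=
  i ≠ j ∧ (i.val < n₁ → j.val < n₁ → i < j) ∧ (n₁ ≤ i.val → n₁ ≤ j.val → j < i)

/-- A circuit: oriented columns and a list of gates, by increasing height. -/
structure Circuit (n₁ n₂ m : ℕ) (I : Finset (Fin (n₁ + n₂))) where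
  orient : Fin (m + 1) → ℤ
  orient_eq : ∀ c, orient c = 1 ∨ orient c = -1
  gates : List (Gate (n₁ + n₂) m)
  valid : ∀ g ∈ gates, g.Valid
  order : gates.Pairwise fun g g' => ∀ i ∈ g.label, ∀ j ∈ g'.label, LabelBelow n₁ i j
  exists_source : ∀ i ∈ I, Gate.source i ∈ gates
  exists_sink : ∀ i ∉ I, ∃ w, Gate.sink i w ∈ gates
  exists_bump : ∀ a, ∃ w w', Gate.bump a w w' ∈ gates

namespace Circuit

variable {n₁ n₂ m : ℕ} {I : Finset (Fin (n₁ + n₂))} (C : Circuit n₁ n₂ m I)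

/-- The gate with a given number. -/
def gate (t : Fin C.gates.length) : Gate (n₁ + n₂) m := C.gates.get t

theorem gate_mem (t : Fin C.gates.length) : C.gate t ∈ C.gates := List.get_mem _ _

theorem gate_valid (t : Fin C.gates.length) : (C.gate t).Valid := C.valid _ (C.gate_mem t)

theorem labelBelow_of_lt {t t' : Fin C.gates.length} (h : t < t') {i j : Fin (n₁ + n₂)}
    (hi : (C.gate t).label = some i) (hj : (C.gate t').label = some j) : LabelBelow n₁ i j :=
  List.pairwise_iff_get.1 C.order t t' h i hi j hj

/-- `LabelBelow` is irreflexive, so the ordering of the gates also excludes repeated labels. -/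
theorem eq_of_label {t t' : Fin C.gates.length} {i : Fin (n₁ + n₂)}
    (h : (C.gate t).label = some i) (h' : (C.gate t').label = some i) : t = t' := by
  rcases lt_trichotomy t t' with hlt | heq | hlt
  · exact absurd rfl (C.labelBelow_of_lt hlt h h').1
  · exact heq
  · exact absurd rfl (C.labelBelow_of_lt hlt h' h).1

theorem exists_gate (i : Fin (n₁ + n₂)) : ∃ t, (C.gate t).label = some i ∧
    ((C.gate t).isSink = false ↔ i ∈ I) := by
  by_cases hi : i ∈ I
  · obtain ⟨t, ht⟩ := List.mem_iff_get.1 (C.exists_source i hi)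
    exact ⟨t, by rw [gate, ht]; simp [Gate.label, Gate.isSink, hi]⟩
  · obtain ⟨w, hw⟩ := C.exists_sink i hi
    obtain ⟨t, ht⟩ := List.mem_iff_get.1 hw
    exact ⟨t, by rw [gate, ht]; simp [Gate.label, Gate.isSink, hi]⟩

/-- The number of the gate of a boundary vertex. -/
def labelGate (i : Fin (n₁ + n₂)) : Fin C.gates.length := (C.exists_gate i).choose

theorem label_labelGate (i : Fin (n₁ + n₂)) : (C.gate (C.labelGate i)).label = some i :=
  (C.exists_gate i).choose_spec.1

theorem isSink_labelGate (i : Fin (n₁ + n₂)) :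
    (C.gate (C.labelGate i)).isSink = false ↔ i ∈ I :=
  (C.exists_gate i).choose_spec.2

theorem eq_labelGate {t : Fin C.gates.length} {i : Fin (n₁ + n₂)}
    (h : (C.gate t).label = some i) : t = C.labelGate i :=
  C.eq_of_label h (C.label_labelGate i)

/-- The column of the end of a gate. -/
def col (p : Fin C.gates.length × Bool) : ℕ :=
  if p.2 then (C.gate p.1).endCol n₁ else (C.gate p.1).startCol n₁

/-- The orientation of a column, numbered from `1`. -/
def colSgn (c : ℕ) : ℤ := if h : 0 < c ∧ c < m + 2 then C.orient ⟨c - 1, by omega⟩ else 1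

theorem colSgn_succ (a : Fin (m + 1)) : C.colSgn (a + 1) = C.orient a := by
  rw [colSgn, dif_pos (by omega)]
  rfl

/-- The ladder of a circuit. -/
@[reducible] def ladder : Ladder n₁ n₂ where
  M := m + 1
  T := C.gates.length
  sgn := C.colSgn
  col := C.col
  boundaryEnd i := (C.labelGate i, (C.gate (C.labelGate i)).isSink)
  sgn_eq c := by
    rw [colSgn]; split_ifs
    · exact C.orient_eq _
    · exact Or.inl rfl
  sgn_zero := by rw [colSgn, dif_neg (by omega)]
  sgn_last := by rw [colSgn, dif_neg (by omega)]
  col_le p := by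
    have h := Gate.col_bounds n₁ (C.gate_valid p.1)
    rw [col]; split_ifs <;> omega
  col_adj t := by
    have h := Gate.col_bounds n₁ (C.gate_valid t)
    simp only [col, Bool.false_eq_true, if_false, if_true]; omega
  internal_or t := by
    have h := Gate.col_bounds n₁ (C.gate_valid t)
    simp only [col, Bool.false_eq_true, if_false, if_true]; omega
  col_boundaryEnd i := by
    have h := C.label_labelGate i
    rw [col]
    generalize C.gate (C.labelGate i) = g at h
    cases g <;> simp_all [Gate.label, Gate.isSink, Gate.startCol, Gate.endCol]
  boundaryEnd_injective i j h := by
    have h1 := C.label_labelGate i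
    have h2 := C.label_labelGate j
    rw [(Prod.mk.inj h).1, h2] at h1
    exact (Option.some.inj h1).symm
  exists_boundaryEnd := by
    rintro ⟨t, b⟩ h
    have key : ∃ i, (C.gate t).label = some i ∧ (C.gate t).isSink = b := by
      rw [col] at h
      simp only at h
      generalize C.gate t = g at h
      cases g <;> cases b <;>
        simp_all [Gate.label, Gate.isSink, Gate.startCol, Gate.endCol, Gate.boundaryCol_val] <;>
        first | omega | (split_ifs at h; all_goals omega)
    obtain ⟨i, h1, h2⟩ := key
    exact ⟨i, by rw [← C.eq_labelGate h1, h2]⟩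
  outer_lt i j hij hj := by
    have hij' : i.val < j.val := hij
    rcases lt_trichotomy (C.labelGate i) (C.labelGate j) with h | h | h
    · exact h
    · have h1 := C.label_labelGate i
      rw [h, C.label_labelGate j] at h1
      exact absurd (Option.some.inj h1) hij.ne'
    · have := (C.labelBelow_of_lt h (C.label_labelGate j) (C.label_labelGate i)).2.1 hj (by omega)
      exact absurd this hij.not_gt
  inner_lt i j hij hi := by
    have hij' : i.val < j.val := hij
    rcases lt_trichotomy (C.labelGate j) (C.labelGate i) with h | h | h
    · exact h
    · have h1 := C.label_labelGate j
      rw [h, C.label_labelGate i] at h1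
      exact absurd (Option.some.inj h1) hij.ne
    · have := (C.labelBelow_of_lt h (C.label_labelGate i) (C.label_labelGate j)).2.2 hi (by omega)
      exact absurd this hij.not_gt
  -- Both ends of a bump lie on the same column, and each column has a bump.
  exists_ne p h0 h1 := by
    obtain ⟨w, w', hw⟩ := C.exists_bump ⟨C.col p - 1, by omega⟩
    obtain ⟨t, ht⟩ := List.mem_iff_get.1 hw
    have h2 : ∀ b, C.col (t, b) = C.col p := by
      intro b
      have : C.gate t = _ := ht
      rw [col, this]
      simp only [Gate.endCol, Gate.startCol, ite_self]
      omega
    by_cases hp : p = (t, false)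
    · exact ⟨(t, true), by rw [hp]; simp, h2 _⟩
    · exact ⟨(t, false), fun h => hp h.symm, h2 _⟩

theorem mem_iff (i : Fin (n₁ + n₂)) : i ∈ I ↔ (C.ladder.boundaryEnd i).2 = false :=
  (C.isSink_labelGate i).symm

/-- The edge weights of a circuit. -/
def edgeWeight : Fin C.gates.length ⊕ C.ladder.V → ℝ :=
  Sum.elim (fun t => (C.gate t).weight)
    fun v => if v.1.2 = false then (C.gate v.1.1).sideWeight else 1

theorem edgeWeight_ne (e : Fin C.gates.length ⊕ C.ladder.V) : C.edgeWeight e ≠ 0 := by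
  rcases e with t | v
  · exact (C.gate_valid t).weight_ne
  · simp only [edgeWeight, Sum.elim_inr]
    split_ifs
    · exact (C.gate_valid _).sideWeight_ne
    · exact one_ne_zero

end Circuit

end AnnularNetwork

namespace AnnularNetwork

namespace Ladder

variable {n₁ n₂ : ℕ} (L : Ladder n₁ n₂)

/-! ### Potentials -/

/-- The modified weight of the edge of a column with weight `1`. -/
def windingWeight (v : L.V) : RatFunc ℝ :=
  if L.key v < L.key (L.next v) then 1 else RatFunc.X ^ (-L.sgn (L.col v.1))

/-- The first vertex of a column at or behind a given time. -/
def IsFirst (c : ℕ) (k : ℤ) (v : L.V) : Prop :=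
  L.col v.1 = c ∧ k ≤ L.key v ∧ ∀ w : L.V, L.col w.1 = c → k ≤ L.key w → L.key v ≤ L.key w

/-- The first vertex of a column. -/
def IsLowest (c : ℕ) (v : L.V) : Prop :=
  L.col v.1 = c ∧ ∀ w : L.V, L.col w.1 = c → L.key v ≤ L.key w

variable (φ : Fin (n₁ + n₂) ⊕ L.V → RatFunc ℝ)

/-- The value of `φ` at an element with the property `p`, or else `x` times the value at an
element with the property `q`. -/
def firstValue (p q : L.V → Prop) (x : RatFunc ℝ) : RatFunc ℝ :=
  if h : ∃ v, p v then φ (Sum.inr h.choose) else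
    if h : ∃ v, q v then x * φ (Sum.inr h.choose) else 0

/-- The potential of the point of a column at a given time. -/
def colState (c : ℕ) (k : ℤ) : RatFunc ℝ :=
  L.firstValue φ (L.IsFirst c k) (L.IsLowest c) (RatFunc.X ^ (-L.sgn c))

variable {φ}

theorem IsFirst.colState_eq {c : ℕ} {k : ℤ} {v : L.V} (h : L.IsFirst c k v) :
    L.colState φ c k = φ (Sum.inr v) := by
  have h' : ∃ v, L.IsFirst c k v := ⟨v, h⟩
  rw [colState, firstValue, dif_pos h']
  have h1 := h'.choose_spec
  congr 2
  exact L.eq_of_key_eq (h1.1.trans h.1.symm)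
    (le_antisymm (h1.2.2 _ h.1 h.2.1) (h.2.2 _ h1.1 h1.2.1))

theorem IsLowest.colState_eq {c : ℕ} {k : ℤ} {v : L.V} (h : L.IsLowest c v)
    (hk : ∀ w : L.V, L.col w.1 = c → L.key w < k) :
    L.colState φ c k = RatFunc.X ^ (-L.sgn c) * φ (Sum.inr v) := by
  have h0 : ¬ ∃ v, L.IsFirst c k v := fun ⟨w, hw⟩ => (hk w hw.1).not_ge hw.2.1
  have h' : ∃ v, L.IsLowest c v := ⟨v, h⟩
  rw [colState, firstValue, dif_neg h0, dif_pos h']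
  have h1 := h'.choose_spec
  congr 3
  exact L.eq_of_key_eq (h1.1.trans h.1.symm) (le_antisymm (h1.2 _ h.1) (h.2 _ h1.1))

/-- The hypotheses say that no later vertex of the column comes before the time `k`. A path from
there goes to the next vertex, across the cut if `v` is the last one. -/
theorem colState_behind {v : L.V} {c : ℕ} {k : ℤ} (hc : L.col v.1 = c) (hk : L.key v < k)
    (h : ∀ w : L.V, L.col w.1 = c → L.key v < L.key w → k ≤ L.key w) :
    L.colState φ c k = L.windingWeight v * φ (Sum.inr (L.next v)) := by
  subst hc
  by_cases hv : L.key v < L.key (L.next v)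
  · have h1 : L.IsFirst (L.col v.1) k (L.next v) := by
      refine ⟨L.col_next v, h _ (L.col_next v) hv, fun w hw hkw => ?_⟩
      exact (L.next_of_lt hv w hw).resolve_left (not_le.2 (hk.trans_le hkw))
    rw [h1.colState_eq, windingWeight, if_pos hv, one_mul]
  · have h1 : L.IsLowest (L.col v.1) (L.next v) :=
      ⟨L.col_next v, fun w hw => (L.next_of_not_lt hv w hw).2⟩
    rw [h1.colState_eq, windingWeight, if_neg hv]
    exact fun w hw => ((L.next_of_not_lt hv w hw).1).trans_lt hk

theorem colState_congr {c : ℕ} {k k' : ℤ}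
    (h : ∀ w : L.V, L.col w.1 = c → (k ≤ L.key w ↔ k' ≤ L.key w)) :
    L.colState φ c k = L.colState φ c k' := by
  have : L.IsFirst c k = L.IsFirst c k' := by
    funext v
    rw [IsFirst, IsFirst, eq_iff_iff]
    constructor
    · rintro ⟨h1, h2, h3⟩
      exact ⟨h1, (h v h1).1 h2, fun w hw hkw => h3 w hw ((h w hw).2 hkw)⟩
    · rintro ⟨h1, h2, h3⟩
      exact ⟨h1, (h v h1).2 h2, fun w hw hkw => h3 w hw ((h w hw).1 hkw)⟩
  rw [colState, this, colState]

theorem exists_isLowest {c : ℕ} (h : ∃ v : L.V, L.col v.1 = c) : ∃ v, L.IsLowest c v := by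
  obtain ⟨v, hv, h1⟩ := Set.exists_min_image {v : L.V | L.col v.1 = c} L.key (Set.toFinite _) h
  exact ⟨v, hv, h1⟩

variable (φ)

/-- The potential of the point of the column `c` below the rung `t`. -/
def state (t c : ℕ) : RatFunc ℝ := L.colState φ c (L.sgn c * (8 * t + 4))

/-- The potential of the point of the column `c` ahead of the rung `t`. -/
def entryState (t c : ℕ) : RatFunc ℝ := L.colState φ c (L.sgn c * (8 * t + 8) - 4)

/-- The potential of the point of the column `c` behind the rung `t`. -/
def exitState (t c : ℕ) : RatFunc ℝ := L.colState φ c (L.sgn c * (8 * t + 8) + 4)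

/-- The heights `8 t + 4` lie halfway between the rungs `t - 1` and `t`. On an upward column one
enters the rung `t` from below, on a downward column from above. -/
theorem entryState_eq (t c : ℕ) :
    L.entryState φ t c = if L.sgn c = 1 then L.state φ t c else L.state φ (t + 1) c := by
  rw [entryState, state, state]
  rcases L.sgn_eq c with h | h
  · rw [if_pos h, h]; ring_nf
  · rw [h, if_neg (by norm_num)]; congr 1

theorem exitState_eq (t c : ℕ) :
    L.exitState φ t c = if L.sgn c = 1 then L.state φ (t + 1) c else L.state φ t c := by
  rw [exitState, state, state]
  rcases L.sgn_eq c with h | h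
  · rw [if_pos h, h]; congr 1
  · rw [h, if_neg (by norm_num)]; congr 1

variable {φ}

theorem key_near (w : L.V) :
    |L.key w - L.sgn (L.col w.1) * (8 * w.1.1.val + 8)| ≤ 2 := by
  have h := L.abs_time_sub w.1
  rw [key, ← mul_sub, abs_mul]
  rcases L.sgn_eq (L.col w.1) with h1 | h1 <;> rw [h1] <;> simpa using h

theorem key_cases {t : ℕ} {w : L.V} {c : ℕ} (hc : L.col w.1 = c) (h : w.1.1.val ≠ t) :
    L.key w < L.sgn c * (8 * t + 8) - 4 ∨ L.sgn c * (8 * t + 8) + 4 < L.key w := by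
  have h1 := abs_le.1 (L.key_near w)
  rw [hc] at h1
  rcases L.sgn_eq c with h2 | h2 <;> rw [h2] at h1 ⊢ <;> omega

/-- At one of the two extreme heights the whole right side is still ahead; at the other one it is
behind and the cut must be crossed. That crossing costs `λ⁻¹` from the top of an upward column and
`λ` from the bottom of a downward one, which is the same relation in both cases. -/
theorem state_wrap {c : ℕ} (hc : ∃ v : L.V, L.col v.1 = c) :
    L.state φ 0 c = RatFunc.X * L.state φ L.T c := by
  obtain ⟨v, hv⟩ := L.exists_isLowest hc
  have key : ∀ w : L.V, L.col w.1 = c → (4 < L.sgn c * L.key w ∧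
      L.sgn c * L.key w < 8 * L.T + 4) := by
    intro w hw
    have h1 := abs_le.1 (L.key_near w)
    have h2 := w.1.1.2
    rw [hw] at h1
    rcases L.sgn_eq c with h | h <;> rw [h] at h1 ⊢ <;> omega
  rw [state, state]
  rcases L.sgn_eq c with h | h <;> rw [h] at key ⊢
  · have h1 : L.IsFirst c (1 * (8 * (0 : ℕ) + 4)) v :=
      ⟨hv.1, by have := key v hv.1; push_cast; linarith, fun w hw _ => hv.2 w hw⟩
    rw [h1.colState_eq, hv.colState_eq, h]
    · rw [zpow_neg, zpow_one, ← mul_assoc, mul_inv_cancel₀ RatFunc.X_ne_zero, one_mul]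
    · intro w hw
      have := key w hw; linarith
  · have h1 : L.IsFirst c (-1 * (8 * (L.T : ℤ) + 4)) v :=
      ⟨hv.1, by have := key v hv.1; linarith, fun w hw _ => hv.2 w hw⟩
    rw [h1.colState_eq, hv.colState_eq, h]
    · rw [neg_neg, zpow_one]
    · intro w hw
      have := key w hw; push_cast; linarith

theorem entryState_eq_exitState {t c : ℕ} (h : ∀ w : L.V, L.col w.1 = c → w.1.1.val ≠ t) :
    L.entryState φ t c = L.exitState φ t c := by
  refine L.colState_congr fun w hw => ?_
  have := L.key_cases hw (h w hw)
  omega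

theorem entryState_of_isFirst {t c : ℕ} {v : L.V} (hc : L.col v.1 = c) (ht : v.1.1.val = t)
    (h : ∀ w : L.V, L.col w.1 = c → w.1.1.val = t → L.key v ≤ L.key w) :
    L.entryState φ t c = φ (Sum.inr v) := by
  refine IsFirst.colState_eq L ⟨hc, ?_, fun w hw hk => ?_⟩
  · have := abs_le.1 (L.key_near v)
    rw [hc, ht] at this
    linarith
  · by_cases hwt : w.1.1.val = t
    · exact h w hw hwt
    · have h1 := L.key_cases hw hwt
      have h2 := abs_le.1 (L.key_near v)
      rw [hc, ht] at h2
      omega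

theorem exitState_of_isLast {t c : ℕ} {v : L.V} (hc : L.col v.1 = c) (ht : v.1.1.val = t)
    (h : ∀ w : L.V, L.col w.1 = c → w.1.1.val = t → L.key w ≤ L.key v) :
    L.exitState φ t c = L.windingWeight v * φ (Sum.inr (L.next v)) := by
  refine L.colState_behind hc ?_ fun w hw hk => ?_
  · have := abs_le.1 (L.key_near v)
    rw [hc, ht] at this
    linarith
  · by_cases hwt : w.1.1.val = t
    · exact absurd hk (not_lt.2 (h w hw hwt))
    · have h1 := L.key_cases hw hwt
      have h2 := abs_le.1 (L.key_near v)
      rw [hc, ht] at h2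
      omega

/-- The system of equations for the potentials of a ladder with modified weights `x` and source
terms `g`. -/
def IsPotential (x : Fin L.T ⊕ L.V → RatFunc ℝ) (g : Fin (n₁ + n₂) ⊕ L.V → RatFunc ℝ)
    (φ : Fin (n₁ + n₂) ⊕ L.V → RatFunc ℝ) : Prop :=
  ∀ u, φ u = g u + ∑ e, if L.src e = u then x e * φ (L.tgt e) else 0

variable {x : Fin L.T ⊕ L.V → RatFunc ℝ} {g : Fin (n₁ + n₂) ⊕ L.V → RatFunc ℝ} {L}

theorem sum_src (u : Fin (n₁ + n₂) ⊕ L.V) :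
    (∑ e, if L.src e = u then x e * φ (L.tgt e) else 0) =
      (∑ t, if (t, false) = L.endEquiv u then x (Sum.inl t) * φ (L.vtx (t, true)) else 0) +
      ∑ v, if Sum.inr v = u then x (Sum.inr v) * φ (Sum.inr (L.next v)) else 0 := by
  rw [Fintype.sum_sum_type]
  congr 1
  refine Finset.sum_congr rfl fun t _ => ?_
  have : L.src (Sum.inl t) = u ↔ (t, false) = L.endEquiv u := L.endEquiv.symm_apply_eq
  simp only [this]
  rfl

theorem IsPotential.start (h : L.IsPotential x g φ) {v : L.V} {t : Fin L.T}
    (hv : v.1 = (t, false)) :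
    φ (Sum.inr v) = g (Sum.inr v) + (x (Sum.inl t) * φ (L.vtx (t, true)) +
      x (Sum.inr v) * φ (Sum.inr (L.next v))) := by
  rw [h, sum_src, endEquiv_inr, hv]
  simp

theorem IsPotential.terminus (h : L.IsPotential x g φ) {v : L.V} {t : Fin L.T}
    (hv : v.1 = (t, true)) :
    φ (Sum.inr v) = g (Sum.inr v) + x (Sum.inr v) * φ (Sum.inr (L.next v)) := by
  rw [h, sum_src, endEquiv_inr, hv]
  simp

theorem IsPotential.source (h : L.IsPotential x g φ) {i : Fin (n₁ + n₂)} {t : Fin L.T}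
    (hi : L.boundaryEnd i = (t, false)) :
    φ (Sum.inl i) = g (Sum.inl i) + x (Sum.inl t) * φ (L.vtx (t, true)) := by
  rw [h, sum_src, endEquiv_inl, hi]
  simp

theorem IsPotential.sink (h : L.IsPotential x g φ) {i : Fin (n₁ + n₂)} {t : Fin L.T}
    (hi : L.boundaryEnd i = (t, true)) : φ (Sum.inl i) = g (Sum.inl i) := by
  rw [h, sum_src, endEquiv_inl, hi]
  simp

end Ladder

/-! ### Runs of a circuit -/

/-- The potential ahead of a gate, in the direction of the column, when `s` and `s'` are the
potentials below and above the gate. -/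
def entry {m : ℕ} (σ : Fin (m + 1) → ℤ) (s s' : Fin (m + 1) → RatFunc ℝ) (c : Fin (m + 1)) :
    RatFunc ℝ := if σ c = 1 then s c else s' c

/-- The relation between the potentials `s` below and `s'` above a gate, for the potentials `δ`
of the boundary vertices. -/
def Gate.Step {n m : ℕ} (n₁ : ℕ) (σ : Fin (m + 1) → ℤ) (δ : Fin n → RatFunc ℝ) :
    Gate n m → (Fin (m + 1) → RatFunc ℝ) → (Fin (m + 1) → RatFunc ℝ) → Prop
  | rung a b w, s, s' => entry σ s s' a = entry σ s' s a + RatFunc.C w * s b ∧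
      ∀ c, c ≠ a → s' c = s c
  | bump a w w', s, s' => entry σ s s' a = RatFunc.C (w + w') * entry σ s' s a ∧
      ∀ c, c ≠ a → s' c = s c
  | source i, s, s' => δ i = s (boundaryCol n₁ m i) ∧ s' = s
  | sink i w, s, s' => entry σ s s' (boundaryCol n₁ m i) =
      entry σ s' s (boundaryCol n₁ m i) + RatFunc.C w * δ i ∧
      ∀ c, c ≠ boundaryCol n₁ m i → s' c = s c

/-- Exchanging the two states turns the potential ahead of a gate into the potential behind it; if
these agree, so do the states, for either orientation. -/
theorem entry_eq_iff {m : ℕ} {σ : Fin (m + 1) → ℤ} {s s' : Fin (m + 1) → RatFunc ℝ}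
    {c : Fin (m + 1)} : entry σ s s' c = entry σ s' s c ↔ s' c = s c := by
  rw [entry, entry]
  split_ifs
  · exact eq_comm
  · exact Iff.rfl

theorem entry_swap_of_eq {m : ℕ} {σ : Fin (m + 1) → ℤ} {s s' : Fin (m + 1) → RatFunc ℝ}
    {c : Fin (m + 1)} (h : s' c = s c) : entry σ s' s c = s c := by
  rw [entry]
  split_ifs
  · exact h
  · rfl

namespace Circuit

variable {n₁ n₂ m : ℕ} {I : Finset (Fin (n₁ + n₂))} (C : Circuit n₁ n₂ m I)
  (φ : Fin (n₁ + n₂) ⊕ C.ladder.V → RatFunc ℝ)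

/-- The potentials of the columns below a gate. -/
def state (t : ℕ) (c : Fin (m + 1)) : RatFunc ℝ := C.ladder.state φ t (c + 1)

variable {φ}

theorem sgn_succ (c : Fin (m + 1)) : C.ladder.sgn (c + 1) = C.orient c := C.colSgn_succ c

theorem entry_state (t : ℕ) (c : Fin (m + 1)) :
    entry C.orient (C.state φ t) (C.state φ (t + 1)) c = C.ladder.entryState φ t (c + 1) := by
  rw [C.ladder.entryState_eq, sgn_succ]; rfl

theorem entry_state' (t : ℕ) (c : Fin (m + 1)) :
    entry C.orient (C.state φ (t + 1)) (C.state φ t) c = C.ladder.exitState φ t (c + 1) := by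
  rw [C.ladder.exitState_eq, sgn_succ]; rfl

/-- The modified edge weights of a circuit. -/
def modWeight : Fin C.gates.length ⊕ C.ladder.V → RatFunc ℝ :=
  Sum.elim (fun t => RatFunc.C (C.gate t).weight)
    fun v => RatFunc.C (if v.1.2 = false then (C.gate v.1.1).sideWeight else 1) *
      C.ladder.windingWeight v

theorem modifiedWeight_eq : C.ladder.diagram.modifiedWeight C.edgeWeight = C.modWeight := by
  funext e
  rcases e with t | v
  · change RatFunc.C (C.gate t).weight * RatFunc.X ^ C.ladder.diagram.ind (Sum.inl t) =
      RatFunc.C (C.gate t).weight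
    rw [C.ladder.ind_rung, zpow_zero, mul_one]
  · change RatFunc.C (if v.1.2 = false then (C.gate v.1.1).sideWeight else 1) *
      RatFunc.X ^ C.ladder.diagram.ind (Sum.inr v) = _ * C.ladder.windingWeight v
    by_cases hv : C.ladder.key v < C.ladder.key (C.ladder.next v)
    · rw [C.ladder.ind_strand hv, Ladder.windingWeight, if_pos hv, zpow_zero]
    · rw [C.ladder.ind_wrap hv, Ladder.windingWeight, if_neg hv]

theorem col_start (t : Fin C.gates.length) :
    C.ladder.col (t, false) = (C.gate t).startCol n₁ := rfl

theorem col_end (t : Fin C.gates.length) :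
    C.ladder.col (t, true) = (C.gate t).endCol n₁ := rfl

theorem end_cases (t : Fin C.gates.length) (v : C.ladder.V) (h : v.1.1.val = t) :
    v.1 = (t, false) ∨ v.1 = (t, true) := by
  obtain ⟨⟨t', b⟩, _⟩ := v
  obtain rfl : t' = t := Fin.ext h
  cases b <;> simp

variable {C} {g : Fin (n₁ + n₂) ⊕ C.ladder.V → RatFunc ℝ}

/-- A column without an end of the rung has no vertex between the two heights. -/
theorem untouched {t : Fin C.gates.length} {c : Fin (m + 1)}
    (h1 : (C.gate t).startCol n₁ ≠ c + 1) (h2 : (C.gate t).endCol n₁ ≠ c + 1) :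
    C.state φ (t + 1) c = C.state φ t c := by
  rw [← entry_eq_iff (σ := C.orient), entry_state, entry_state']
  refine C.ladder.entryState_eq_exitState fun w hw ht => ?_
  rcases C.end_cases t w ht with h | h <;> rw [h] at hw
  · exact h1 hw
  · exact h2 hw

/-- Every gate acts by its defining relation, and the potentials of the internal vertices are
potentials of columns. -/
theorem step (hφ : C.ladder.IsPotential C.modWeight g φ) (hg : ∀ v, g (Sum.inr v) = 0)
    (hgI : ∀ i ∈ I, g (Sum.inl i) = 0) (t : Fin C.gates.length) :
    (C.gate t).Step n₁ C.orient (fun i => φ (Sum.inl i)) (C.state φ t) (C.state φ (t + 1)) ∧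
    ∀ v : C.ladder.V, v.1.1 = t → ∃ c, φ (Sum.inr v) = C.state φ t c ∨
      φ (Sum.inr v) = C.state φ (t + 1) c := by
  have hentry : ∀ {v : C.ladder.V} {c}, φ (Sum.inr v) = C.ladder.entryState φ t (c + 1) →
      c < m + 1 → ∃ c, φ (Sum.inr v) = C.state φ t c ∨ φ (Sum.inr v) = C.state φ (t + 1) c := by
    intro v c h hc
    refine ⟨⟨c, hc⟩, ?_⟩
    rw [h, C.ladder.entryState_eq]
    split_ifs
    · exact Or.inl rfl
    · exact Or.inr rfl
  have hmod : ∀ {v : C.ladder.V}, (v.1.2 = true ∨ (C.gate v.1.1).sideWeight = 1) →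
      C.modWeight (Sum.inr v) = C.ladder.windingWeight v := by
    intro v h
    simp only [modWeight, Sum.elim_inr]
    rcases h with h | h <;> simp [h]
  have hcs := C.col_start t
  have hce := C.col_end t
  have hval := C.gate_valid t
  have hun : ∀ c : Fin (m + 1), (C.gate t).startCol n₁ ≠ c + 1 →
    (C.gate t).endCol n₁ ≠ c + 1 → C.state φ (t + 1) c = C.state φ t c :=
      fun c h1 h2 => untouched h1 h2
  have hrung : C.modWeight (Sum.inl t) = RatFunc.C (C.gate t).weight := rfl
  have hlab : ∀ i, (C.gate t).label = some i → C.ladder.boundaryEnd i = (t, (C.gate t).isSink) := by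
    intro i hi
    rw [C.eq_labelGate hi]
  have hlabI : ∀ i, (C.gate t).label = some i → ((C.gate t).isSink = false ↔ i ∈ I) := by
    intro i hi
    rw [C.eq_labelGate hi]
    exact C.isSink_labelGate i
  have hside : ∀ {v : C.ladder.V}, v.1.1 = t → (C.gate t).sideWeight = 1 →
      C.modWeight (Sum.inr v) = C.ladder.windingWeight v :=
    fun h1 h2 => hmod (Or.inr (by rw [h1]; exact h2))
  have hsideW : ∀ {v : C.ladder.V}, v.1 = (t, false) →
      C.modWeight (Sum.inr v) = RatFunc.C (C.gate t).sideWeight * C.ladder.windingWeight v := by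
    intro v h
    simp only [modWeight, Sum.elim_inr, h, if_true]
  generalize hG : C.gate t = G at hcs hce hval hun hrung hlab hlabI hside hsideW ⊢
  cases G with
  | rung a b w =>
    have hab : a ≠ b := by
      rintro rfl
      have := hval.1
      omega
    set v₀ : C.ladder.V := ⟨(t, false), by
      rw [hcs]; change _ ∧ _ < m + 1 + 1; simp only [Gate.startCol]; omega⟩
    set v₁ : C.ladder.V := ⟨(t, true), by
      rw [hce]; change _ ∧ _ < m + 1 + 1; simp only [Gate.endCol]; omega⟩
    have hab' : (a : ℕ) ≠ b := fun h => hab (Fin.ext h)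
    have u0 : ∀ w : C.ladder.V, C.ladder.col w.1 = a + 1 → w.1.1.val = t → w = v₀ := by
      intro w hw ht
      rcases C.end_cases t w ht with h | h
      · exact Subtype.ext h
      · rw [h, hce] at hw; simp only [Gate.endCol] at hw; omega
    have u1 : ∀ w : C.ladder.V, C.ladder.col w.1 = b + 1 → w.1.1.val = t → w = v₁ := by
      intro w hw ht
      rcases C.end_cases t w ht with h | h
      · rw [h, hcs] at hw; simp only [Gate.startCol] at hw; omega
      · exact Subtype.ext h
    have en0 : C.ladder.entryState φ t (a + 1) = φ (Sum.inr v₀) :=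
      C.ladder.entryState_of_isFirst hcs rfl fun w hw ht => by rw [u0 w hw ht]
    have ex0 : C.ladder.exitState φ t (a + 1) = _ :=
      C.ladder.exitState_of_isLast (v := v₀) hcs rfl fun w hw ht => by rw [u0 w hw ht]
    have en1 : C.ladder.entryState φ t (b + 1) = φ (Sum.inr v₁) :=
      C.ladder.entryState_of_isFirst hce rfl fun w hw ht => by rw [u1 w hw ht]
    have ex1 : C.ladder.exitState φ t (b + 1) = _ :=
      C.ladder.exitState_of_isLast (v := v₁) hce rfl fun w hw ht => by rw [u1 w hw ht]
    have e0 := hφ.start (v := v₀) (t := t) rfl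
    have e1 := hφ.terminus (v := v₁) (t := t) rfl
    rw [hg, zero_add, hside rfl rfl, ← ex1] at e1
    rw [hg, zero_add, hside rfl rfl, ← ex0, hrung, show C.ladder.vtx (t, true) = Sum.inr v₁ from
      C.ladder.vtx_eq_inr.2 rfl] at e0
    -- The terminus has a single outgoing edge, of weight `1` up to the winding, so the potential of
    -- column `b` is not changed by the arrival of the rung.
    have hb : C.state φ (t + 1) b = C.state φ t b := by
      rw [← entry_eq_iff (σ := C.orient), entry_state, entry_state', en1, e1]
    have hb' : φ (Sum.inr v₁) = C.state φ t b := by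
      rw [e1, ← entry_state', entry_swap_of_eq hb]
    refine ⟨⟨?_, fun c hc => ?_⟩, fun v hv => ?_⟩
    · rw [entry_state, entry_state', en0, e0, hb', add_comm]
      rfl
    · by_cases hcb : c = b
      · rw [hcb, hb]
      · refine hun c ?_ ?_ <;> simp only [Gate.startCol, Gate.endCol] <;> omega
    · rcases C.end_cases t v (congrArg Fin.val hv) with h | h
      · obtain rfl : v = v₀ := Subtype.ext h
        exact hentry en0.symm a.2
      · obtain rfl : v = v₁ := Subtype.ext h
        exact hentry en1.symm b.2
  | bump a w w' =>
    set v₀ : C.ladder.V := ⟨(t, false), by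
      rw [hcs]; change _ ∧ _ < m + 1 + 1; simp only [Gate.startCol]; omega⟩ with hv0
    set v₁ : C.ladder.V := ⟨(t, true), by
      rw [hce]; change _ ∧ _ < m + 1 + 1; simp only [Gate.endCol]; omega⟩ with hv1
    have hcs' : C.ladder.col v₀.1 = a + 1 := hcs
    have hce' : C.ladder.col v₁.1 = a + 1 := hce
    have hk0 : C.ladder.key v₀ = C.ladder.sgn (a + 1) * (8 * t.val + 8) := by
      rw [Ladder.key, hcs']
      exact congrArg _ (C.ladder.time_start t)
    -- Two units in the direction of the column, for either orientation.
    have hk1 : C.ladder.key v₁ = C.ladder.key v₀ + 2 := by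
      rw [hk0, Ladder.key, hce']
      have h1 : C.ladder.time v₁.1 = 8 * t.val + 8 + C.ladder.sgn (C.ladder.col (t, false)) +
        C.ladder.sgn (C.ladder.col (t, true)) := C.ladder.time_end t
      have h2 : C.ladder.sgn (C.ladder.col (t, false)) = C.ladder.sgn (a + 1) := by rw [hcs]; rfl
      have h3 : C.ladder.sgn (C.ladder.col (t, true)) = C.ladder.sgn (a + 1) := by rw [hce]; rfl
      rw [h1, h2, h3]
      rcases C.ladder.sgn_eq (a + 1) with h | h <;> rw [h] <;> ring
    have hcases : ∀ w : C.ladder.V, w.1.1.val = t → w = v₀ ∨ w = v₁ := fun w ht =>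
      (C.end_cases t w ht).imp (fun h => Subtype.ext h) (fun h => Subtype.ext h)
    have hlt : C.ladder.key v₀ < C.ladder.key (C.ladder.next v₀) := by
      by_contra h
      have := (C.ladder.next_of_not_lt h v₁ (hce'.trans hcs'.symm)).1
      omega
    have hnext : C.ladder.next v₀ = v₁ := by
      have h1 := (C.ladder.next_of_lt hlt v₁ (hce'.trans hcs'.symm)).resolve_left (by omega)
      have h2 : (C.ladder.next v₀).1.1.val = t := by
        by_contra h
        have := C.ladder.key_cases ((C.ladder.col_next v₀).trans hcs') h
        omega
      rcases hcases _ h2 with h | h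
      · exact absurd h (C.ladder.next_ne v₀)
      · exact h
    have en0 : C.ladder.entryState φ t (a + 1) = φ (Sum.inr v₀) :=
      C.ladder.entryState_of_isFirst hcs rfl fun w _ ht => by
        rcases hcases w ht with h | h <;> rw [h]
        omega
    have ex1 : C.ladder.exitState φ t (a + 1) = _ :=
      C.ladder.exitState_of_isLast (v := v₁) hce rfl fun w _ ht => by
        rcases hcases w ht with h | h <;> rw [h]
        omega
    have e0 := hφ.start (v := v₀) (t := t) rfl
    have e1 := hφ.terminus (v := v₁) (t := t) rfl
    rw [hg, zero_add, hmod (Or.inl rfl), ← ex1] at e1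
    -- Both edges out of `v₀`, the rung and the edge of the column, lead to `v₁`. Hence their
    -- weights add up.
    rw [hg, zero_add, hsideW rfl, hrung, show C.ladder.vtx (t, true) = Sum.inr v₁ from
      C.ladder.vtx_eq_inr.2 rfl, hnext, Ladder.windingWeight, if_pos hlt, mul_one, e1] at e0
    refine ⟨⟨?_, fun c hc => ?_⟩, fun v hv => ?_⟩
    · rw [entry_state, entry_state', en0, e0, map_add]
      simp only [Gate.weight, Gate.sideWeight]
      ring
    · refine hun c ?_ ?_ <;> simp only [Gate.startCol, Gate.endCol] <;> omega
    · rcases hcases v (congrArg Fin.val hv) with rfl | rfl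
      · exact hentry en0.symm a.2
      · refine ⟨a, ?_⟩
        rw [e1, C.ladder.exitState_eq]
        split_ifs
        · exact Or.inr rfl
        · exact Or.inl rfl
  | source i =>
    set b := Gate.boundaryCol n₁ m i with hb
    have hs : C.ladder.boundaryEnd i = (t, false) := hlab i rfl
    have hcs' : C.ladder.col (t, false) ≠ b + 1 := by
      rw [hcs]; simp only [Gate.startCol]; split_ifs <;> omega
    set v₁ : C.ladder.V := ⟨(t, true), by
      rw [hce]; change _ ∧ _ < m + 1 + 1; simp only [Gate.endCol]; omega⟩
    have u1 : ∀ w : C.ladder.V, w.1.1.val = t → w = v₁ := by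
      intro w ht
      rcases C.end_cases t w ht with h | h
      · have h1 := w.2
        have h2 := C.ladder.col_boundaryEnd i
        have h3 : C.ladder.M = m + 1 := rfl
        rw [h, ← hs, h2] at h1
        split_ifs at h1 <;> omega
      · exact Subtype.ext h
    have en1 : C.ladder.entryState φ t (b + 1) = φ (Sum.inr v₁) :=
      C.ladder.entryState_of_isFirst hce rfl fun w hw ht => by rw [u1 w ht]
    have ex1 : C.ladder.exitState φ t (b + 1) = _ :=
      C.ladder.exitState_of_isLast (v := v₁) hce rfl fun w hw ht => by rw [u1 w ht]
    have e1 := hφ.terminus (v := v₁) (t := t) rfl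
    rw [hg, zero_add, hside rfl rfl, ← ex1] at e1
    have hbs : C.state φ (t + 1) b = C.state φ t b := by
      rw [← entry_eq_iff (σ := C.orient), entry_state, entry_state', en1, e1]
    have hb' : φ (Sum.inr v₁) = C.state φ t b := by
      rw [e1, ← entry_state', entry_swap_of_eq hbs]
    refine ⟨⟨?_, funext fun c => ?_⟩, fun v hv => ?_⟩
    · change φ (Sum.inl i) = _
      rw [hφ.source hs, hgI i ((hlabI i rfl).1 rfl), zero_add, hrung,
        show C.ladder.vtx (t, true) = Sum.inr v₁ from C.ladder.vtx_eq_inr.2 rfl, hb']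
      simp [Gate.weight, hb]
    · by_cases hcb : c = b
      · rw [hcb, hbs]
      · refine hun c ?_ ?_
        · simp only [Gate.startCol]; split_ifs <;> omega
        · simp only [Gate.endCol]; omega
    · obtain rfl := u1 v (congrArg Fin.val hv)
      exact hentry en1.symm b.2
  | sink i w =>
    set a := Gate.boundaryCol n₁ m i with ha
    have hs : C.ladder.boundaryEnd i = (t, true) := hlab i rfl
    set v₀ : C.ladder.V := ⟨(t, false), by
      rw [hcs]; change _ ∧ _ < m + 1 + 1; simp only [Gate.startCol]; omega⟩
    have u0 : ∀ w : C.ladder.V, w.1.1.val = t → w = v₀ := by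
      intro w ht
      rcases C.end_cases t w ht with h | h
      · exact Subtype.ext h
      · have h1 := w.2
        have h2 := C.ladder.col_boundaryEnd i
        have h3 : C.ladder.M = m + 1 := rfl
        rw [h, ← hs, h2] at h1
        split_ifs at h1 <;> omega
    have en0 : C.ladder.entryState φ t (a + 1) = φ (Sum.inr v₀) :=
      C.ladder.entryState_of_isFirst hcs rfl fun w hw ht => by rw [u0 w ht]
    have ex0 : C.ladder.exitState φ t (a + 1) = _ :=
      C.ladder.exitState_of_isLast (v := v₀) hcs rfl fun w hw ht => by rw [u0 w ht]
    have e0 := hφ.start (v := v₀) (t := t) rfl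
    rw [hg, zero_add, hside rfl rfl, ← ex0, hrung, show C.ladder.vtx (t, true) = Sum.inl i from
      C.ladder.vtx_eq_inl.2 hs.symm] at e0
    refine ⟨⟨?_, fun c hc => ?_⟩, fun v hv => ?_⟩
    · rw [entry_state, entry_state', en0, e0, add_comm]
      rfl
    · refine hun c ?_ ?_
      · simp only [Gate.startCol]; omega
      · simp only [Gate.endCol]; split_ifs <;> omega
    · obtain rfl := u0 v (congrArg Fin.val hv)
      exact hentry en0.symm a.2

/-- The bump on the column supplies the vertex that the relation for ladders needs. -/
theorem state_wrap (c : Fin (m + 1)) :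
    C.state φ 0 c = RatFunc.X * C.state φ C.gates.length c := by
  refine C.ladder.state_wrap ?_
  obtain ⟨w, w', hw⟩ := C.exists_bump c
  obtain ⟨t, ht⟩ := List.mem_iff_get.1 hw
  have h : C.ladder.col (t, false) = c + 1 := by
    rw [C.col_start, gate, ht]; rfl
  exact ⟨⟨(t, false), by rw [h]; change _ ∧ _ < m + 1 + 1; omega⟩, h⟩

end Circuit

end AnnularNetwork

/-! ### From runs of a circuit to boundary measurements. -/

namespace AnnularNetwork

theorem ite_decidable_eq {α : Sort*} {p : Prop} {d d' : Decidable p} {a b : α} :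
    @ite α p d a b = @ite α p d' a b := by congr

/-- `s 0, s 1, …` are potentials of the columns below the gates of a list. -/
def IsRun {n m : ℕ} (n₁ : ℕ) (σ : Fin (m + 1) → ℤ) (δ : Fin n → RatFunc ℝ) :
    List (Gate n m) → (ℕ → Fin (m + 1) → RatFunc ℝ) → Prop
  | [], _ => True
  | g :: G, s => g.Step n₁ σ δ (s 0) (s 1) ∧ IsRun n₁ σ δ G fun t => s (t + 1)

theorem isRun_of_step {n m n₁ : ℕ} {σ : Fin (m + 1) → ℤ} {δ : Fin n → RatFunc ℝ}
    {G : List (Gate n m)} {s : ℕ → Fin (m + 1) → RatFunc ℝ}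
    (h : ∀ t : Fin G.length, (G.get t).Step n₁ σ δ (s t) (s (t + 1))) : IsRun n₁ σ δ G s := by
  induction G generalizing s with
  | nil => trivial
  | cons g G ih => exact ⟨h ⟨0, by simp⟩, ih fun t => h t.succ⟩

namespace Circuit

variable {n₁ n₂ m : ℕ} {I : Finset (Fin (n₁ + n₂))} (C : Circuit n₁ n₂ m I)

theorem isPotential_iff {g φ : Fin (n₁ + n₂) ⊕ C.ladder.V → RatFunc ℝ} :
    C.ladder.IsPotential C.modWeight g φ ↔ ∀ u, φ u = g u + ∑ e : Fin C.ladder.T ⊕ C.ladder.V,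
      if C.ladder.src e = u then C.ladder.diagram.modifiedWeight C.edgeWeight e *
        φ (C.ladder.tgt e) else 0 := by
  rw [modifiedWeight_eq]; rfl

theorem isRun_state {g φ : Fin (n₁ + n₂) ⊕ C.ladder.V → RatFunc ℝ}
    (hφ : C.ladder.IsPotential C.modWeight g φ) (hg : ∀ v, g (Sum.inr v) = 0)
    (hgI : ∀ i ∈ I, g (Sum.inl i) = 0) :
    IsRun n₁ C.orient (fun i => φ (Sum.inl i)) C.gates (C.state φ) :=
  isRun_of_step fun t => (step hφ hg hgI t).1

/-- No edge leaves a sink, so its equation contains only the source term. -/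
theorem sink_eq {g φ : Fin (n₁ + n₂) ⊕ C.ladder.V → RatFunc ℝ}
    (hφ : C.ladder.IsPotential C.modWeight g φ) {i : Fin (n₁ + n₂)} (hi : i ∉ I) :
    φ (Sum.inl i) = g (Sum.inl i) := by
  refine hφ.sink (t := C.labelGate i) ?_
  have h := C.isSink_labelGate i
  have : (C.gate (C.labelGate i)).isSink = true := by
    rw [← Bool.not_eq_false]; exact fun h' => hi (h.1 h')
  rw [← this]

/-- The boundary measurements of a circuit can be computed from its runs. -/
theorem exists_network
    (hzero : ∀ (δ : Fin (n₁ + n₂) → RatFunc ℝ) (s : ℕ → Fin (m + 1) → RatFunc ℝ),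
      IsRun n₁ C.orient δ C.gates s → (∀ c, s 0 c = RatFunc.X * s C.gates.length c) →
      (∀ i ∉ I, δ i = 0) → (∀ t ≤ C.gates.length, ∀ c, s t c = 0) ∧ ∀ i, δ i = 0)
    (F : Fin (n₁ + n₂) → Fin (n₁ + n₂) → RatFunc ℝ)
    (hF : ∀ i ∈ I, ∀ j ∉ I, ∀ (δ : Fin (n₁ + n₂) → RatFunc ℝ) (s : ℕ → Fin (m + 1) → RatFunc ℝ),
      IsRun n₁ C.orient δ C.gates s → (∀ c, s 0 c = RatFunc.X * s C.gates.length c) →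
      (∀ l ∉ I, δ l = if l = j then 1 else 0) → δ i = Ladder.closingSign n₁ i j * F i j) :
    ∃ N : Network n₁ n₂ I, ∃ w : N.E → ℝ, (∀ e, w e ≠ 0) ∧
      ∀ i ∈ I, ∀ j ∉ I, N.BoundaryMeasurementEq w i j (F i j) := by
  let _ : Fintype C.ladder.diagram.E := inferInstanceAs (Fintype (Fin C.ladder.T ⊕ C.ladder.V))
  let _ : Fintype C.ladder.diagram.V := inferInstanceAs (Fintype C.ladder.V)
  have hsign : ∀ e, C.ladder.diagram.edgeSign e * C.ladder.diagram.edgeSign e = 1 :=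
    fun e => paritySign_mul_self _
  refine ⟨C.ladder.network I C.mem_iff,
    -- The weights of the network carry the edge signs, which cancel those of the paths.
    fun e => C.ladder.diagram.edgeSign e * C.edgeWeight e, fun e => ?_, fun i hi j hj => ?_⟩
  · refine mul_ne_zero ?_ (C.edgeWeight_ne e)
    have h : C.ladder.diagram.edgeSign e ≠ 0 := fun h => by simpa [h] using hsign e
    exact_mod_cast h
  · refine C.ladder.diagram.boundaryMeasurementEq_of_system C.ladder.diagram.edgeSign hsign
      (Ladder.closingSign n₁ i j) (Ladder.closingSign_mul_self _ _ _) i j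
      (fun P hP => C.ladder.pathSign_eq (ne_of_mem_of_not_mem hi hj) hP) C.edgeWeight ?_ (F i j) ?_
    · intro φ hφ
      have hφ' : C.ladder.IsPotential C.modWeight (fun _ => 0) φ :=
        C.isPotential_iff.2 fun u => by
          exact (hφ u).trans ((Finset.sum_congr rfl fun e _ =>
            ite_decidable_eq).trans (zero_add _).symm)
      obtain ⟨h1, h2⟩ := hzero _ _ (C.isRun_state hφ' (fun _ => rfl) fun _ _ => rfl)
        state_wrap fun i hi => C.sink_eq hφ' hi
      funext u
      rcases u with i | v
      · exact h2 i
      -- The potential of an internal vertex is an entry of a state next to its rung, so vanishing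
      -- states leave no room for a nonzero potential.
      · obtain ⟨c, hc | hc⟩ := (step hφ' (fun _ => rfl) (fun _ _ => rfl) v.1.1).2 v rfl
        · exact hc.trans (h1 _ v.1.1.2.le c)
        · exact hc.trans (h1 _ v.1.1.2 c)
    · intro φ hφ
      have hφ' : C.ladder.IsPotential C.modWeight
          (fun u => if u = Sum.inl j then 1 else 0) φ := C.isPotential_iff.2 fun u =>
            (hφ u).trans (congrArg₂ (· + ·) (ite_decidable_eq)
              (Finset.sum_congr rfl fun e _ => ite_decidable_eq))
      refine hF i hi j hj _ _ (C.isRun_state hφ' (fun _ => if_neg Sum.inr_ne_inl) fun l hl => ?_)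
        state_wrap fun l hl => ?_
      · exact if_neg fun h => ne_of_mem_of_not_mem hl hj (Sum.inl.inj h)
      · rw [C.sink_eq hφ' hl]
        simp

end Circuit

end AnnularNetwork

namespace AnnularNetwork

/-! ### Circuits for invertible matrices -/

theorem isRun_append {n m n₁ : ℕ} {σ : Fin (m + 1) → ℤ} {δ : Fin n → RatFunc ℝ}
    {L L' : List (Gate n m)} {s : ℕ → Fin (m + 1) → RatFunc ℝ} :
    IsRun n₁ σ δ (L ++ L') s ↔ IsRun n₁ σ δ L s ∧ IsRun n₁ σ δ L' fun t => s (t + L.length) := by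
  induction L generalizing s with
  | nil => simp [IsRun]
  | cons g L ih =>
    rw [List.cons_append, IsRun, IsRun, ih, and_assoc]
    rfl

/-- A list of gates without boundary vertices acts on the potentials as a matrix. -/
structure Realizes {n m : ℕ} (σ : Fin (m + 1) → ℤ) (L : List (Gate n m))
    (G : Matrix (Fin (m + 1)) (Fin (m + 1)) ℝ) : Prop where
  valid : ∀ g ∈ L, g.Valid
  label : ∀ g ∈ L, g.label = none
  mulVec : ∀ {n₁ : ℕ} {δ : Fin n → RatFunc ℝ} {s}, IsRun n₁ σ δ L s →
    s L.length = (G.map RatFunc.C).mulVec (s 0)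
  zero : ∀ {n₁ : ℕ} {δ : Fin n → RatFunc ℝ} {s}, IsRun n₁ σ δ L s → s 0 = 0 →
    ∀ t ≤ L.length, s t = 0

namespace Realizes

variable {n m : ℕ} {σ : Fin (m + 1) → ℤ}

theorem one : Realizes σ ([] : List (Gate n m)) 1 where
  valid := by simp
  label := by simp
  mulVec _ := by simp
  zero _ h0 t ht := by rwa [Nat.le_zero.1 ht]

/-- Gates are listed upwards, so the right factor of a product comes first. -/
theorem mul {L L' : List (Gate n m)} {G G' : Matrix (Fin (m + 1)) (Fin (m + 1)) ℝ}
    (h : Realizes σ L G) (h' : Realizes σ L' G') : Realizes σ (L' ++ L) (G * G') where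
  valid g hg := (List.mem_append.1 hg).elim (h'.valid g) (h.valid g)
  label g hg := (List.mem_append.1 hg).elim (h'.label g) (h.label g)
  mulVec {_ _ s} hs := by
    obtain ⟨h1, h2⟩ := isRun_append.1 hs
    have e := h.mulVec h2
    simp only [zero_add] at e
    rw [List.length_append, Nat.add_comm L'.length, e, h'.mulVec h1, Matrix.mulVec_mulVec, Matrix.map_mul]
  zero {_ _ s} hs h0 t ht := by
    obtain ⟨h1, h2⟩ := isRun_append.1 hs
    rcases le_total t L'.length with hl | hl
    · exact h'.zero h1 h0 t hl
    · rw [List.length_append] at ht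
      have e := h.zero h2 (by simpa using h'.zero h1 h0 _ le_rfl) (t - L'.length) (by omega)
      simpa only [Nat.sub_add_cancel hl] using e

theorem singleton {g : Gate n m} {G : Matrix (Fin (m + 1)) (Fin (m + 1)) ℝ} (hg : g.Valid)
    (hl : g.label = none)
    (h : ∀ {n₁ : ℕ} {δ : Fin n → RatFunc ℝ} {s s'}, g.Step n₁ σ δ s s' →
      s' = (G.map RatFunc.C).mulVec s) : Realizes σ [g] G where
  valid := by simpa using hg
  label := by simpa using hl
  mulVec hs := h hs.1
  zero {_ _ s} hs h0 t ht := by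
    have h1 : s 1 = 0 := by rw [h hs.1, h0, Matrix.mulVec_zero]
    rw [List.length_singleton] at ht
    interval_cases t
    · exact h0
    · exact h1

end Realizes

/-- A matrix can be realized by gates. -/
def Realizable (n : ℕ) {m : ℕ} (σ : Fin (m + 1) → ℤ)
    (G : Matrix (Fin (m + 1)) (Fin (m + 1)) ℝ) : Prop := ∃ L : List (Gate n m), Realizes σ L G

namespace Realizable

variable {n m : ℕ} {σ : Fin (m + 1) → ℤ}

theorem one : Realizable n σ (1 : Matrix (Fin (m + 1)) (Fin (m + 1)) ℝ) := ⟨[], Realizes.one⟩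

theorem mul {G G' : Matrix (Fin (m + 1)) (Fin (m + 1)) ℝ} :
    Realizable n σ G → Realizable n σ G' → Realizable n σ (G * G')
  | ⟨_, h⟩, ⟨_, h'⟩ => ⟨_, h.mul h'⟩

theorem map_transvection_mulVec {a b : Fin (m + 1)} (c : ℝ) (s : Fin (m + 1) → RatFunc ℝ) :
    ((Matrix.transvection a b c).map RatFunc.C).mulVec s =
      Function.update s a (s a + RatFunc.C c * s b) := by
  have h : (Matrix.transvection a b c).map RatFunc.C = 1 + Matrix.single a b (RatFunc.C c) := by
    rw [Matrix.transvection, Matrix.map_add _ (map_add _), Matrix.map_one _ (map_zero _) (map_one _),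
      Matrix.map_single]
  rw [h, Matrix.add_mulVec, Matrix.one_mulVec, Matrix.single_mulVec]
  funext i
  by_cases hi : i = a
  · subst hi; simp
  · simp [hi]

theorem transvection_of_adjacent {a b : Fin (m + 1)} (hab : a.val + 1 = b.val ∨ b.val + 1 = a.val)
    (c : ℝ) : Realizable n σ (Matrix.transvection a b c) := by
  -- A rung of weight `0` is not allowed; the empty list takes its place.
  by_cases hc : c = 0
  · rw [hc, Matrix.transvection_zero]; exact one
  -- On an upward column the relation gives the lower state in terms of the upper one; solving for
  -- the upper state changes the sign of the weight.
  refine ⟨[Gate.rung a b (if σ a = 1 then -c else c)], Realizes.singleton ⟨hab, ?_⟩ rfl ?_⟩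
  · split_ifs
    · exact neg_ne_zero.2 hc
    · exact hc
  · rintro _ δ s s' ⟨h1, h2⟩
    rw [map_transvection_mulVec]
    funext i
    by_cases hi : i = a
    · subst hi
      rw [Function.update_self]
      simp only [entry] at h1
      split_ifs at h1
      · rw [h1, map_neg]; ring
      · exact h1
    · rw [Function.update_of_ne hi, h2 i hi]

/-- The commutator relation of elementary matrices. It replaces a rung between distant columns,
which would have to cross the columns between them. -/
theorem transvection_commutator {R ι : Type*} [CommRing R] [Fintype ι] [DecidableEq ι]
    {i j k : ι} (hij : i ≠ j) (hjk : j ≠ k) (hik : i ≠ k) (c : R) :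
    Matrix.transvection i k c = Matrix.transvection i j c * Matrix.transvection j k 1 *
      (Matrix.transvection i j (-c) * Matrix.transvection j k (-1)) := by
  simp only [Matrix.transvection, mul_add, add_mul, one_mul, mul_one,
    Matrix.single_mul_single_same, Matrix.single_mul_single_of_ne _ _ _ _ hij.symm,
    Matrix.single_mul_single_of_ne _ _ _ _ hjk.symm, Matrix.single_mul_single_of_ne _ _ _ _ hik.symm,
    add_zero]
  ext a b
  simp only [Matrix.add_apply, Matrix.single_apply]
  split_ifs <;> ring

theorem transvection {a b : Fin (m + 1)} (hab : a ≠ b) (c : ℝ) :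
    Realizable n σ (Matrix.transvection a b c) := by
  -- With truncated subtraction this is the distance of the columns. The induction inserts a column
  -- strictly between them.
  obtain ⟨d, hd⟩ : ∃ d, (a.val - b.val) + (b.val - a.val) = d := ⟨_, rfl⟩
  induction d using Nat.strong_induction_on generalizing a b c with
  | _ d ih =>
    have hab' : a.val ≠ b.val := fun h => hab (Fin.ext h)
    by_cases h : a.val + 1 = b.val ∨ b.val + 1 = a.val
    · exact transvection_of_adjacent h c
    · obtain ⟨j, hj⟩ : ∃ j : Fin (m + 1),
          (a.val < j.val ∧ j.val < b.val) ∨ (b.val < j.val ∧ j.val < a.val) := by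
        rcases lt_or_gt_of_ne hab' with h1 | h1
        · exact ⟨⟨a + 1, by omega⟩, Or.inl ⟨by simp, by simp; omega⟩⟩
        · exact ⟨⟨b + 1, by omega⟩, Or.inr ⟨by simp, by simp; omega⟩⟩
      have haj : a ≠ j := by rintro rfl; omega
      have hjb : j ≠ b := by rintro rfl; omega
      rw [transvection_commutator haj hjb hab]
      exact ((ih _ (by omega) haj _ rfl).mul (ih _ (by omega) hjb _ rfl)).mul
        ((ih _ (by omega) haj _ rfl).mul (ih _ (by omega) hjb _ rfl))

theorem diagonal_update {a : Fin (m + 1)} {z : ℝ} (hz : z ≠ 0) :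
    Realizable n σ (Matrix.diagonal (Function.update 1 a z)) := by
  -- On an upward column the bump multiplies the upper potential to give the lower one, so the
  -- factor has to be inverted. Two equal halves keep both weights nonzero.
  set y : ℝ := (if σ a = 1 then z⁻¹ else z) with hy
  have hy0 : y / 2 ≠ 0 := by rw [hy]; split_ifs <;> simpa
  refine ⟨[Gate.bump a (y / 2) (y / 2)], Realizes.singleton ⟨hy0, hy0⟩ rfl ?_⟩
  rintro _ δ s s' ⟨h1, h2⟩
  rw [Matrix.diagonal_map (map_zero _)]
  funext i
  rw [Matrix.mulVec_diagonal]
  by_cases hi : i = a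
  · subst hi
    rw [add_halves] at h1
    simp only [Function.update_self]
    simp only [entry] at h1
    split_ifs at h1 with h
    · rw [h1, hy, if_pos h, ← mul_assoc, ← map_mul, mul_inv_cancel₀ hz, map_one, one_mul]
    · rw [h1, hy, if_neg h]
  · simp [Function.update_of_ne hi, h2 i hi]

theorem diagonal {D : Fin (m + 1) → ℝ} (hD : ∀ i, D i ≠ 0) :
    Realizable n σ (Matrix.diagonal D) := by
  have key : ∀ S : Finset (Fin (m + 1)),
      Realizable n σ (Matrix.diagonal fun i => if i ∈ S then D i else 1) := by
    intro S
    induction S using Finset.induction_on with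
    | empty => simpa using one
    | insert a S ha ih =>
      have := (diagonal_update (n := n) (σ := σ) (a := a) (hD a)).mul ih
      rw [Matrix.diagonal_mul_diagonal] at this
      refine (congrArg (fun d => Realizable n σ (Matrix.diagonal d)) (funext fun i => ?_)).mpr this
      by_cases hi : i = a
      · subst hi; simp [ha]
      · simp [hi]
  simpa using key Finset.univ

/-- Every invertible matrix can be realized by gates. -/
theorem of_det_ne_zero {G : Matrix (Fin (m + 1)) (Fin (m + 1)) ℝ} (hG : G.det ≠ 0) :
    Realizable n σ G := by
  refine Matrix.diagonal_transvection_induction_of_det_ne_zero _ G hG (fun D hD => ?_)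
    (fun t => ?_) fun A B _ _ hA hB => hA.mul hB
  · rw [Matrix.det_diagonal, Finset.prod_ne_zero_iff] at hD
    exact diagonal fun i => hD i (Finset.mem_univ i)
  · exact transvection t.hij t.c

end Realizable

end AnnularNetwork

namespace AnnularNetwork

/-! ### Blocks: one boundary vertex of a circuit -/

/-- Replace by `v` the row of the identity matrix at an index `z` with `v z ≠ 0`, then swap the rows
`b` and `z`. The determinant is `v z` up to sign. -/
theorem exists_det_ne_zero_row {ι : Type*} [Fintype ι] [DecidableEq ι] {v : ι → ℝ} (hv : v ≠ 0)
    (b : ι) : ∃ H : Matrix ι ι ℝ, H.det ≠ 0 ∧ H b = v := by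
  obtain ⟨z, hz⟩ := Function.ne_iff.1 hv
  refine ⟨((1 : Matrix ι ι ℝ).updateRow z v).submatrix (Equiv.swap b z) id, ?_, ?_⟩
  · rw [Matrix.det_permute, ← Matrix.cramer_transpose_apply, Matrix.transpose_one,
      Matrix.cramer_one]
    refine mul_ne_zero ?_ hz
    rcases Int.units_eq_one_or (Equiv.Perm.sign (Equiv.swap b z)) with h | h <;> simp [h]
  · funext c
    simp

variable {n m : ℕ} {n₁ : ℕ} {σ : Fin (m + 1) → ℤ}

theorem filterMap_label_eq_nil {L : List (Gate n m)} (h : ∀ g ∈ L, g.label = none) :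
    L.filterMap Gate.label = [] := List.filterMap_eq_nil_iff.2 h

/-- A boundary gate can be conjugated by an invertible matrix. -/
theorem exists_conjugate {g : Gate n m} (hg : g.Valid) {i : Fin n} (hi : g.label = some i)
    {H : Matrix (Fin (m + 1)) (Fin (m + 1)) ℝ} (hH : H.det ≠ 0) :
    ∃ L : List (Gate n m), (∀ g ∈ L, g.Valid) ∧ L.filterMap Gate.label = [i] ∧ g ∈ L ∧
      ∀ {δ : Fin n → RatFunc ℝ} {s}, IsRun n₁ σ δ L s →
        ∃ x, g.Step n₁ σ δ ((H.map RatFunc.C).mulVec (s 0)) x ∧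
          s L.length = (H⁻¹.map RatFunc.C).mulVec x ∧
          (s 0 = 0 → x = 0 → ∀ t ≤ L.length, s t = 0) := by
  obtain ⟨A, hA⟩ := Realizable.of_det_ne_zero (n := n) (σ := σ) hH
  obtain ⟨B, hB⟩ := Realizable.of_det_ne_zero (n := n) (σ := σ) (G := H⁻¹)
    (Matrix.isUnit_nonsing_inv_det _ hH.isUnit).ne_zero
  refine ⟨A ++ g :: B, fun g' hg' => ?_, ?_, by simp, fun {δ s} hs => ?_⟩
  · rcases List.mem_append.1 hg' with h | h
    · exact hA.valid _ h
    · rcases List.mem_cons.1 h with rfl | h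
      · exact hg
      · exact hB.valid _ h
  · rw [List.filterMap_append, List.filterMap_cons, hi, filterMap_label_eq_nil hA.label,
      filterMap_label_eq_nil hB.label, List.nil_append]
  · obtain ⟨h1, h2, h3⟩ := isRun_append.1 hs
    have e1 := hA.mulVec h1
    have e2 := hB.mulVec h3
    have hlen : (A ++ g :: B).length = B.length + 1 + A.length := by simp; omega
    beta_reduce at h2
    rw [zero_add, e1] at h2
    refine ⟨_, h2, by rw [hlen]; exact e2, fun h0 hx t ht => ?_⟩
    rcases le_total t A.length with hl | hl
    · exact hA.zero h1 h0 t hl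
    · rcases hl.eq_or_lt with rfl | hl
      · exact hA.zero h1 h0 _ le_rfl
      · have e := hB.zero h3 hx (t - A.length - 1) (by omega)
        simpa only [show t - A.length - 1 + 1 + A.length = t by omega] using e

/-- A list of gates with the boundary vertex `i` that reads `v` if `i` is a source, and adds a
multiple of `u` to the potentials if `i` is a sink. -/
structure IsBlock (n₁ : ℕ) (σ : Fin (m + 1) → ℤ) (I : Finset (Fin n)) (v u : Fin (m + 1) → ℝ)
    (i : Fin n) (L : List (Gate n m)) : Prop where
  valid : ∀ g ∈ L, g.Valid
  label : L.filterMap Gate.label = [i]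
  source : i ∈ I → Gate.source i ∈ L
  sink : i ∉ I → ∃ w, Gate.sink i w ∈ L
  read : ∀ {δ : Fin n → RatFunc ℝ} {s}, IsRun n₁ σ δ L s → i ∈ I →
    δ i = ∑ c, RatFunc.C (v c) * s 0 c
  state : ∀ {δ : Fin n → RatFunc ℝ} {s}, IsRun n₁ σ δ L s → ∀ c,
    s L.length c = s 0 c + if i ∈ I then 0 else RatFunc.C (u c) * δ i
  zero : ∀ {δ : Fin n → RatFunc ℝ} {s}, IsRun n₁ σ δ L s → s 0 = 0 → (i ∉ I → δ i = 0) →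
    ∀ t ≤ L.length, s t = 0

theorem map_inv_mulVec_mulVec {H : Matrix (Fin (m + 1)) (Fin (m + 1)) ℝ} (hH : H.det ≠ 0)
    (x : Fin (m + 1) → RatFunc ℝ) :
    (H⁻¹.map RatFunc.C).mulVec ((H.map RatFunc.C).mulVec x) = x := by
  rw [Matrix.mulVec_mulVec, ← Matrix.map_mul, Matrix.nonsing_inv_mul _ hH.isUnit,
    Matrix.map_one _ (map_zero _) (map_one _), Matrix.one_mulVec]

/-- A source can only read its neighbouring column `b`, and a sink can only feed it. Conjugation by
a matrix with a prescribed row removes this restriction. -/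
theorem exists_isBlock (I : Finset (Fin n)) {v u : Fin (m + 1) → ℝ} (i : Fin n)
    (hv : i ∈ I → v ≠ 0) (hu : i ∉ I → u ≠ 0) : ∃ L, IsBlock n₁ σ I v u i L := by
  by_cases hi : i ∈ I
  · obtain ⟨H, hH, hrow⟩ := exists_det_ne_zero_row (hv hi) (Gate.boundaryCol n₁ m i)
    obtain ⟨L, h1, h2, h3, h4⟩ := exists_conjugate (n₁ := n₁) (σ := σ) (g := Gate.source i)
      trivial rfl hH
    refine ⟨L, h1, h2, fun _ => h3, fun h => absurd hi h, fun {δ s} hs _ => ?_,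
      fun {δ s} hs c => ?_, fun {δ s} hs h0 _ => ?_⟩
    all_goals obtain ⟨x, ⟨h5, h6⟩, h7, h8⟩ := h4 hs
    · rw [h5, ← hrow]; rfl
    · rw [h7, h6, map_inv_mulVec_mulVec hH, if_pos hi, add_zero]
    · exact h8 h0 (by rw [h6, h0, Matrix.mulVec_zero])
  · set b := Gate.boundaryCol n₁ m i with hb
    obtain ⟨H, hH, hrow⟩ := exists_det_ne_zero_row (hu hi) b
    -- Conjugating by the inverse of the transpose, the feed comes out as the column `b` of the
    -- transpose, that is, the row `u` of `H`.
    have hHt : (H.transpose)⁻¹.det ≠ 0 :=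
      (Matrix.isUnit_nonsing_inv_det _ (by rwa [Matrix.det_transpose, isUnit_iff_ne_zero])).ne_zero
    obtain ⟨L, h1, h2, h3, h4⟩ := exists_conjugate (n₁ := n₁) (σ := σ)
      (g := Gate.sink (m := m) i (if σ b = 1 then -1 else 1))
      (by rw [Gate.Valid]; split_ifs <;> norm_num) rfl hHt
    have key : ∀ {δ : Fin n → RatFunc ℝ} {s x},
        (Gate.sink (m := m) i (if σ b = 1 then -1 else 1)).Step n₁ σ δ s x →
        x = s + Pi.single b (δ i) := by
      rintro δ s x ⟨h5, h6⟩
      funext c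
      by_cases hc : c = b
      · rw [hc, Pi.add_apply, Pi.single_eq_same]
        simp only [entry, ← hb] at h5
        split_ifs at h5
        · rw [h5, map_neg, map_one]; ring
        · rw [h5, map_one, one_mul]
      · rw [Pi.add_apply, Pi.single_eq_of_ne hc, add_zero, h6 c hc]
    refine ⟨L, h1, h2, fun h => absurd h hi, fun _ => ⟨_, h3⟩, fun _ h => absurd h hi,
      fun {δ s} hs c => ?_, fun {δ s} hs h0 hδ => ?_⟩
    all_goals obtain ⟨x, h5, h7, h8⟩ := h4 hs
    · rw [h7, key h5, Matrix.mulVec_add, map_inv_mulVec_mulVec hHt, if_neg hi,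
        Matrix.nonsing_inv_nonsing_inv _ (by rwa [Matrix.det_transpose, isUnit_iff_ne_zero]),
        Matrix.mulVec_single, ← hrow]
      simp [mul_comm]
    · exact h8 h0 (by rw [key h5, h0, Matrix.mulVec_zero, hδ hi, Pi.single_zero, add_zero])

/-- The boundary vertices of a circuit act one after the other. -/
theorem isRun_flatMap {I : Finset (Fin n)} {v u : Fin n → Fin (m + 1) → ℝ}
    {B : Fin n → List (Gate n m)} (hB : ∀ i, IsBlock n₁ σ I (v i) (u i) i (B i))
    (hvu : ∀ i ∈ I, ∀ j ∉ I, ∀ c, v i c * u j c = 0) {δ : Fin n → RatFunc ℝ} (l : List (Fin n))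
    {s} (hs : IsRun n₁ σ δ (l.flatMap B) s) :
    (∀ i ∈ l, i ∈ I → δ i = ∑ c, RatFunc.C (v i c) * s 0 c) ∧
    (∀ c, s (l.flatMap B).length c =
      s 0 c + (l.map fun i => if i ∈ I then 0 else RatFunc.C (u i c) * δ i).sum) ∧
    (s 0 = 0 → (∀ i ∉ I, δ i = 0) → ∀ t ≤ (l.flatMap B).length, s t = 0) := by
  induction l generalizing s with
  | nil =>
    refine ⟨by simp, by simp, fun h0 _ t ht => ?_⟩
    obtain rfl : t = 0 := by simpa using ht
    exact h0
  | cons i l ih =>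
    rw [List.flatMap_cons] at hs ⊢
    obtain ⟨h1, h2⟩ := isRun_append.1 hs
    obtain ⟨ih1, ih2, ih3⟩ := ih h2
    have hst := (hB i).state h1
    simp only [zero_add] at ih1 ih2 ih3
    have hlen : (B i ++ l.flatMap B).length = (l.flatMap B).length + (B i).length := by
      simp [add_comm]
    refine ⟨fun j hj hjI => ?_, fun c => ?_, fun h0 hδ t ht => ?_⟩
    · rcases List.mem_cons.1 hj with rfl | hj
      · exact (hB j).read h1 hjI
      · rw [ih1 j hj hjI]
        refine Finset.sum_congr rfl fun c _ => ?_
        rw [hst, mul_add]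
        split_ifs with hi
        · rw [mul_zero, add_zero]
        -- What a lower sink has added is invisible to the source, which therefore reads the initial
        -- state.
        · rw [← mul_assoc, ← map_mul, hvu j hjI i hi, map_zero, zero_mul, add_zero]
    · have e := ih2 c
      rw [hst, ← hlen] at e
      rw [e, List.map_cons, List.sum_cons, add_assoc]
    · rcases le_total t (B i).length with hl | hl
      · exact (hB i).zero h1 h0 (hδ i) t hl
      · have e := ih3 ((hB i).zero h1 h0 (hδ i) _ le_rfl) hδ (t - (B i).length) (by omega)
        simpa only [Nat.sub_add_cancel hl] using e

/-- Bumps act on their own columns only. -/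
theorem isRun_map_bump {w w' : Fin (m + 1) → ℝ} {δ : Fin n → RatFunc ℝ} {l : List (Fin (m + 1))}
    (hl : l.Nodup) {s} (hs : IsRun n₁ σ δ (l.map fun c => Gate.bump c (w c) (w' c)) s) :
    (∀ c ∈ l, entry σ (s 0) (s l.length) c =
      RatFunc.C (w c + w' c) * entry σ (s l.length) (s 0) c) ∧
    (∀ c ∉ l, s l.length c = s 0 c) ∧
    ∀ t ≤ l.length, ∀ c, s t c = s 0 c ∨ s t c = s l.length c := by
  induction l generalizing s with
  | nil =>
    refine ⟨by simp, by simp, fun t ht c => ?_⟩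
    obtain rfl : t = 0 := by simpa using ht
    exact Or.inl rfl
  | cons a l ih =>
    obtain ⟨ha, hl⟩ := List.nodup_cons.1 hl
    obtain ⟨⟨h1, h2⟩, h3⟩ := hs
    obtain ⟨ih1, ih2, ih3⟩ := ih hl h3
    simp only [zero_add] at ih1 ih2 ih3
    simp only [List.length_cons]
    have entry_congr : ∀ {x x' y y' : Fin (m + 1) → RatFunc ℝ} {c}, x c = x' c → y c = y' c →
        entry σ x y c = entry σ x' y' c := by
      intro x x' y y' c h h'
      rw [entry, entry, h, h']
    refine ⟨fun c hc => ?_, fun c hc => ?_, fun t ht c => ?_⟩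
    · rcases List.mem_cons.1 hc with rfl | hc
      · rw [entry_congr rfl (ih2 c ha), entry_congr (ih2 c ha) rfl]
        exact h1
      · have hca : c ≠ a := fun h => ha (h ▸ hc)
        rw [entry_congr (h2 c hca).symm rfl, ih1 c hc, entry_congr rfl (h2 c hca)]
    · rw [List.mem_cons, not_or] at hc
      rw [ih2 c hc.2, h2 c hc.1]
    · rcases t with _ | t
      · exact Or.inl rfl
      · rcases ih3 t (by omega) c with h | h
        · by_cases hca : c = a
          · subst hca; rw [h, ← ih2 c ha]; exact Or.inr rfl
          · rw [h, h2 c hca]; exact Or.inl rfl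
        · exact Or.inr h

/-- The boundary vertices, by increasing height. -/
def labelList (n₁ n : ℕ) : List (Fin n) :=
  (List.finRange n).filter (fun i => i.val < n₁) ++
    ((List.finRange n).filter fun i => n₁ ≤ i.val).reverse

theorem mem_labelList (i : Fin n) : i ∈ labelList n₁ n := by
  simp only [labelList, List.mem_append, List.mem_reverse, List.mem_filter, List.mem_finRange,
    true_and, decide_eq_true_eq]
  exact lt_or_ge _ _

/-- Outer labels go up the right side and inner labels go down, hence the reversal. Labels on
different circles may come in any order. -/
theorem pairwise_labelList : (labelList n₁ n).Pairwise (LabelBelow n₁) := by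
  have hlt : (List.finRange n).Pairwise (· < ·) := List.pairwise_lt_finRange n
  rw [labelList, List.pairwise_append, List.pairwise_reverse]
  refine ⟨?_, ?_, ?_⟩
  · refine List.Pairwise.imp_of_mem ?_ (hlt.filter _)
    intro a b ha hb hab
    have h1 : a.val < n₁ := by simpa using ha
    exact ⟨hab.ne, fun _ _ => hab, fun h => absurd h1 h.not_gt⟩
  · refine List.Pairwise.imp_of_mem ?_ (hlt.filter _)
    intro a b ha hb hab
    have h1 : n₁ ≤ a.val := by simpa using ha
    exact ⟨hab.ne', fun _ h => absurd h1 h.not_ge, fun _ _ => hab⟩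
  · intro a ha b hb
    have h1 : a.val < n₁ := by simpa using ha
    have h2 : n₁ ≤ b.val := by simpa using hb
    exact ⟨fun h => by rw [h] at h1; omega, fun _ h => absurd h2 h.not_ge,
      fun h => absurd h1 h.not_gt⟩

theorem nodup_labelList : (labelList n₁ n).Nodup :=
  pairwise_labelList.imp fun h => h.1

theorem filterMap_flatMap_block {I : Finset (Fin n)} {v u : Fin n → Fin (m + 1) → ℝ}
    {B : Fin n → List (Gate n m)} (hB : ∀ i, IsBlock n₁ σ I (v i) (u i) i (B i))
    (l : List (Fin n)) : (l.flatMap B).filterMap Gate.label = l := by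
  induction l with
  | nil => rfl
  | cons i l ih => rw [List.flatMap_cons, List.filterMap_append, ih, (hB i).label]; rfl

end AnnularNetwork

namespace AnnularNetwork

/-! ### Circuits for matrices of rational functions -/

/-- The registers of a circuit: `d + 2` registers for every boundary vertex, and one that is
always zero. -/
abbrev Register (n d : ℕ) := Option (Fin n × Fin (d + 2))

variable {n d : ℕ}

/-- The matrix that shifts the registers of every boundary vertex, and evaluates a linear form at
the first one. -/
def companion (q : Fin (d + 2) → ℝ) : Matrix (Register n d) (Register n d) ℝ
  | none => Pi.single none 1
  | some (j, p) => Fin.cases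
      (fun r => r.elim 0 fun x => if x.1 = j then q x.2 else 0)
      (fun p => Pi.single (some (j, p.castSucc)) 1) p

theorem companion_mulVec {K : Type*} [Field K] (f : ℝ →+* K) (q : Fin (d + 2) → ℝ)
    (x : Register n d → K) :
    ((companion q).map f).mulVec x none = x none ∧
    ∀ j, ((companion q).map f).mulVec x (some (j, 0)) = ∑ p, f (q p) * x (some (j, p)) ∧
      ∀ p : Fin (d + 1),
        ((companion q).map f).mulVec x (some (j, p.succ)) = x (some (j, p.castSucc)) := by
  have single : ∀ r, ∑ r', f ((Pi.single r 1 : Register n d → ℝ) r') * x r' = x r := by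
    intro r
    simp [Pi.single_apply, apply_ite f]
  refine ⟨single none, fun j => ⟨?_, fun p => single _⟩⟩
  change ∑ r : Register n d, f (r.elim 0 fun x => if x.1 = j then q x.2 else 0) * x r = _
  rw [Fintype.sum_option, Fintype.sum_prod_type]
  simp [apply_ite f]

/-- On a vector of the kernel the shift makes all registers but the last ones vanish, and the linear
form then kills these since `q` does not vanish there. -/
theorem det_companion_ne_zero {q : Fin (d + 2) → ℝ} (hq : q (Fin.last _) ≠ 0) :
    (companion q : Matrix (Register n d) (Register n d) ℝ).det ≠ 0 := by
  intro h
  obtain ⟨x, hx, hx0⟩ := Matrix.exists_mulVec_eq_zero_iff.2 h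
  obtain ⟨h1, h2⟩ := companion_mulVec (RingHom.id ℝ) q x
  simp only [RingHom.coe_id, Matrix.map_id, hx0, Pi.zero_apply, id_eq] at h1 h2
  refine hx (funext fun r => ?_)
  rcases r with _ | ⟨j, p⟩
  · exact h1.symm
  · obtain ⟨h3, h4⟩ := h2 j
    cases p using Fin.lastCases with
    | cast p => exact (h4 p).symm
    | last =>
      rw [Fin.sum_univ_castSucc, Finset.sum_eq_zero fun p _ => by rw [← h4, mul_zero],
        zero_add] at h3
      exact (mul_eq_zero.1 h3.symm).resolve_left hq

/-- The solution of a chain of linear recursions. -/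
theorem chain_solution {a : Fin (d + 2) → RatFunc ℝ}
    (hlast : a (Fin.last _) = 0)
    (hshift : ∀ p : Fin (d + 1), p.succ ≠ Fin.last _ →
      a p.succ = RatFunc.X * a p.castSucc) :
    (∀ P : Polynomial ℝ, P.natDegree ≤ d → ∑ p : Fin (d + 2), RatFunc.C (P.coeff p) * a p =
      algebraMap _ (RatFunc ℝ) P * a 0) ∧
    ∀ p : Fin (d + 2), a 0 = 0 → a p = 0 := by
  have hpow : ∀ k : ℕ, ∀ hk : k < d + 1, a ⟨k, by omega⟩ = RatFunc.X ^ k * a 0 := by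
    intro k
    induction k with
    | zero => intro _; rw [pow_zero, one_mul]; rfl
    | succ k ih =>
      intro hk
      have e := hshift ⟨k, by omega⟩ (by
        intro h
        have := congrArg Fin.val h
        simp at this
        omega)
      have e' : a ⟨k + 1, by omega⟩ = RatFunc.X * a ⟨k, by omega⟩ := e
      rw [e', ih (by omega), pow_succ', mul_assoc]
  refine ⟨fun P hP => ?_, fun p h0 => ?_⟩
  · rw [Fin.sum_univ_castSucc, hlast, mul_zero, add_zero,
      P.as_sum_range' (d + 1) (by omega), map_sum, Finset.sum_mul, ← Fin.sum_univ_eq_sum_range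
        (fun k => algebraMap _ (RatFunc ℝ) (Polynomial.monomial k (P.coeff k)) * a 0)]
    refine Finset.sum_congr rfl fun p _ => ?_
    rw [← P.as_sum_range' (d + 1) (by omega)]
    have e : a p.castSucc = _ := hpow p p.2
    rw [e, ← Polynomial.C_mul_X_pow_eq_monomial, map_mul, map_pow, RatFunc.algebraMap_C,
      RatFunc.algebraMap_X, Fin.val_castSucc, mul_assoc]
  · cases p using Fin.lastCases with
    | last => exact hlast
    | cast p =>
      have e : a p.castSucc = _ := hpow p p.2
      rw [e, h0, mul_zero]

end AnnularNetwork

/-! ### The circuit that computes the fractions. -/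

namespace AnnularNetwork

/-- The registers that the last bumps separate from each other. -/
def IsReset {n d : ℕ} (r : Register n d) : Prop :=
  ∃ j, r = some (j, 0) ∨ r = some (j, Fin.last _)

/-- The columns with downward orientation. -/
def registerOrient {n d : ℕ} (r : Register n d) : ℤ :=
  if ∃ j, r = some (j, Fin.last _) then -1 else 1

/-- The linear form of the registers that is read by a source. -/
def readForm {n d : ℕ} (P : Fin n → Polynomial ℝ) (r : Register n d) : ℝ :=
  r.elim 1 fun x => (P x.1).coeff x.2

/-- The register fed by a sink. -/
def feedForm {n d : ℕ} (i : Fin n) (r : Register n d) : ℝ :=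
  if r = some (i, Fin.last _) then 1 else 0

/-- The coefficients of a common denominator, extended by `-1`. -/
def denomCoeff (d : ℕ) (Q : Polynomial ℝ) (p : Fin (d + 2)) : ℝ :=
  Q.coeff p - if p = Fin.last _ then 1 else 0

variable {n₁ n d m : ℕ} (e : Register n d ≃ Fin (m + 1)) (P : Fin n → Fin n → Polynomial ℝ)
  (Q : Polynomial ℝ) (B : Fin n → List (Gate n m)) (A : List (Gate n m))

/-- The last bumps of a circuit. -/
def resetBumps : List (Gate n m) := (List.finRange (m + 1)).map fun c =>
  Gate.bump c (if IsReset (e.symm c) then 1 else 1 / 2) (if IsReset (e.symm c) then -1 else 1 / 2)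

/-- The gates of a circuit for a matrix of rational functions. -/
def program (n₁ : ℕ) : List (Gate n m) := (labelList n₁ n).flatMap B ++ (A ++ resetBumps e)

/-- The potentials of the registers below the gates. -/
theorem program_spec {I : Finset (Fin n)} (hQ0 : Q ≠ 0) (hQ : Q.natDegree ≤ d)
    (hP : ∀ i j, (P i j).natDegree ≤ d)
    (hB : ∀ i, IsBlock n₁ (fun c => registerOrient (e.symm c)) I
      (fun c => readForm (P i) (e.symm c)) (fun c => feedForm i (e.symm c)) i (B i))
    (hA : Realizes (fun c => registerOrient (e.symm c)) A
      ((companion (denomCoeff d Q)).submatrix e.symm e.symm))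
    {δ : Fin n → RatFunc ℝ} {s : ℕ → Fin (m + 1) → RatFunc ℝ}
    (hs : IsRun n₁ (fun c => registerOrient (e.symm c)) δ (program e B A n₁) s)
    (hwrap : ∀ c, s 0 c = RatFunc.X * s (program e B A n₁).length c) :
    (∀ i ∈ I, algebraMap _ (RatFunc ℝ) Q * δ i =
      ∑ j, algebraMap _ (RatFunc ℝ) (P i j) * if j ∈ I then 0 else δ j) ∧
    ((∀ i ∉ I, δ i = 0) →
      (∀ t ≤ (program e B A n₁).length, ∀ c, s t c = 0) ∧ ∀ i, δ i = 0) := by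
  have hX : (RatFunc.X : RatFunc ℝ) ≠ 0 := RatFunc.X_ne_zero
  have hQ' : algebraMap _ (RatFunc ℝ) Q ≠ 0 := by
    simpa using hQ0
  set δ' : Fin n → RatFunc ℝ := fun j => if j ∈ I then 0 else δ j with hδ'
  obtain ⟨hs1, hs'⟩ := isRun_append.1 hs
  obtain ⟨hs2, hs3⟩ := isRun_append.1 hs'
  -- Sinks feed only the registers with index `d + 1`, and the polynomials that are read have degree
  -- at most `d`.
  obtain ⟨hread, hfeed, hzero1⟩ := isRun_flatMap hB (fun i _ j _ c => by
    rw [readForm, feedForm]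
    split_ifs with h
    · rw [h, Option.elim_some, mul_one]
      exact Polynomial.coeff_eq_zero_of_natDegree_lt (by
        rw [Fin.val_last]; exact Nat.lt_succ_of_le (hP i j))
    · rw [mul_zero]) (labelList n₁ n) hs1
  have hmid := hA.mulVec hs2
  have hzero2 := hA.zero hs2
  obtain ⟨hbump, -, hzero3⟩ := isRun_map_bump (List.nodup_finRange (m + 1)) hs3
  have hlen : (program e B A n₁).length =
      (List.finRange (m + 1)).length + A.length + ((labelList n₁ n).flatMap B).length := by
    simp only [program, resetBumps, List.length_append, List.length_map]
    omega
  simp only [zero_add] at hmid hzero2 hbump hzero3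
  rw [← hlen] at hbump hzero3
  set l₁ := ((labelList n₁ n).flatMap B).length
  set T := (program e B A n₁).length
  -- `a` is the state above all gates, and `y` below is the state between the companion matrix and
  -- the last bumps.
  set a : Register n d → RatFunc ℝ := fun r => s T (e r) with ha
  set y : Register n d → RatFunc ℝ := fun r => s (A.length + l₁) (e r) with hy
  have h0 : ∀ r, s 0 (e r) = RatFunc.X * a r := fun r => hwrap (e r)
  have h1 : ∀ r, s l₁ (e r) = RatFunc.X * a r + ∑ j, RatFunc.C (feedForm j r) * δ' j := by
    intro r
    rw [hfeed, h0, ← List.sum_toFinset _ nodup_labelList, show (labelList n₁ n).toFinset =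
      Finset.univ from Finset.eq_univ_of_forall fun i => List.mem_toFinset.2 (mem_labelList i)]
    congr 1
    refine Finset.sum_congr rfl fun j _ => ?_
    rw [e.symm_apply_apply, hδ']
    dsimp only
    split_ifs <;> simp
  have h1none : s l₁ (e none) = RatFunc.X * a none := by
    rw [h1]; simp [feedForm]
  have h1some : ∀ j p, s l₁ (e (some (j, p))) = RatFunc.X * a (some (j, p)) +
      if p = Fin.last _ then δ' j else 0 := by
    intro j p
    rw [h1]
    congr 1
    by_cases hp : p = Fin.last _
    · subst hp
      simp [feedForm, apply_ite RatFunc.C]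
    · simp [feedForm, hp]
  have h2 : ∀ r, y r = ((companion (denomCoeff d Q)).map RatFunc.C).mulVec
      (fun r => s l₁ (e r)) r := by
    intro r
    have := congrFun hmid (e r)
    rw [← Matrix.submatrix_map, Matrix.submatrix_mulVec_equiv] at this
    rw [hy]
    dsimp only
    rw [this, Function.comp_apply, e.symm_apply_apply, Equiv.symm_symm]
    rfl
  obtain ⟨hc1, hc2⟩ := companion_mulVec (n := n) RatFunc.C (denomCoeff d Q) fun r => s l₁ (e r)
  -- The weights `1` and `-1` cancel: the potential ahead of the bump is zero and the one behind it
  -- is free. The weights `1 / 2` and `1 / 2` act as the identity but still put a bump on the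
  -- column.
  have hb : ∀ r, (IsReset r → (if registerOrient r = 1 then y r else a r) = 0) ∧
      (¬ IsReset r → a r = y r) := by
    intro r
    have := hbump (e r) (List.mem_finRange _)
    simp only [entry, e.symm_apply_apply] at this
    refine ⟨fun hr => ?_, fun hr => ?_⟩
    · rw [if_pos hr, if_pos hr, add_neg_cancel, map_zero, zero_mul] at this
      exact this
    · rw [if_neg hr, if_neg hr, add_halves, map_one, one_mul] at this
      split_ifs at this
      · exact this.symm
      · exact this
  -- This register goes round unchanged except for the factor `λ`, and `1 - λ ≠ 0`.
  have hnone : a none = 0 := by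
    have := (hb none).2 (by rintro ⟨j, h | h⟩ <;> cases h)
    rw [h2, hc1, h1none] at this
    have h3 : (1 - RatFunc.X) * a none = 0 := by linear_combination this
    refine (mul_eq_zero.1 h3).resolve_left fun h => ?_
    have h4 : algebraMap (Polynomial ℝ) (RatFunc ℝ) (1 - Polynomial.X) = 0 := by
      rw [map_sub, map_one, RatFunc.algebraMap_X, h]
    rw [map_eq_zero_iff _ (RatFunc.algebraMap_injective ℝ)] at h4
    have := congrArg (Polynomial.eval 0) h4
    simp at this
  -- These columns run downwards, so the vanishing potential is the one above the bump.
  have hlast : ∀ j, a (some (j, Fin.last _)) = 0 := by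
    intro j
    have := (hb (some (j, Fin.last _))).1 ⟨j, Or.inr rfl⟩
    have ho : registerOrient (some (j, Fin.last (d + 1))) = -1 := if_pos ⟨j, rfl⟩
    rwa [ho, if_neg (by norm_num)] at this
  -- These columns run upwards: the potential below the bump vanishes, while `a (some (j, 0))` stays
  -- the unknown of the chain.
  have hfirst : ∀ j, y (some (j, 0)) = 0 := by
    intro j
    have := (hb (some (j, 0))).1 ⟨j, Or.inl rfl⟩
    have ho : registerOrient (some (j, (0 : Fin (d + 2)))) = 1 := if_neg fun ⟨j', h⟩ =>
      absurd (congrArg Fin.val (Prod.mk.inj (Option.some.inj h)).2) (by simp)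
    rwa [ho, if_pos rfl] at this
  have hchain : ∀ j, _ := fun j => chain_solution (a := fun p => a (some (j, p))) (hlast j)
    (fun p hp => by
      have := (hb (some (j, p.succ))).2 (by
        rintro ⟨j', h | h⟩ <;> have h' := (Prod.mk.inj (Option.some.inj h)).2
        · exact Fin.succ_ne_zero _ h'
        · exact hp h')
      rw [this, h2, (hc2 j).2 p, h1some, if_neg (Fin.castSucc_ne_last p), add_zero])
  -- The vanishing first register below the bumps is the companion form. Its last coefficient is
  -- `-1` since `Q` has degree at most `d`, and it meets only the fed value `δ' j`; the other terms
  -- give `λ Q` times the unknown.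
  have hsolve : ∀ j, RatFunc.X * (algebraMap _ (RatFunc ℝ) Q * a (some (j, 0))) = δ' j := by
    intro j
    have h3 := hfirst j
    rw [h2, (hc2 j).1] at h3
    rw [← (hchain j).1 Q hQ, Finset.mul_sum]
    have h4 : ∀ p : Fin (d + 2), RatFunc.C (denomCoeff d Q p) * s l₁ (e (some (j, p))) =
        RatFunc.X * (RatFunc.C (Q.coeff p) * a (some (j, p))) -
          if p = Fin.last _ then δ' j else 0 := by
      intro p
      rw [h1some, denomCoeff]
      split_ifs with hp
      · subst hp
        rw [hlast, Polynomial.coeff_eq_zero_of_natDegree_lt (by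
          rw [Fin.val_last]; exact Nat.lt_succ_of_le hQ), zero_sub, map_neg, map_one]
        ring
      · rw [sub_zero]; ring
    rw [Finset.sum_congr rfl fun p _ => h4 p, Finset.sum_sub_distrib,
      Finset.sum_ite_eq' Finset.univ, if_pos (Finset.mem_univ _)] at h3
    exact sub_eq_zero.1 h3
  have hδI : ∀ i ∈ I, δ i =
      ∑ j, algebraMap _ (RatFunc ℝ) (P i j) * (RatFunc.X * a (some (j, 0))) := by
    intro i hi
    rw [hread i (mem_labelList i) hi, ← e.sum_comp, Fintype.sum_option, Fintype.sum_prod_type]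
    rw [h0, hnone, mul_zero, mul_zero, zero_add]
    refine Finset.sum_congr rfl fun j _ => ?_
    rw [mul_left_comm, ← (hchain j).1 (P i j) (hP i j), Finset.mul_sum]
    refine Finset.sum_congr rfl fun p _ => ?_
    rw [h0, e.symm_apply_apply]
    simp only [readForm, Option.elim_some]
    ring
  refine ⟨fun i hi => ?_, fun hδ => ?_⟩
  · rw [hδI i hi, Finset.mul_sum]
    refine Finset.sum_congr rfl fun j _ => ?_
    change _ = _ * δ' j
    rw [← hsolve j]
    ring
  · have hδ'0 : ∀ j, δ' j = 0 := by
      intro j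
      rw [hδ']
      dsimp only
      split_ifs with h
      · rfl
      · exact hδ j h
    have ha0 : ∀ j, a (some (j, 0)) = 0 := fun j =>
      (mul_eq_zero.1 ((mul_eq_zero.1 ((hsolve j).trans (hδ'0 j))).resolve_left hX)).resolve_left hQ'
    have hra : ∀ r, a r = 0 := by
      rintro (_ | ⟨j, p⟩)
      · exact hnone
      · exact (hchain j).2 p (ha0 j)
    have hT : s T = 0 := funext fun c => by
      have : s T (e (e.symm c)) = 0 := hra (e.symm c)
      rwa [e.apply_symm_apply] at this
    have hs0 : s 0 = 0 := funext fun c => by rw [hwrap, hT, Pi.zero_apply, mul_zero]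
    have hl := hzero1 hs0 hδ
    have hm := hzero2 (hl _ le_rfl)
    have hy0 := hm _ le_rfl
    refine ⟨fun t ht c => ?_, fun i => ?_⟩
    · rcases le_total t l₁ with h3 | h3
      · rw [hl t h3]; rfl
      · rcases le_total t (A.length + l₁) with h4 | h4
        · have h5 := hm (t - l₁) (by omega)
          rw [Nat.sub_add_cancel h3] at h5
          rw [h5]; rfl
        · have h5 := hzero3 (t - l₁ - A.length) (by omega) c
          rw [show t - l₁ - A.length + A.length + l₁ = t by omega] at h5
          rcases h5 with h5 | h5
          · rw [h5, hy0]; rfl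
          · rw [h5, hT]; rfl
    · by_cases hi : i ∈ I
      · rw [hδI i hi]
        exact Finset.sum_eq_zero fun j _ => by rw [ha0, mul_zero, mul_zero]
      · exact hδ i hi

end AnnularNetwork

/-! ### Assembly of the network. -/

namespace AnnularNetwork

theorem registerOrient_eq {n d : ℕ} (r : Register n d) :
    registerOrient r = 1 ∨ registerOrient r = -1 := by
  rw [registerOrient]
  split_ifs
  · exact Or.inr rfl
  · exact Or.inl rfl

theorem label_resetBumps {n d m : ℕ} (e : Register n d ≃ Fin (m + 1)) :
    ∀ g ∈ (resetBumps e : List (Gate n m)), g.label = none := by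
  intro g hg
  obtain ⟨c, -, rfl⟩ := List.mem_map.1 hg
  rfl

theorem valid_resetBumps {n d m : ℕ} (e : Register n d ≃ Fin (m + 1)) :
    ∀ g ∈ (resetBumps e : List (Gate n m)), g.Valid := by
  intro g hg
  obtain ⟨c, -, rfl⟩ := List.mem_map.1 hg
  rw [Gate.Valid]
  constructor <;> split_ifs <;> norm_num

/-- Every matrix of rational functions is represented by a network. -/
theorem exists_network_of_fractions {n₁ n₂ d : ℕ} (I : Finset (Fin (n₁ + n₂)))
    (F : Fin (n₁ + n₂) → Fin (n₁ + n₂) → RatFunc ℝ)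
    (P : Fin (n₁ + n₂) → Fin (n₁ + n₂) → Polynomial ℝ) {Q : Polynomial ℝ} (hQ0 : Q ≠ 0)
    (hQ : Q.natDegree ≤ d) (hP : ∀ i j, (P i j).natDegree ≤ d)
    (hF : ∀ i j, algebraMap _ (RatFunc ℝ) Q * (Ladder.closingSign n₁ i j * F i j) =
      algebraMap _ (RatFunc ℝ) (P i j)) :
    ∃ N : Network n₁ n₂ I, ∃ w : N.E → ℝ, (∀ e, w e ≠ 0) ∧
      ∀ i ∈ I, ∀ j ∉ I, N.BoundaryMeasurementEq w i j (F i j) := by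
  obtain ⟨m, ⟨e⟩⟩ : ∃ m, Nonempty (Register (n₁ + n₂) d ≃ Fin (m + 1)) :=
    ⟨(n₁ + n₂) * (d + 2), ⟨Fintype.equivFinOfCardEq (by simp)⟩⟩
  have hB : ∀ i, ∃ L : List (Gate (n₁ + n₂) m),
      IsBlock n₁ (fun c => registerOrient (e.symm c)) I (fun c => readForm (P i) (e.symm c))
        (fun c => feedForm i (e.symm c)) i L := by
    -- The always vanishing register has coefficient `1` in every form that is read. So these forms
    -- are nonzero even when all `P i j` vanish.
    refine fun i => exists_isBlock I i (fun _ h => ?_) (fun _ h => ?_)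
    · have := congrFun h (e none)
      simp [readForm] at this
    · have := congrFun h (e (some (i, Fin.last _)))
      simp [feedForm] at this
  choose B hB using hB
  -- The entry `-1` that extends the coefficients of `Q` makes the companion matrix invertible,
  -- whatever the degree of `Q`.
  have hdet : ((companion (denomCoeff d Q)).submatrix e.symm e.symm).det ≠ 0 := by
    rw [Matrix.det_submatrix_equiv_self]
    refine det_companion_ne_zero ?_
    rw [denomCoeff, if_pos rfl, Polynomial.coeff_eq_zero_of_natDegree_lt (by
      rw [Fin.val_last]; exact Nat.lt_succ_of_le hQ)]
    norm_num
  obtain ⟨A, hA⟩ := Realizable.of_det_ne_zero (n := n₁ + n₂)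
    (σ := fun c => registerOrient (e.symm c)) hdet
  have hmem : ∀ {i g}, g ∈ B i → g ∈ program e B A n₁ := fun {i g} h =>
    List.mem_append_left _ (List.mem_flatMap.2 ⟨i, mem_labelList i, h⟩)
  let C : Circuit n₁ n₂ m I :=
    { orient := fun c => registerOrient (e.symm c)
      orient_eq := fun c => registerOrient_eq _
      gates := program e B A n₁
      valid := by
        intro g hg
        rcases List.mem_append.1 hg with h | h
        · obtain ⟨i, -, hi⟩ := List.mem_flatMap.1 h
          exact (hB i).valid g hi
        · rcases List.mem_append.1 h with h | h
          · exact hA.valid g h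
          · exact valid_resetBumps e g h
      order := by
        have h : (program e B A n₁).filterMap Gate.label = labelList n₁ (n₁ + n₂) := by
          rw [program, List.filterMap_append, List.filterMap_append, filterMap_flatMap_block hB,
            filterMap_label_eq_nil hA.label, filterMap_label_eq_nil (label_resetBumps e),
            List.append_nil, List.append_nil]
        exact List.pairwise_filterMap.1 (h ▸ pairwise_labelList)
      exists_source := fun i hi => hmem ((hB i).source hi)
      exists_sink := fun i hi => ((hB i).sink hi).imp fun _ h => hmem h
      exists_bump := fun c => ⟨_, _, List.mem_append_right _ (List.mem_append_right _
        (List.mem_map_of_mem (List.mem_finRange c)))⟩ }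
  refine C.exists_network (fun δ s hs hw hδ => ?_) F fun i hi j hj δ s hs hw hδ => ?_
  · exact (program_spec e P Q B A hQ0 hQ hP hB hA hs hw).2 hδ
  · have h := (program_spec e P Q B A hQ0 hQ hP hB hA hs hw).1 i hi
    have h1 : ∀ l, (if l ∈ I then 0 else δ l) = if l = j then 1 else 0 := by
      intro l
      by_cases hl : l ∈ I
      · rw [if_pos hl, if_neg (ne_of_mem_of_not_mem hl hj)]
      · rw [if_neg hl, hδ l hl]
    simp only [h1, mul_ite, mul_one, mul_zero, Finset.sum_ite_eq', Finset.mem_univ, if_true] at h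
    rw [← hF i j] at h
    exact mul_left_cancel₀ (by simpa using hQ0) h

/-- Finitely many rational functions have a common denominator. -/
theorem exists_common_denominator {ι : Type*} [Finite ι] (f : ι → RatFunc ℝ) :
    ∃ (Q : Polynomial ℝ) (P : ι → Polynomial ℝ), Q ≠ 0 ∧
      ∀ i, algebraMap _ (RatFunc ℝ) Q * f i = algebraMap _ (RatFunc ℝ) (P i) := by
  obtain ⟨b, hb⟩ := IsLocalization.exist_integer_multiples_of_finite
    (nonZeroDivisors (Polynomial ℝ)) f
  choose P hP using hb
  refine ⟨b, P, nonZeroDivisors.coe_ne_zero b, fun i => ?_⟩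
  rw [hP i, ← Algebra.smul_def]

theorem exists_network (n₁ n₂ : ℕ) (I : Finset (Fin (n₁ + n₂)))
    (F : Fin (n₁ + n₂) → Fin (n₁ + n₂) → RatFunc ℝ) :
    ∃ N : Network n₁ n₂ I, ∃ w : N.E → ℝ, (∀ e, w e ≠ 0) ∧
      ∀ i ∈ I, ∀ j ∉ I, N.BoundaryMeasurementEq w i j (F i j) := by
  obtain ⟨Q, P, hQ0, hP⟩ := exists_common_denominator
    fun x : Fin (n₁ + n₂) × Fin (n₁ + n₂) => Ladder.closingSign n₁ x.1 x.2 * F x.1 x.2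
  -- A crude common bound for all degrees; any bound would do.
  refine exists_network_of_fractions (d := Q.natDegree + ∑ x, (P x).natDegree) I F
    (fun i j => P (i, j)) hQ0 (Nat.le_add_right _ _) (fun i j => ?_) fun i j => hP (i, j)
  exact (Finset.single_le_sum (f := fun x => (P x).natDegree) (fun _ _ => Nat.zero_le _)
    (Finset.mem_univ (i, j))).trans (Nat.le_add_left _ _)

end AnnularNetwork

end

theorem theorem3p6 (n₁ n₂ k m : ℕ) (I : Finset (Fin (n₁ + n₂)))
    (hI : I.card = k) (hJ : Iᶜ.card = m) (F : Matrix (Fin k) (Fin m) (RatFunc ℝ)) :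
    ∃ N : AnnularNetwork.Network n₁ n₂ I, N.Represents hI hJ F := by
  -- The matrix is extended by zero to all pairs of labels; only pairs of a source and a sink
  -- matter.
  obtain ⟨N, w, hw, h⟩ := AnnularNetwork.exists_network n₁ n₂ I fun i j =>
    if hij : i ∈ I ∧ j ∈ Iᶜ then
      F ((I.orderIsoOfFin hI).symm ⟨i, hij.1⟩) ((Iᶜ.orderIsoOfFin hJ).symm ⟨j, hij.2⟩) else 0
  refine ⟨N, w, hw, fun p q => ?_⟩
  have hp := I.orderEmbOfFin_mem hI p
  have hq := Iᶜ.orderEmbOfFin_mem hJ q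
  have e := h _ hp _ (Finset.mem_compl.1 hq)
  rw [dif_pos ⟨hp, hq⟩] at e
  convert e
  · exact ((I.orderIsoOfFin hI).symm_apply_apply p).symm
  · exact ((Iᶜ.orderIsoOfFin hJ).symm_apply_apply q).symm
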